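/- Let $n\ge 1$ be an integer and let $p>1$, with $p\le n/(n-2)$ if $n\ge 3$. Let $T\in(0,\infty]$ and let $g$ be a kernel with $g(t)>0$ for $0<t<T$ and $g\in L^1(0,t)$ for every $t\in(0,T)$. Write $(g*|u|^p)(t,x)=\int_0^t g(t-\tau)|u(\tau,x)|^p\,d\tau$. Let $r\ge 0$ be an integer and put $$\mathcal L(t)=\underbrace{\ln(\ln(\cdots\ln(}_{r+1\text{ times}}E_r+t)\cdots)),\qquad E_0=1,\quad E_{k+1}=\exp(E_k).$$ Let $p_{\mathrm{Str}}(1)=\infty$ and $p_{\mathrm{Str}}(n)=\dfrac{n+1+\sqrt{n^2+10n-7}}{2(n-1)}$ for $n\ge2$. Suppose that one of the following two conditions holds. 1. $g$ is nonincreasing on $(0,T)$, and there are $t_0\in[0,T)$ and $c>0$ such that $g(t)\ge c\,t^{-1}$ and $g(t)\ge c\,t^{\frac{n-1}{2}(p-1)-2-\frac1p}\mathcal L(t)$ for all $t\in[t_0,T)$, $t>0$. 2. There are $t_0\in[0,T)$ and $C>0$ such that $g(t)\le C\,t^{-1}$ for all $t\in[t_0,T)$, $t>0$; moreover $g\in C^2([0,T))$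 with $g''(0)>0$ (one-sided derivatives at $0$), and $1<p<p_{\mathrm{Str}}(n)$. Let $R>0$ and let $u_0\in H^1(\mathbb R^n)$, $u_1\in L^2(\mathbb R^n)$ be real-valued and nonnegative a.e., and vanish a.e. outside $\{|x|\le R\}$, where $u_1$ is not a.e. equal to zero. Let $u$ be an energy solution on $[0,T)$ of $$u_{tt}-\Delta u=g*|u|^p,\qquad (u,u_t)(0,\cdot)=(u_0,u_1),$$ that is, $u\in C([0,T),H^1(\mathbb R^n))\cap C^1([0,T),L^2(\mathbb R^n))$, $g*|u|^p\in L^1_{\mathrm{loc}}([0,T)\times\mathbb R^n)$, $u(0,\cdot)=u_0$, and for every $\phi\in C_0^\infty([0,T)\times\mathbb R^n)$ and every $t\in(0,T)$ $$\int_0^t\!\!\int_{\mathbb R^n}\bigl(-u_t\phi_s+\nabla u\cdot\nabla\phi\bigr)\,dx\,ds+\int_{\mathbb R^n}u_t(t,x)\phi(t,x)\,dx=\int_{\mathbb R^n}u_1(x)\phi(0,x)\,dx+\int_0^t\!\!\int_{\mathbb R^n}(g*|u|^p)\,\phi\,dx\,ds.$$ Then $u(t,\cdot)=0$ a.e. on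 $\{|x|>R+t\}$ for every $t\in[0,T)$, and $u$ blows up in finite time in the sense that $T<\infty$ (so no energy solution exists on $[0,\infty)$). -/

import Mathlib

open MeasureTheory Set Function
open scoped ENNReal ContDiff Gradient

noncomputable section

namespace MemoryWave

/-- Euclidean space `ℝⁿ`. -/
abbrev E (n : ℕ) : Type := EuclideanSpace ℝ (Fin n)

/-- The time interval `[0, T)`, where `T ∈ [0, ∞]`. -/
def timeSpan (T : ℝ≥0∞) : Set ℝ := {t | 0 ≤ t ∧ ENNReal.ofReal t < T}

/-- The Strauss exponent: `∞` in dimension one, and in dimension `n ≥ 2` the positive root of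
`(n - 1) p ^ 2 - (n + 1) p - 2 = 0`. -/
def strauss (n : ℕ) : EReal :=
  if n = 1 then ⊤
  else ((((n : ℝ) + 1 + Real.sqrt ((n : ℝ) ^ 2 + 10 * n - 7)) / (2 * ((n : ℝ) - 1)) : ℝ) : EReal)

/-- The slowly growing function `ln (ln (⋯ ln (exp (exp (⋯ exp 1)) + t)))`, with `r + 1` logarithms
and `r` exponentials. -/
def slowLog (r : ℕ) (t : ℝ) : ℝ := Real.log^[r + 1] (Real.exp^[r] 1 + t)

/-- `F` is the weak (distributional) gradient of `f` on `ℝⁿ`. -/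
def IsWeakGradient {n : ℕ} (f : E n → ℝ) (F : E n → E n) : Prop :=
  ∀ φ : E n → ℝ, ContDiff ℝ ∞ φ → HasCompactSupport φ →
    ∫ x, f x • ∇ φ x = - ∫ x, φ x • F x

/-- Membership in the Sobolev space `H¹(ℝⁿ)`. -/
def MemH1 {n : ℕ} (f : E n → ℝ) : Prop :=
  MemLp f 2 volume ∧ ∃ F : E n → E n, MemLp F 2 volume ∧ IsWeakGradient f F

/-- The integrand `τ ↦ g (s - τ) |u (τ, x)| ^ p` of the memory term. -/
def memoryIntegrand {n : ℕ} (g : ℝ → ℝ) (p : ℝ) (u : ℝ → E n → ℝ) (s : ℝ) (x : E n) (τ : ℝ) : ℝ :=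
  g (s - τ) * |u τ x| ^ p

/-- The memory term `(g ∗ |u| ^ p)(s, x)`, the integral of `g (s - τ) |u (τ, x)| ^ p` over
`τ ∈ (0, s)`. -/
def memory {n : ℕ} (g : ℝ → ℝ) (p : ℝ) (u : ℝ → E n → ℝ) (s : ℝ) (x : E n) : ℝ :=
  ∫ τ in (0 : ℝ)..s, memoryIntegrand g p u s x τ

/-- Test functions in `C₀^∞([0, T) × ℝⁿ)`, given as the restrictions to `[0, T) × ℝⁿ` of smooth
functions on `ℝ × ℝⁿ` with compact support in `(-∞, T) × ℝⁿ`; they need not vanish at time `0`. -/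
def IsTestFunction {n : ℕ} (T : ℝ≥0∞) (φ : ℝ → E n → ℝ) : Prop :=
  ContDiff ℝ ∞ (uncurry φ) ∧ HasCompactSupport (uncurry φ) ∧
    ∀ z ∈ tsupport (uncurry φ), ENNReal.ofReal z.1 < T

/-- `u` is an energy solution on `[0, T)` of `u_tt - Δu = g ∗ |u| ^ p` with data `(u₀, u₁)`.

The curves `U`, `V`, `W` are `t ↦ u(t)`, `t ↦ u_t(t)`, `t ↦ ∇u(t)` with values in `L²`: continuity of
`U` and `W` says that `u ∈ C([0, T), H¹)`, and `u ∈ C¹([0, T), L²)` is the continuity of the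
derivative `V` of `U` with respect to the norm of `L²`. The function `u` itself is a representative
that is measurable in `(t, x)`, as needed for the memory term. The memory term is required to be a
convergent integral almost everywhere and to be locally integrable on `[0, T) × ℝⁿ`. -/
def IsEnergySolution {n : ℕ} (g : ℝ → ℝ) (p : ℝ) (u₀ u₁ : E n → ℝ) (T : ℝ≥0∞)
    (u : ℝ → E n → ℝ) : Prop :=
  AEStronglyMeasurable (uncurry u) (volume.restrict (timeSpan T ×ˢ (univ : Set (E n)))) ∧
  (∀ᵐ z ∂(volume.restrict (timeSpan T ×ˢ (univ : Set (E n)))),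
    IntervalIntegrable (memoryIntegrand g p u z.1 z.2) volume 0 z.1) ∧
  LocallyIntegrableOn (uncurry (memory g p u)) (timeSpan T ×ˢ (univ : Set (E n))) volume ∧
  u 0 =ᵐ[volume] u₀ ∧
  ∃ (U V : ℝ → Lp ℝ 2 (volume : Measure (E n))) (W : ℝ → Lp (E n) 2 (volume : Measure (E n))),
    (∀ t ∈ timeSpan T, u t =ᵐ[volume] U t) ∧
    (∀ t ∈ timeSpan T, IsWeakGradient (U t) (W t)) ∧
    ContinuousOn U (timeSpan T) ∧
    ContinuousOn W (timeSpan T) ∧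
    (∀ t ∈ timeSpan T, HasDerivWithinAt U (V t) (timeSpan T) t) ∧
    ContinuousOn V (timeSpan T) ∧
    ∀ φ : ℝ → E n → ℝ, IsTestFunction T φ → ∀ t ∈ timeSpan T, 0 < t →
      (∫ s in (0 : ℝ)..t, ∫ x, (-(V s x * deriv (fun σ => φ σ x) s) + inner ℝ (W s x) (∇ (φ s) x)))
          + ∫ x, V t x * φ t x
        = (∫ x, u₁ x * φ 0 x) + ∫ s in (0 : ℝ)..t, ∫ x, memory g p u s x * φ s x

/-- The condition on a slowly decaying kernel: `g` is nonincreasing, and for all times in `[t₀, T)`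
it is bounded below by multiples of `t⁻¹` and of `t ^ ((n-1)(p-1)/2 - 2 - 1/p) 𝓛(t)`. -/
def SlowKernel (n : ℕ) (p : ℝ) (r : ℕ) (T : ℝ≥0∞) (g : ℝ → ℝ) : Prop :=
  AntitoneOn g (timeSpan T ∩ Ioi 0) ∧
  ∃ t₀ ∈ timeSpan T, ∃ c : ℝ, 0 < c ∧ ∀ t ∈ timeSpan T, t₀ ≤ t → 0 < t →
    c * t⁻¹ ≤ g t ∧
    c * (t ^ (((n : ℝ) - 1) / 2 * (p - 1) - 2 - 1 / p) * slowLog r t) ≤ g t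

/-- The condition on a fast decaying kernel: `g` is bounded above by a multiple of `t⁻¹` on
`[t₀, T)`, it is `C²` up to time `0` with `g''(0) > 0`, and `p` is below the Strauss exponent. -/
def FastKernel (n : ℕ) (p : ℝ) (T : ℝ≥0∞) (g : ℝ → ℝ) : Prop :=
  (∃ t₀ ∈ timeSpan T, ∃ C : ℝ, 0 < C ∧ ∀ t ∈ timeSpan T, t₀ ≤ t → 0 < t → g t ≤ C * t⁻¹) ∧
  ContDiffOn ℝ 2 g (timeSpan T) ∧ 0 < iteratedDerivWithin 2 g (timeSpan T) 0 ∧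
  (p : EReal) < strauss n

end MemoryWave

end

noncomputable section

namespace MemoryWave

/-! ### The integral inequality behind the blow-up -/

/-! Suppose that the solution exists for all times. Put F(t) = ∫ u(t,x) dx, f(t) = ∫ |u(t,x)|^p dx
and G(h) = ∫_0^h g, and write n = m + 1. The proof derives lower bounds that force F to be infinite
at a finite time.

The first ingredient is finite speed of propagation (`LinearSolution.eq_zero_of_support`). The
energy with weight exp(-2l|x - x₀|), smoothed at x₀, grows at most at a rate 2l + o(l). The local
part contributes 2l. The memory contributes (2 + l) ∫ g(r) e^{-lr} dr up to a constant, and this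
integral tends to 0 as l → ∞; the superlinear source is made linear in the weighted energy by the
embedding of H¹ in L^{2p}. For |x₀| > R + t the weight on the initial data wins as l → ∞. Because
u(t) is supported in |x| ≤ R + t, the equation may be tested with 1 and with exp(w·x).

Testing with 1 gives F'' = g * f, hence F(t) ≥ (h²/2) L G(h) whenever f ≥ L on [s,t] and s + 2h ≤ t
(`quadratic_growth_of_integral_identity`). Hölder's inequality on the ball of radius R + t gives f ≥
c t^{-n(p-1)} F^p for t ≥ 1 (`IsEnergySolution.exists_mean_power_bound`).

Testing with exp(w·x), |w| = 1, gives a moment with M'' ≥ M, hence M ≥ c sinh t. Hölder's inequality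
with this weight, followed by an average over all directions w, yields f(t) ≥ c t^{m(1-p/2)} for t ≥
1 (`IsEnergySolution.exists_nonlinearity_lower_bound`). The two gains are the volume estimate e^t
t^{m/2} for the integral of exp(w·x) over the ball, and the decay t^{-m/2} of the average of exp(w·x
- t) over w.

These bounds are scaling critical when G(t) is of size t^e with e = `criticalExponent n p`. Under
either kernel condition G(θt) exceeds M θ³ t^e for every M and all large t: in the slow case because
of the factor 𝓛, in the fast case because e < 0 below the Strauss exponent while G stays bounded
below. Then `no_global_of_integral_inequality` iterates the inequalities on shrinking time
intervals, and F(2t₀) exceeds every bound. -/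

theorem rpow_two_mul_bound {x t : ℝ} (a : ℝ) (ht : 0 < t) (h1 : t / 2 ≤ x) (h2 : x ≤ 2 * t) :
    (2 : ℝ) ^ (-|a|) * t ^ a ≤ x ^ a := by
  have hx : 0 < x := by linarith
  have hy : x = (x / t) * t := by field_simp
  have hy1 : 1 / 2 ≤ x / t := by rw [le_div_iff₀ ht]; linarith
  have hy2 : x / t ≤ 2 := by rw [div_le_iff₀ ht]; linarith
  have hy0 : 0 < x / t := by positivity
  rw [hy, Real.mul_rpow hy0.le ht.le]
  refine mul_le_mul_of_nonneg_right ?_ (by positivity)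
  rcases le_total 0 a with ha | ha
  · rw [abs_of_nonneg ha, Real.rpow_neg (by norm_num), ← Real.inv_rpow (by norm_num)]
    exact Real.rpow_le_rpow (by norm_num) (by linarith) ha
  · rw [abs_of_nonpos ha, neg_neg]
    exact Real.rpow_le_rpow_of_nonpos hy0 hy2 ha

/-- A nonnegative function satisfying a superlinear integral inequality at critical scaling, with
a kernel that is large compared with the critical power of time, cannot exist globally. -/
theorem no_global_of_integral_inequality {p k e a b c₁ c₂ : ℝ} (hp : 1 < p) (hc₁ : 0 < c₁)
    (hc₂ : 0 < c₂) {U f G : ℝ → ℝ}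
    (hU : ∀ s h t L : ℝ, 0 ≤ s → 0 < h → s + 2 * h ≤ t → 0 ≤ L → (∀ τ ∈ Icc s t, L ≤ f τ) →
      h ^ 2 / 2 * L * G h ≤ U t)
    (hG : ∀ M : ℝ, ∃ t₁ : ℝ, 1 ≤ t₁ ∧ ∀ t, t₁ ≤ t → ∀ θ : ℝ, 0 < θ → θ ≤ 1 →
      M * θ ^ 3 * t ^ e ≤ G (θ * t))
    (hf₁ : ∀ τ, 1 ≤ τ → c₁ * τ ^ a ≤ f τ)
    (hf₂ : ∀ τ, 1 ≤ τ → c₂ * τ ^ (-b) * U τ ^ p ≤ f τ)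
    (hk₁ : k = e + 2 + a) (hk₂ : k * p - b + e + 2 = k) : False := by
  -- One pass through the inequalities: the bound on `f` over [t/2, t] with h = t/4 gives `U t` at
  -- least a constant times t^(2+a) `G (t/4)`. Since `G` beats every multiple of t^e, `U` eventually
  -- beats every multiple of t^k.
  have step : ∀ B : ℝ, ∃ t₀ : ℝ, 1 ≤ t₀ ∧ ∀ t, t₀ ≤ t → B * t ^ k ≤ U t := by
    intro B
    -- The factor 1/32 is (1/4)²/2 from h²/2, and 1/64 is θ³ at θ = 1/4.
    set d : ℝ := 1 / 32 * c₁ * 2 ^ (-|a|) / 64 with hd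
    have hd0 : 0 < d := by positivity
    obtain ⟨t₁, ht₁, h₁⟩ := hG (B / d)
    refine ⟨max t₁ 2, le_max_of_le_right (by norm_num), fun t ht => ?_⟩
    have ht1 : t₁ ≤ t := (le_max_left _ _).trans ht
    have ht2 : 2 ≤ t := (le_max_right _ _).trans ht
    have htp : 0 < t := by linarith
    have hg := h₁ t ht1 (1 / 4) (by norm_num) (by norm_num)
    have := hU (t / 2) (1 / 4 * t) t (c₁ * (2 ^ (-|a|) * t ^ a)) (by linarith) (by linarith)
      (by linarith) (by positivity) (fun τ hτ => by
        refine le_trans ?_ (hf₁ τ (by linarith [hτ.1]))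
        exact mul_le_mul_of_nonneg_left
          (rpow_two_mul_bound a htp hτ.1 (by linarith [hτ.2])) hc₁.le)
    refine le_trans ?_ this
    have hle : (1 / 4 * t) ^ 2 / 2 * (c₁ * (2 ^ (-|a|) * t ^ a)) * (B / d * (1 / 4) ^ 3 * t ^ e)
        ≤ (1 / 4 * t) ^ 2 / 2 * (c₁ * (2 ^ (-|a|) * t ^ a)) * G (1 / 4 * t) :=
      mul_le_mul_of_nonneg_left hg (by positivity)
    refine le_trans (le_of_eq ?_) hle
    have hpow : t ^ k = t ^ 2 * t ^ a * t ^ e := by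
      rw [hk₁, Real.rpow_add htp, Real.rpow_add htp, Real.rpow_two]; ring
    have hB : B = B / d * d := by field_simp
    rw [hpow]
    nth_rewrite 1 [hB]
    rw [hd]
    ring
  -- At stage j the time step has size 2^(-j), which costs 2^(-5j) = 32^(-j): two powers from h² and
  -- three from θ³. The p-th power turns l^j into l^(jp) = 32^j l^j, so this choice of `l` cancels
  -- the loss exactly.
  set l : ℝ := (32 : ℝ) ^ (1 / (p - 1)) with hl
  have hp1 : 0 < p - 1 := by linarith
  have hl1 : 1 < l := Real.one_lt_rpow (by norm_num) (by positivity)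
  have hl0 : 0 < l := by linarith
  have hlp : l ^ (p - 1) = 32 := by
    rw [hl, ← Real.rpow_mul (by norm_num), one_div_mul_cancel hp1.ne', Real.rpow_one]
  set d : ℝ := 1 / 2 / 32 ^ 2 * c₂ * 2 ^ (-|-b|) with hd
  have hd0 : 0 < d := by positivity
  -- `B` is so large that the remaining constants leave a gain of one full factor `l` per stage.
  set B : ℝ := (l / d) ^ (1 / (p - 1)) with hB
  have hB0 : 0 < B := by positivity
  have hBp : d * B ^ (p - 1) = l := by
    rw [hB, ← Real.rpow_mul (by positivity), one_div_mul_cancel hp1.ne', Real.rpow_one]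
    field_simp
  obtain ⟨t₁, ht₁, h₁⟩ := step (2 ^ |k| * B)
  obtain ⟨t₂, ht₂, h₂⟩ := hG 1
  set t₀ := max t₁ t₂ with ht₀
  have h0 : 1 ≤ t₀ := le_max_of_le_left ht₁
  have h0p : 0 < t₀ := by linarith
  -- All these intervals contain 2 t₀, so their bounds accumulate at that single time.
  have key : ∀ j : ℕ, ∀ t ∈ Icc (t₀ * (2 - (1 / 2) ^ j)) (2 * t₀), B * l ^ j * t₀ ^ k ≤ U t := by
    intro j
    induction j with
    | zero =>
      intro t ht
      have htl : t₀ ≤ t := by have := ht.1; norm_num at this; linarith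
      refine le_trans ?_ (h₁ t ((le_max_left _ _).trans htl))
      have := rpow_two_mul_bound k h0p (by linarith) ht.2
      have h3 : (2 : ℝ) ^ |k| * 2 ^ (-|k|) = 1 := by
        rw [← Real.rpow_add (by norm_num)]; simp
      calc B * l ^ 0 * t₀ ^ k = 2 ^ |k| * B * (2 ^ (-|k|) * t₀ ^ k) := by
            linear_combination (- B * t₀ ^ k) * h3
        _ ≤ _ := mul_le_mul_of_nonneg_left this (by positivity)
    | succ j ih =>
      intro t ht
      have hj0 : (0 : ℝ) < (1 / 2) ^ j := by positivity
      have hj1 : ((1 : ℝ) / 2) ^ j ≤ 1 := pow_le_one₀ (by norm_num) (by norm_num)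
      have hs : t₀ ≤ t₀ * (2 - (1 / 2) ^ j) := by nlinarith
      have hA : 0 < B * l ^ j * t₀ ^ k := by positivity
      -- Consecutive left endpoints differ by t₀ 2^(-j)/2, which is 2h for h = 2^(-j) t₀/4.
      have := hU (t₀ * (2 - (1 / 2) ^ j)) ((1 / 2) ^ j * (1 / 4) * t₀) t
        (c₂ * (2 ^ (-|-b|) * t₀ ^ (-b)) * (B * l ^ j * t₀ ^ k) ^ p) (by linarith) (by positivity)
        (by have := ht.1; rw [pow_succ] at this; linarith) (by positivity) (fun τ hτ => by
          have hτ0 : t₀ ≤ τ := hs.trans hτ.1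
          refine le_trans ?_ (hf₂ τ (by linarith))
          have e1 := rpow_two_mul_bound (-b) h0p (by linarith) (hτ.2.trans ht.2)
          have e2 := Real.rpow_le_rpow hA.le (ih τ ⟨hτ.1, hτ.2.trans ht.2⟩) (by linarith : 0 ≤ p)
          have hτp : 0 < τ := by linarith
          gcongr)
      refine le_trans ?_ this
      have hg := h₂ t₀ (le_max_right _ _) ((1 / 2) ^ j * (1 / 4)) (by positivity) (by linarith)
      refine le_trans (le_of_eq ?_) (mul_le_mul_of_nonneg_left hg (by positivity))
      have hpow : t₀ ^ k = (t₀ ^ k) ^ p * t₀ ^ (-b) * t₀ ^ e * t₀ ^ 2 := by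
        rw [← Real.rpow_mul h0p.le, ← Real.rpow_add h0p, ← Real.rpow_add h0p, ← Real.rpow_two,
          ← Real.rpow_add h0p]
        congr 1; linarith
      have hp' : p = (p - 1) + 1 := by ring
      have hBB : B ^ p = B ^ (p - 1) * B := by
        nth_rewrite 1 [hp']; rw [Real.rpow_add hB0, Real.rpow_one]
      have hll : (l ^ j) ^ p = 32 ^ j * l ^ j := by
        nth_rewrite 1 [hp']
        rw [Real.rpow_add (by positivity), Real.rpow_one, ← hlp, ← Real.rpow_natCast,
          ← Real.rpow_natCast, ← Real.rpow_mul hl0.le, ← Real.rpow_mul hl0.le, mul_comm (p - 1)]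
      rw [Real.mul_rpow (by positivity) (by positivity), Real.mul_rpow hB0.le (by positivity),
        hBB, hll]
      have h32 : ((1 / 2 : ℝ) ^ j) ^ 5 * 32 ^ j = 1 := by
        rw [← pow_mul, mul_comm j 5, pow_mul, ← mul_pow]; norm_num
      rw [pow_succ, hpow.trans rfl]
      nth_rewrite 2 [← hBp]
      rw [hd]
      rw [← hpow]
      nth_rewrite 1 [hpow]
      linear_combination (-(1 / 2 / 32 ^ 2 * c₂ * 2 ^ (-|-b|) * B ^ (p - 1) * B * l ^ j *
        ((t₀ ^ k) ^ p * t₀ ^ (-b) * t₀ ^ e * t₀ ^ 2))) * h32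
  have hbd : ∀ j : ℕ, l ^ j ≤ U (2 * t₀) / (B * t₀ ^ k) := by
    intro j
    rw [le_div_iff₀ (by positivity)]
    have := key j (2 * t₀) ⟨by nlinarith [show (0 : ℝ) < (1 / 2) ^ j by positivity], le_rfl⟩
    linarith
  obtain ⟨j, hj⟩ := pow_unbounded_of_one_lt (U (2 * t₀) / (B * t₀ ^ k)) hl1
  exact absurd (hbd j) (not_le.mpr hj)

/-! ### Lower bounds for the integrated kernel -/

theorem timeSpan_top : timeSpan ⊤ = Ici 0 := by
  ext t; simp [timeSpan]

theorem tendsto_slowLog (r : ℕ) : Filter.Tendsto (slowLog r) Filter.atTop Filter.atTop := by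
  have h : ∀ m : ℕ, Filter.Tendsto (Real.log^[m]) Filter.atTop Filter.atTop := fun m => by
    induction m with
    | zero => exact Filter.tendsto_id
    | succ m ih => rw [Function.iterate_succ]; exact ih.comp Real.tendsto_log_atTop
  exact (h (r + 1)).comp (Filter.tendsto_atTop_add_const_left _ _ Filter.tendsto_id)

/-- The exponent for which the integrated kernel has critical size. -/
def criticalExponent (n : ℕ) (p : ℝ) : ℝ := ((n : ℝ) - 1) / 2 * (p - 1) - 1 - 1 / p

/-- Monotonicity gives G(θt) ≥ θ t g(t), and the lower bound on g(t) carries the unbounded factor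
𝓛(t), which absorbs any `M`. The weaker power θ³ ≤ θ is kept so that both kernel conditions yield
the same statement. -/
theorem SlowKernel.integral_lower_bound {n : ℕ} {p : ℝ} {r : ℕ} {g : ℝ → ℝ}
    (hg : SlowKernel n p r ⊤ g)
    (hgint : ∀ t, 0 ≤ t → IntegrableOn g (Ioc 0 t)) (M : ℝ) :
    ∃ t₁ : ℝ, 1 ≤ t₁ ∧ ∀ t, t₁ ≤ t → ∀ θ : ℝ, 0 < θ → θ ≤ 1 →
      M * θ ^ 3 * t ^ criticalExponent n p ≤ ∫ s in (0 : ℝ)..θ * t, g s := by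
  obtain ⟨hanti, t₀, -, c, hc, hlow⟩ := hg
  rw [timeSpan_top] at hanti hlow
  obtain ⟨t₂, ht₂⟩ := Filter.eventually_atTop.mp
    ((tendsto_slowLog r).eventually_ge_atTop (|M| / c))
  refine ⟨max (max t₀ t₂) 1, le_max_right _ _, fun t ht θ hθ hθ1 => ?_⟩
  have ht1 : 1 ≤ t := (le_max_right _ _).trans ht
  have htp : 0 < t := by linarith
  have hts : t₂ ≤ t := (le_max_right _ _).trans ((le_max_left _ _).trans ht)
  have ht0 : t₀ ≤ t := (le_max_left _ _).trans ((le_max_left _ _).trans ht)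
  have hθt : 0 < θ * t := by positivity
  have hgt : |M| * t ^ (criticalExponent n p - 1) ≤ g t := by
    refine le_trans ?_ (hlow t htp.le ht0 htp).2
    have := ht₂ t hts
    rw [div_le_iff₀ hc] at this
    have he : criticalExponent n p - 1 = ((n : ℝ) - 1) / 2 * (p - 1) - 2 - 1 / p := by
      unfold criticalExponent; ring
    rw [he]
    have h0 : (0 : ℝ) < t ^ (((n : ℝ) - 1) / 2 * (p - 1) - 2 - 1 / p) := by positivity
    nlinarith
  have hint : ∫ s in (0 : ℝ)..θ * t, g t ≤ ∫ s in (0 : ℝ)..θ * t, g s := by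
    refine intervalIntegral.integral_mono_on_of_le_Ioo hθt.le (by simp)
      ((intervalIntegrable_iff_integrableOn_Ioc_of_le hθt.le).2 (hgint _ hθt.le)) ?_
    intro s hs
    have : s ≤ t := by nlinarith [hs.2]
    exact hanti ⟨hs.1.le, hs.1⟩ ⟨htp.le, htp⟩ this
  rw [intervalIntegral.integral_const, smul_eq_mul, sub_zero] at hint
  refine le_trans ?_ hint
  have e1 : t ^ criticalExponent n p = t ^ (criticalExponent n p - 1) * t := by
    rw [← Real.rpow_add_one htp.ne']; congr 1; ring
  have h0 : (0 : ℝ) < t ^ criticalExponent n p := by positivity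
  have hθ3 : θ ^ 3 ≤ θ := by nlinarith [mul_pos hθ hθ, mul_nonneg hθ.le (sub_nonneg.2 hθ1)]
  calc M * θ ^ 3 * t ^ criticalExponent n p ≤ |M| * θ * t ^ criticalExponent n p := by
        gcongr
        exact le_abs_self M
    _ = θ * t * (|M| * t ^ (criticalExponent n p - 1)) := by rw [e1]; ring
    _ ≤ θ * t * g t := by gcongr

/-- Taylor's formula at 0, where the affine part g(0) + g'(0)t is nonnegative for small t > 0:
either g(0) > 0, or g(0) = 0 and then positivity of g forces g'(0) ≥ 0. -/
theorem exists_quadratic_lower_bound {g : ℝ → ℝ} (hgpos : ∀ t, 0 < t → 0 < g t)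
    (hg : ContDiffOn ℝ 2 g (Ici 0)) (hg2 : 0 < iteratedDerivWithin 2 g (Ici 0) 0) :
    ∃ c δ : ℝ, 0 < c ∧ 0 < δ ∧ ∀ t, 0 < t → t ≤ δ → c * t ^ 2 ≤ g t := by
  set A := iteratedDerivWithin 2 g (Ici 0) 0 with hA
  set D := derivWithin g (Ici 0) 0 with hD
  have hcont : ContinuousOn g (Ici 0) := hg.continuousOn
  have hder : HasDerivWithinAt g D (Ici 0) 0 :=
    ((hg.differentiableOn (by norm_num)) 0 self_mem_Ici).hasDerivWithinAt
  have hpos : ∀ᶠ t in nhdsWithin (0 : ℝ) (Ioi 0), 0 < g t :=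
    Filter.eventually_of_mem self_mem_nhdsWithin fun t ht => hgpos t ht
  have hg0 : 0 ≤ g 0 := by
    have : Filter.Tendsto g (nhdsWithin (0 : ℝ) (Ioi 0)) (nhds (g 0)) :=
      (hcont 0 self_mem_Ici).mono Ioi_subset_Ici_self
    exact ge_of_tendsto this (hpos.mono fun t ht => ht.le)
  have htay := taylor_isLittleO (n := 2) (convex_Ici (0 : ℝ)) self_mem_Ici hg
  have hT : ∀ t, taylorWithinEval g 2 (Ici 0) 0 t = g 0 + D * t + A / 2 * t ^ 2 := by
    intro t
    simp only [taylorWithinEval_succ, taylor_within_zero_eval, sub_zero, ← hA]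
    rw [iteratedDerivWithin_one]
    simp only [smul_eq_mul, ← hD]
    norm_num
    ring
  have hrem := (htay.def (show (0 : ℝ) < A / 8 by positivity))
  -- The coefficient is 3/8 = 1/2 - 1/8, with 1/8 given up to the remainder.
  have hrem' : ∀ᶠ t in nhdsWithin (0 : ℝ) (Ioi 0), g 0 + D * t + 3 / 8 * A * t ^ 2 ≤ g t := by
    filter_upwards [hrem.filter_mono (nhdsWithin_mono 0 Ioi_subset_Ici_self)] with t ht
    rw [hT, sub_zero, Real.norm_eq_abs, Real.norm_eq_abs, abs_of_nonneg (sq_nonneg t)] at ht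
    have := (abs_le.mp ht).1
    linarith
  have hlin : ∀ᶠ t in nhdsWithin (0 : ℝ) (Ioi 0), 0 ≤ g 0 + D * t := by
    rcases hg0.eq_or_lt with h | h
    · have hD0 : 0 ≤ D := by
        have h2 := (hasDerivWithinAt_iff_tendsto_slope' (by simp)).1 hder.Ioi_of_Ici
        refine ge_of_tendsto h2 ?_
        filter_upwards [hpos, self_mem_nhdsWithin] with t ht ht0
        rw [slope_def_field, ← h, sub_zero, sub_zero]
        exact (div_pos ht ht0).le
      filter_upwards [self_mem_nhdsWithin] with t ht
      rw [← h, zero_add]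
      exact mul_nonneg hD0 (le_of_lt ht)
    · have : Filter.Tendsto (fun t : ℝ => g 0 + D * t) (nhdsWithin (0 : ℝ) (Ioi 0))
          (nhds (g 0 + D * 0)) :=
        ((continuous_const.add (continuous_const.mul continuous_id)).tendsto 0).mono_left
          nhdsWithin_le_nhds
      rw [mul_zero, add_zero] at this
      exact (this.eventually_const_lt h).mono fun t ht => ht.le
  have := hrem'.and hlin
  rw [Filter.Eventually, mem_nhdsGT_iff_exists_Ioc_subset] at this
  obtain ⟨δ, hδ, h⟩ := this
  refine ⟨3 / 8 * A, δ, by positivity, hδ, fun t ht htδ => ?_⟩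
  obtain ⟨h1, h2⟩ := h ⟨ht, htδ⟩
  linarith

/-- Multiplying the critical exponent by 2p gives the Strauss polynomial (n-1)p² - (n+1)p - 2. Its
sign between its roots comes from completing the square: (2(n-1)p - (n+1))² is compared with the
discriminant n² + 10n - 7. -/
theorem criticalExponent_neg_of_lt_strauss {n : ℕ} (hn : 1 ≤ n) {p : ℝ} (hp : 1 < p)
    (h : (p : EReal) < strauss n) : criticalExponent n p < 0 := by
  have hp0 : 0 < p := by linarith
  have key : ((n : ℝ) - 1) * p ^ 2 - (n + 1) * p - 2 < 0 := by
    rcases eq_or_lt_of_le hn with rfl | hn2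
    · norm_num; nlinarith
    · rw [strauss, if_neg (by omega)] at h
      have h' := EReal.coe_lt_coe_iff.1 h
      have hn1 : (1 : ℝ) < n := by exact_mod_cast hn2
      set s := Real.sqrt ((n : ℝ) ^ 2 + 10 * n - 7) with hs
      have hs2 : s ^ 2 = (n : ℝ) ^ 2 + 10 * n - 7 := Real.sq_sqrt (by nlinarith)
      have hs0 : 0 ≤ s := Real.sqrt_nonneg _
      have hsn : (n : ℝ) + 1 < s := by
        refine Real.lt_sqrt_of_sq_lt ?_
        nlinarith
      rw [lt_div_iff₀ (by linarith)] at h'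
      have h1 : 2 * ((n : ℝ) - 1) * p - (n + 1) < s := by linarith
      have h2 : -s < 2 * ((n : ℝ) - 1) * p - (n + 1) := by nlinarith
      have h3 := sq_lt_sq' h2 h1
      rw [hs2] at h3
      have h4 : 4 * ((n : ℝ) - 1) * (((n : ℝ) - 1) * p ^ 2 - (n + 1) * p - 2) < 0 := by nlinarith
      by_contra hcon
      push Not at hcon
      have : 0 ≤ 4 * ((n : ℝ) - 1) * (((n : ℝ) - 1) * p ^ 2 - (n + 1) * p - 2) :=
        mul_nonneg (by linarith) hcon
      linarith
  have e : criticalExponent n p * (2 * p) = ((n : ℝ) - 1) * p ^ 2 - (n + 1) * p - 2 := by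
    unfold criticalExponent; field_simp; ring
  by_contra hcon
  push Not at hcon
  have := mul_nonneg hcon (by positivity : 0 ≤ 2 * p)
  linarith

/-- The critical power of t tends to 0, so a bound on G(θt) independent of t suffices. Integrating
g(s) ≥ c s² over (0, θ min(δ,1)) supplies it, and is the source of the power θ³. -/
theorem FastKernel.integral_lower_bound {n : ℕ} (hn : 1 ≤ n) {p : ℝ} (hp : 1 < p) {g : ℝ → ℝ}
    (hg : FastKernel n p ⊤ g) (hgpos : ∀ t, 0 < t → 0 < g t)
    (hgint : ∀ t, 0 ≤ t → IntegrableOn g (Ioc 0 t)) (M : ℝ) :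
    ∃ t₁ : ℝ, 1 ≤ t₁ ∧ ∀ t, t₁ ≤ t → ∀ θ : ℝ, 0 < θ → θ ≤ 1 →
      M * θ ^ 3 * t ^ criticalExponent n p ≤ ∫ s in (0 : ℝ)..θ * t, g s := by
  obtain ⟨-, hC2, hg2, hstr⟩ := hg
  rw [timeSpan_top] at hC2 hg2
  have he := criticalExponent_neg_of_lt_strauss hn hp hstr
  obtain ⟨c, δ, hc, hδ, hlow⟩ := exists_quadratic_lower_bound hgpos hC2 hg2
  set d := c * min δ 1 ^ 3 / 3 with hd
  have hδ1 : 0 < min δ 1 := lt_min hδ one_pos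
  have hd0 : 0 < d := by positivity
  have hlim : Filter.Tendsto (fun t : ℝ => M * t ^ criticalExponent n p) Filter.atTop
      (nhds (M * 0)) := by
    refine Filter.Tendsto.const_mul M ?_
    simpa using tendsto_rpow_neg_atTop (y := -criticalExponent n p) (by linarith)
  rw [mul_zero] at hlim
  obtain ⟨t₂, ht₂⟩ := Filter.eventually_atTop.mp (hlim.eventually_lt_const hd0)
  refine ⟨max t₂ 1, le_max_right _ _, fun t ht θ hθ hθ1 => ?_⟩
  have ht1 : 1 ≤ t := (le_max_right _ _).trans ht
  have h2 := ht₂ t ((le_max_left _ _).trans ht)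
  have hθt : 0 < θ * t := by positivity
  set h := θ * min δ 1 with hh
  have hh0 : 0 < h := by positivity
  have hhδ : h ≤ δ := by
    calc h ≤ 1 * min δ 1 := by rw [hh]; gcongr
      _ ≤ δ := by rw [one_mul]; exact min_le_left _ _
  have hht : h ≤ θ * t := by
    rw [hh]; gcongr; exact (min_le_right _ _).trans ht1
  have hII : ∀ {y : ℝ}, 0 ≤ y → IntervalIntegrable g volume 0 y := fun hy =>
    (intervalIntegrable_iff_integrableOn_Ioc_of_le hy).2 (hgint _ hy)
  have h3 : ∫ s in (0 : ℝ)..h, c * s ^ 2 ≤ ∫ s in (0 : ℝ)..h, g s :=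
    intervalIntegral.integral_mono_on_of_le_Ioo hh0.le
      (by apply Continuous.intervalIntegrable; fun_prop) (hII hh0.le)
      fun s hs => hlow s hs.1 (hs.2.le.trans hhδ)
  have h4 : ∫ s in (0 : ℝ)..h, g s ≤ ∫ s in (0 : ℝ)..θ * t, g s := by
    refine intervalIntegral.integral_mono_interval le_rfl hh0.le hht ?_ (hII hθt.le)
    refine (ae_restrict_iff' measurableSet_Ioc).2 (Filter.Eventually.of_forall fun s hs => ?_)
    exact (hgpos s hs.1).le
  refine le_trans ?_ (h3.trans h4)
  have h5 : ∫ s in (0 : ℝ)..h, c * s ^ 2 = d * θ ^ 3 := by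
    rw [intervalIntegral.integral_const_mul, integral_pow, hd, hh]; norm_num; ring
  rw [h5]
  have : 0 < θ ^ 3 := by positivity
  nlinarith

/-! ### Gaussian integrals transverse to a direction -/

theorem exists_orthonormalBasis_zero_eq {m : ℕ} {e : E (m + 1)} (he : ‖e‖ = 1) :
    ∃ b : OrthonormalBasis (Fin (m + 1)) ℝ (E (m + 1)), b 0 = e := by
  have horth : Orthonormal ℝ (({0} : Set (Fin (m + 1))).domRestrict fun _ => e) := by
    rw [orthonormal_iff_ite]
    rintro ⟨i, hi⟩ ⟨j, hj⟩
    rw [mem_singleton_iff] at hi hj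
    subst hi hj
    simp [he]
  obtain ⟨b, hb⟩ := horth.exists_orthonormalBasis_extension_of_card_eq (by simp)
  exact ⟨b, hb 0 (mem_singleton _)⟩

/-- In an orthonormal basis starting with `e`, the integrand is a product of one-variable functions:
`k` along `e` and m Gaussians in the other coordinates. -/
theorem transverse_gaussian {m : ℕ} {e : E (m + 1)} (he : ‖e‖ = 1) {a : ℝ} (ha : 0 < a)
    {k : ℝ → ℝ} (hk : Integrable k) :
    Integrable (fun x : E (m + 1) =>
        k (inner ℝ e x) * Real.exp (-a * (‖x‖ ^ 2 - inner ℝ e x ^ 2))) ∧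
      ∫ x : E (m + 1), k (inner ℝ e x) * Real.exp (-a * (‖x‖ ^ 2 - inner ℝ e x ^ 2))
        = (∫ s, k s) * Real.sqrt (Real.pi / a) ^ m := by
  obtain ⟨b, hb⟩ := exists_orthonormalBasis_zero_eq he
  set F : Fin (m + 1) → ℝ → ℝ := Fin.cons k fun _ s => Real.exp (-a * s ^ 2) with hF
  have hFi : ∀ i, Integrable (F i) := fun i => by
    refine Fin.cases ?_ (fun j => ?_) i
    · simpa [hF] using hk
    · simpa [hF] using integrable_exp_neg_mul_sq ha
  let Φ : E (m + 1) ≃ᵐ (Fin (m + 1) → ℝ) :=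
    b.repr.toHomeomorph.toMeasurableEquiv.trans (MeasurableEquiv.toLp 2 (Fin (m + 1) → ℝ)).symm
  have hΦ : MeasurePreserving Φ volume volume :=
    (EuclideanSpace.volume_preserving_symm_measurableEquiv_toLp (Fin (m + 1))).comp
      b.measurePreserving_repr
  have hΦi : ∀ x i, Φ x i = inner ℝ (b i) x := fun x i => b.repr_apply_apply x i
  have hfun : (fun x : E (m + 1) =>
      k (inner ℝ e x) * Real.exp (-a * (‖x‖ ^ 2 - inner ℝ e x ^ 2)))
      = (fun y : Fin (m + 1) → ℝ => ∏ i, F i (y i)) ∘ Φ := by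
    ext x
    have hx : ‖x‖ ^ 2 = ∑ i, inner ℝ (b i) x ^ 2 := (b.sum_sq_inner_right x).symm
    simp only [comp_apply, Fin.prod_univ_succ, hF, Fin.cons_zero, Fin.cons_succ, hΦi, hb]
    rw [← Real.exp_sum, hx, Fin.sum_univ_succ, hb, add_sub_cancel_left, Finset.mul_sum]
  rw [hfun]
  constructor
  · exact hΦ.integrable_comp_of_integrable (Integrable.fintype_prod hFi)
  · have := hΦ.integral_comp' (fun y : Fin (m + 1) → ℝ => ∏ i, F i (y i))
    rw [show (∫ x, ((fun y : Fin (m + 1) → ℝ => ∏ i, F i (y i)) ∘ Φ) x)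
      = ∫ x, (fun y : Fin (m + 1) → ℝ => ∏ i, F i (y i)) (Φ x) from rfl, this,
      integral_fin_nat_prod_volume_eq_prod, Fin.prod_univ_succ]
    simp [hF, integral_gaussian, -neg_mul]

/-- With s = w·x one has |x|² - s² ≤ (ρ - s)(ρ + s) ≤ 2ρ(ρ - s). Half of the decay e^{-(ρ-s)}
therefore pays for a Gaussian of width √ρ across `w`, and the other half is integrable along `w`. -/
theorem exp_inner_le_of_norm_le {n : ℕ} {w x : E n} (hw : ‖w‖ = 1) {ρ : ℝ} (hρ : 0 < ρ)
    (hx : ‖x‖ ≤ ρ) :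
    Real.exp (inner ℝ w x) ≤ Real.exp ρ * ((Iic ρ).indicator
      (fun s => Real.exp (1 / 2 * s) * Real.exp (-(1 / 2) * ρ)) (inner ℝ w x) *
      Real.exp (-(1 / (4 * ρ)) * (‖x‖ ^ 2 - inner ℝ w x ^ 2))) := by
  set s : ℝ := inner ℝ w x with hs
  have habs : |s| ≤ ‖x‖ := by
    have := abs_real_inner_le_norm w x; rwa [hw, one_mul] at this
  have h1 := abs_le.1 (habs.trans hx)
  rw [indicator_of_mem (show s ∈ Iic ρ from h1.2), ← Real.exp_add, ← Real.exp_add, ← Real.exp_add]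
  refine Real.exp_le_exp.2 ?_
  have h2 : ‖x‖ ^ 2 - s ^ 2 ≤ (ρ - s) * (2 * ρ) := by
    have : ‖x‖ ^ 2 ≤ ρ ^ 2 := by gcongr
    nlinarith
  have h3 : 1 / (4 * ρ) * (‖x‖ ^ 2 - s ^ 2) ≤ (ρ - s) / 2 := by
    rw [one_div, inv_mul_le_iff₀ (by positivity)]; linarith
  linarith

/-- The integral of a plane exponential over a ball. -/
theorem integral_exp_inner_ball_le {m : ℕ} {w : E (m + 1)} (hw : ‖w‖ = 1) {ρ : ℝ} (hρ : 0 < ρ) :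
    ∫ x in Metric.closedBall (0 : E (m + 1)) ρ, Real.exp (inner ℝ w x) ≤
      2 * Real.exp ρ * Real.sqrt (4 * Real.pi * ρ) ^ m := by
  set k : ℝ → ℝ := (Iic ρ).indicator
    (fun s => Real.exp (1 / 2 * s) * Real.exp (-(1 / 2) * ρ)) with hk
  have hki : Integrable k := by
    rw [hk, integrable_indicator_iff measurableSet_Iic]
    exact (integrableOn_exp_mul_Iic (by norm_num) ρ).mul_const _
  have hkv : ∫ s, k s = 2 := by
    rw [hk, integral_indicator measurableSet_Iic, integral_mul_const,
      integral_exp_mul_Iic (by norm_num), div_mul_eq_mul_div, ← Real.exp_add]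
    norm_num
  obtain ⟨hi, hv⟩ := transverse_gaussian hw (a := 1 / (4 * ρ)) (by positivity) hki
  have hk0 : ∀ s, 0 ≤ k s := fun s => indicator_nonneg (fun _ _ => by positivity) s
  calc ∫ x in Metric.closedBall (0 : E (m + 1)) ρ, Real.exp (inner ℝ w x)
      ≤ ∫ x in Metric.closedBall (0 : E (m + 1)) ρ, Real.exp ρ * (k (inner ℝ w x) *
          Real.exp (-(1 / (4 * ρ)) * (‖x‖ ^ 2 - inner ℝ w x ^ 2))) := by
        refine setIntegral_mono_on ?_ (hi.const_mul _).integrableOn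
          measurableSet_closedBall fun x hx => ?_
        · exact (by fun_prop : Continuous fun x : E (m + 1) => Real.exp (inner ℝ w x)).continuousOn
            |>.integrableOn_compact (isCompact_closedBall _ _)
        · exact exp_inner_le_of_norm_le hw hρ (by simpa using hx)
    _ ≤ ∫ x, Real.exp ρ * (k (inner ℝ w x) *
          Real.exp (-(1 / (4 * ρ)) * (‖x‖ ^ 2 - inner ℝ w x ^ 2))) := by
        refine setIntegral_le_integral (hi.const_mul _) (Filter.Eventually.of_forall fun x => ?_)
        have := hk0 (inner ℝ w x)
        positivity
    _ = 2 * Real.exp ρ * Real.sqrt (4 * Real.pi * ρ) ^ m := by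
        rw [integral_const_mul, hv, hkv]
        have : Real.pi / (1 / (4 * ρ)) = 4 * Real.pi * ρ := by field_simp
        rw [this]; ring

/-- Let c be the cosine of the angle between ξ and e. If |x| ≥ t/2, the exponent is at most R -
(t/2)(1 - c), and |ξ|²(1 - c²) ≤ 2(1 - c) for |ξ| ≤ 1. If |x| ≤ t/2, the exponent is already below
-t/2. Directions are parametrised by ξ/|ξ| with ξ in the unit ball, so an integral over the ball
replaces one over the sphere. -/
theorem exp_inner_normalized_le {n : ℕ} {ξ x e : E n} (hξ : ‖ξ‖ ≤ 1) (he : ‖e‖ = 1)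
    (hx : x = ‖x‖ • e) {R t : ℝ} (hR : 0 ≤ R) (ht : 0 < t) (hxt : ‖x‖ ≤ R + t) :
    Real.exp (inner ℝ (‖ξ‖⁻¹ • ξ) x - t) ≤
      Real.exp R * ((Icc (-1) 1).indicator (fun _ => (1 : ℝ)) (inner ℝ e ξ) *
        Real.exp (-(t / 4) * (‖ξ‖ ^ 2 - inner ℝ e ξ ^ 2))) := by
  have hmem : inner ℝ e ξ ∈ Icc (-1 : ℝ) 1 := by
    have := abs_real_inner_le_norm e ξ
    rw [he, one_mul] at this
    exact abs_le.1 (this.trans hξ)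
  rw [indicator_of_mem hmem, one_mul, ← Real.exp_add]
  refine Real.exp_le_exp.2 ?_
  set c : ℝ := inner ℝ (‖ξ‖⁻¹ • ξ) e with hc
  have hξc : inner ℝ e ξ = ‖ξ‖ * c := by
    rw [hc, real_inner_smul_left, real_inner_comm]
    rcases eq_or_ne ξ 0 with rfl | h
    · simp
    · have : ‖ξ‖ ≠ 0 := norm_ne_zero_iff.2 h
      field_simp
  have hc1 : |c| ≤ 1 := by
    have := abs_real_inner_le_norm (‖ξ‖⁻¹ • ξ) e
    rw [he, mul_one] at this
    refine this.trans ?_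
    rw [norm_smul, norm_inv, norm_norm]
    exact inv_mul_le_one
  have hinner : inner ℝ (‖ξ‖⁻¹ • ξ) x = ‖x‖ * c := by
    conv_lhs => rw [hx]
    rw [real_inner_smul_right]
  have hc2 := abs_le.1 hc1
  have hξ0 := norm_nonneg ξ
  have hx0 := norm_nonneg x
  have h1 : ‖ξ‖ ^ 2 - inner ℝ e ξ ^ 2 ≤ 2 * (1 - c) := by
    rw [hξc]
    have : ‖ξ‖ ^ 2 ≤ 1 := pow_le_one₀ hξ0 hξ
    nlinarith [mul_nonneg (sub_nonneg.2 this) (mul_nonneg (sub_nonneg.2 hc2.2)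
      (by linarith [hc2.1] : 0 ≤ 1 + c)), sq_nonneg (1 - c)]
  have h3 : ‖ξ‖ ^ 2 - inner ℝ e ξ ^ 2 ≤ 1 := by
    nlinarith [sq_nonneg (inner ℝ e ξ : ℝ), pow_le_one₀ hξ0 hξ (n := 2)]
  rw [hinner]
  rcases le_total (‖x‖) (t / 2) with h | h
  · have : ‖x‖ * c ≤ t / 2 := by nlinarith
    nlinarith
  · have : ‖x‖ * c - t ≤ R - t / 2 * (1 - c) := by nlinarith
    nlinarith

/-- Averaging plane exponentials over directions gains the decay of a spherical average. -/
theorem integral_exp_inner_direction_le {m : ℕ} {x : E (m + 1)} {R t : ℝ} (hR : 0 ≤ R)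
    (ht : 0 < t) (hxt : ‖x‖ ≤ R + t) :
    ∫ ξ in Metric.closedBall (0 : E (m + 1)) 1, Real.exp (inner ℝ (‖ξ‖⁻¹ • ξ) x - t) ≤
      2 * Real.exp R * Real.sqrt (Real.pi / (t / 4)) ^ m := by
  obtain ⟨e, he, hx⟩ : ∃ e : E (m + 1), ‖e‖ = 1 ∧ x = ‖x‖ • e := by
    rcases eq_or_ne x 0 with rfl | h
    · obtain ⟨e, he⟩ := exists_norm_eq (E (m + 1)) zero_le_one
      exact ⟨e, he, by simp⟩
    · have h0 : ‖x‖ ≠ 0 := norm_ne_zero_iff.2 h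
      exact ⟨‖x‖⁻¹ • x, by rw [norm_smul, norm_inv, norm_norm, inv_mul_cancel₀ h0],
        by rw [smul_inv_smul₀ h0]⟩
  set k : ℝ → ℝ := (Icc (-1) 1).indicator (fun _ => (1 : ℝ)) with hk
  have hki : Integrable k := by
    rw [hk, integrable_indicator_iff measurableSet_Icc]
    exact integrableOn_const (by simp)
  have hkv : ∫ s, k s = 2 := by
    rw [hk, integral_indicator measurableSet_Icc]
    simp
    norm_num
  obtain ⟨hi, hv⟩ := transverse_gaussian he (a := t / 4) (by positivity) hki
  have hk0 : ∀ s, 0 ≤ k s := fun s => indicator_nonneg (fun _ _ => zero_le_one) s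
  calc ∫ ξ in Metric.closedBall (0 : E (m + 1)) 1, Real.exp (inner ℝ (‖ξ‖⁻¹ • ξ) x - t)
      ≤ ∫ ξ in Metric.closedBall (0 : E (m + 1)) 1, Real.exp R * (k (inner ℝ e ξ) *
          Real.exp (-(t / 4) * (‖ξ‖ ^ 2 - inner ℝ e ξ ^ 2))) := by
        refine integral_mono_of_nonneg (Filter.Eventually.of_forall fun ξ => (Real.exp_pos _).le)
          (hi.const_mul _).integrableOn ?_
        refine (ae_restrict_iff' measurableSet_closedBall).2
          (Filter.Eventually.of_forall fun ξ hξ => ?_)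
        exact exp_inner_normalized_le (by simpa using hξ) he hx hR ht hxt
    _ ≤ ∫ ξ, Real.exp R * (k (inner ℝ e ξ) *
          Real.exp (-(t / 4) * (‖ξ‖ ^ 2 - inner ℝ e ξ ^ 2))) := by
        refine setIntegral_le_integral (hi.const_mul _) (Filter.Eventually.of_forall fun x => ?_)
        have := hk0 (inner ℝ e x)
        positivity
    _ = 2 * Real.exp R * Real.sqrt (Real.pi / (t / 4)) ^ m := by
        rw [integral_const_mul, hv, hkv]
        ring

/-! ### Gradients of smooth functions -/

section Gradient

variable {n : ℕ}

theorem gradient_eq_toDual_symm (φ : E n → ℝ) :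
    ∇ φ = fun x => (InnerProductSpace.toDual ℝ (E n)).symm (fderiv ℝ φ x) := rfl

theorem contDiff_gradient {φ : E n → ℝ} (hφ : ContDiff ℝ ∞ φ) : ContDiff ℝ ∞ (∇ φ) := by
  rw [gradient_eq_toDual_symm]
  exact (InnerProductSpace.toDual ℝ (E n)).symm.contDiff.comp (hφ.fderiv_right (by simp))

theorem norm_gradient (φ : E n → ℝ) (x : E n) : ‖∇ φ x‖ = ‖fderiv ℝ φ x‖ := by
  rw [gradient_eq_toDual_symm]; simp

theorem support_gradient_subset (φ : E n → ℝ) : support (∇ φ) ⊆ tsupport φ := by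
  intro x hx
  refine support_fderiv_subset ℝ (f := φ) ?_
  rw [mem_support] at hx ⊢
  rwa [← norm_ne_zero_iff, norm_gradient, norm_ne_zero_iff] at hx

theorem hasCompactSupport_gradient {φ : E n → ℝ} (hφ : HasCompactSupport φ) :
    HasCompactSupport (∇ φ) :=
  HasCompactSupport.mono' hφ (support_gradient_subset φ)

theorem gradient_mul {k φ : E n → ℝ} {x : E n} (hk : DifferentiableAt ℝ k x)
    (hφ : DifferentiableAt ℝ φ x) :
    ∇ (fun y => k y * φ y) x = k x • ∇ φ x + φ x • ∇ k x := by
  simp only [gradient_eq_toDual_symm]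
  rw [fderiv_fun_mul hk hφ]
  simp

theorem memLp_of_smooth {F : Type*} [NormedAddCommGroup F] [NormedSpace ℝ F] {φ : E n → F}
    (hφ : ContDiff ℝ ∞ φ) (hc : HasCompactSupport φ) {q : ℝ≥0∞} : MemLp φ q volume :=
  hφ.continuous.memLp_of_hasCompactSupport hc

theorem integrable_smul_of_memLp_two {F : Type*} [NormedAddCommGroup F] [NormedSpace ℝ F]
    {f : E n → ℝ} {G : E n → F} (hf : MemLp f 2 volume) (hG : MemLp G 2 volume) :
    Integrable fun x => f x • G x :=
  memLp_one_iff_integrable.1 (hG.smul hf)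

end Gradient

/-! ### Pairs consisting of an `L²` function and its weak gradient -/

/-- Real valued `L²` functions. -/
abbrev L2 (n : ℕ) : Type := Lp ℝ 2 (volume : Measure (E n))

/-- Square integrable vector fields. -/
abbrev L2V (n : ℕ) : Type := Lp (E n) 2 (volume : Measure (E n))

section WeakPairs

variable {n : ℕ}

/-- The defect in the integration by parts formula against a test function. -/
def weakDefect (φ : E n → ℝ) (hφ : ContDiff ℝ ∞ φ) (hc : HasCompactSupport φ) :
    L2 n × L2V n →L[ℝ] E n :=
  (((ContinuousLinearMap.lsmul ℝ ℝ : ℝ →L[ℝ] E n →L[ℝ] E n).lpPairing volume 2 2).flip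
      ((memLp_of_smooth (contDiff_gradient hφ) (hasCompactSupport_gradient hc)).toLp (∇ φ))).comp
      (ContinuousLinearMap.fst ℝ _ _) +
    ((ContinuousLinearMap.lsmul ℝ ℝ : ℝ →L[ℝ] E n →L[ℝ] E n).lpPairing volume 2 2
      ((memLp_of_smooth hφ hc).toLp φ)).comp (ContinuousLinearMap.snd ℝ _ _)

theorem weakDefect_apply {φ : E n → ℝ} (hφ : ContDiff ℝ ∞ φ) (hc : HasCompactSupport φ)
    (z : L2 n × L2V n) :
    weakDefect φ hφ hc z = (∫ x, z.1 x • ∇ φ x) + ∫ x, φ x • z.2 x := by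
  simp only [weakDefect, add_apply, ContinuousLinearMap.comp_apply,
    ContinuousLinearMap.flip_apply, ContinuousLinearMap.lpPairing_eq_integral,
    ContinuousLinearMap.coe_fst', ContinuousLinearMap.coe_snd', ContinuousLinearMap.lsmul_apply]
  congr 1
  · refine integral_congr_ae ?_
    filter_upwards [(memLp_of_smooth (contDiff_gradient hφ) (hasCompactSupport_gradient hc) :
      MemLp (∇ φ) 2 volume).coeFn_toLp] with x hx
    rw [hx]
  · refine integral_congr_ae ?_
    filter_upwards [(memLp_of_smooth hφ hc : MemLp φ 2 volume).coeFn_toLp] with x hx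
    rw [hx]

variable (n) in
/-- The closed subspace of pairs of an `L²` function and its weak gradient. -/
def weakPairs : Submodule ℝ (L2 n × L2V n) :=
  ⨅ (φ : E n → ℝ) (hφ : ContDiff ℝ ∞ φ) (hc : HasCompactSupport φ),
    (weakDefect φ hφ hc).toLinearMap.ker

theorem mem_weakPairs {z : L2 n × L2V n} : z ∈ weakPairs n ↔ IsWeakGradient z.1 z.2 := by
  simp only [weakPairs, Submodule.mem_iInf, LinearMap.mem_ker, ContinuousLinearMap.coe_coe,
    weakDefect_apply, IsWeakGradient, eq_neg_iff_add_eq_zero]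

theorem isWeakGradient_of_smooth {φ : E n → ℝ} (hφ : ContDiff ℝ ∞ φ) (hc : HasCompactSupport φ) :
    IsWeakGradient φ (∇ φ) := by
  intro ψ hψ hcψ
  have i1 : Integrable fun x => φ x • ∇ ψ x :=
    (hφ.continuous.smul (contDiff_gradient hψ).continuous).integrable_of_hasCompactSupport
      hc.smul_right
  have i2 : Integrable fun x => ψ x • ∇ φ x :=
    (hψ.continuous.smul (contDiff_gradient hφ).continuous).integrable_of_hasCompactSupport
      hcψ.smul_right
  refine ext_inner_left ℝ fun v => ?_
  rw [inner_neg_right, ← integral_inner i1, ← integral_inner i2]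
  have h1 : ∀ (f g : E n → ℝ) x, inner ℝ v (f x • ∇ g x) = f x * fderiv ℝ g x v := fun f g x => by
    rw [real_inner_smul_right, inner_gradient_right]; simp
  simp only [h1]
  have := integral_mul_fderiv_eq_neg_fderiv_mul_of_integrable (μ := (volume : Measure (E n)))
    (f := φ) (g := ψ) (v := v) ?_ ?_ ?_ (fun x _ => hφ.differentiable (by simp) x)
    (fun x _ => hψ.differentiable (by simp) x)
  · rw [this]
    congr 1
    exact integral_congr_ae (Filter.Eventually.of_forall fun x => mul_comm _ _)
  · refine (i2.const_inner v).congr (Filter.Eventually.of_forall fun x => ?_)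
    simp only [h1]; ring
  · exact (i1.const_inner v).congr (Filter.Eventually.of_forall fun x => h1 φ ψ x)
  · exact (hφ.continuous.mul hψ.continuous).integrable_of_hasCompactSupport hc.mul_right

/-- The pair of a test function and its gradient. -/
def testPair (φ : E n → ℝ) (hφ : ContDiff ℝ ∞ φ) (hc : HasCompactSupport φ) : L2 n × L2V n :=
  ((memLp_of_smooth hφ hc).toLp φ,
    (memLp_of_smooth (contDiff_gradient hφ) (hasCompactSupport_gradient hc)).toLp (∇ φ))

theorem IsWeakGradient.congr {f f' : E n → ℝ} {F F' : E n → E n} (h : IsWeakGradient f F)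
    (hf : f =ᵐ[volume] f') (hF : F =ᵐ[volume] F') : IsWeakGradient f' F' := by
  intro φ hφ hc
  have h1 : ∫ x, f' x • ∇ φ x = ∫ x, f x • ∇ φ x :=
    integral_congr_ae (by filter_upwards [hf] with x hx; rw [hx])
  have h2 : ∫ x, φ x • F' x = ∫ x, φ x • F x :=
    integral_congr_ae (by filter_upwards [hF] with x hx; rw [hx])
  rw [h1, h2, h φ hφ hc]

theorem coeFn_testPair_fst {φ : E n → ℝ} (hφ : ContDiff ℝ ∞ φ) (hc : HasCompactSupport φ) :
    ⇑(testPair φ hφ hc).1 =ᵐ[volume] φ :=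
  (memLp_of_smooth hφ hc : MemLp φ 2 volume).coeFn_toLp

theorem coeFn_testPair_snd {φ : E n → ℝ} (hφ : ContDiff ℝ ∞ φ) (hc : HasCompactSupport φ) :
    ⇑(testPair φ hφ hc).2 =ᵐ[volume] ∇ φ :=
  (memLp_of_smooth (contDiff_gradient hφ) (hasCompactSupport_gradient hc) :
    MemLp (∇ φ) 2 volume).coeFn_toLp

theorem testPair_mem {φ : E n → ℝ} (hφ : ContDiff ℝ ∞ φ) (hc : HasCompactSupport φ) :
    testPair φ hφ hc ∈ weakPairs n :=
  mem_weakPairs.2 ((isWeakGradient_of_smooth hφ hc).congr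
    (coeFn_testPair_fst hφ hc).symm (coeFn_testPair_snd hφ hc).symm)

/-- Weak gradients are local: test functions supported in the open set see only the zero function.
This transfers support information from u to ∇u. -/
theorem IsWeakGradient.eq_zero_on {f : E n → ℝ} {F : E n → E n} (h : IsWeakGradient f F)
    (hF : MemLp F 2 volume) {O : Set (E n)} (hO : IsOpen O)
    (hf : ∀ᵐ x, x ∈ O → f x = 0) : ∀ᵐ x, x ∈ O → F x = 0 := by
  refine hO.ae_eq_zero_of_integral_contDiff_smul_eq_zero
    ((hF.locallyIntegrable (by norm_num)).locallyIntegrableOn O) fun φ hφ hc hs => ?_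
  rw [← neg_eq_zero, ← h φ hφ hc]
  refine integral_eq_zero_of_ae ?_
  filter_upwards [hf] with x hx
  by_cases hxO : x ∈ O
  · simp [hx hxO]
  · have : ∇ φ x = 0 := by
      by_contra hne
      exact hxO (hs (support_gradient_subset φ hne))
    simp [this]

theorem IsWeakGradient.mul_smooth {f : E n → ℝ} {F : E n → E n} (h : IsWeakGradient f F)
    (hf : MemLp f 2 volume) (hF : MemLp F 2 volume) {k : E n → ℝ} (hk : ContDiff ℝ ∞ k) :
    IsWeakGradient (fun x => k x * f x) (fun x => k x • F x + f x • ∇ k x) := by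
  intro φ hφ hc
  have hkφ : ContDiff ℝ ∞ fun x => k x * φ x := hk.mul hφ
  have hckφ : HasCompactSupport fun x => k x * φ x := hc.mul_left
  have key := h _ hkφ hckφ
  have hk' := contDiff_gradient hk
  have hφ' := contDiff_gradient hφ
  have m1 : MemLp (fun x => k x • ∇ φ x) 2 volume :=
    memLp_of_smooth (hk.smul hφ') (hasCompactSupport_gradient hc).smul_left
  have m2 : MemLp (fun x => φ x • ∇ k x) 2 volume :=
    memLp_of_smooth (hφ.smul hk') hc.smul_right
  have m3 : MemLp (fun x => k x * φ x) 2 volume := memLp_of_smooth hkφ hckφ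
  have i1 : Integrable fun x => f x • (k x • ∇ φ x) := integrable_smul_of_memLp_two hf m1
  have i2 : Integrable fun x => f x • (φ x • ∇ k x) := integrable_smul_of_memLp_two hf m2
  have i3 : Integrable fun x => (k x * φ x) • F x := integrable_smul_of_memLp_two m3 hF
  have e1 : ∫ x, f x • ∇ (fun y => k y * φ y) x
      = (∫ x, f x • (k x • ∇ φ x)) + ∫ x, f x • (φ x • ∇ k x) := by
    rw [← integral_add i1 i2]
    refine integral_congr_ae (Filter.Eventually.of_forall fun x => ?_)
    simp only
    rw [gradient_mul (hk.differentiable (by simp) x) (hφ.differentiable (by simp) x), smul_add]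
  have e2 : ∫ x, φ x • (k x • F x + f x • ∇ k x)
      = (∫ x, (k x * φ x) • F x) + ∫ x, f x • (φ x • ∇ k x) := by
    rw [← integral_add i3 i2]
    refine integral_congr_ae (Filter.Eventually.of_forall fun x => ?_)
    simp only [smul_add, smul_smul]
    rw [mul_comm (k x), mul_comm (f x)]
  have e3 : ∫ x, (k x * f x) • ∇ φ x = ∫ x, f x • (k x • ∇ φ x) :=
    integral_congr_ae (Filter.Eventually.of_forall fun x => by simp only [smul_smul, mul_comm])
  rw [e3, e2]
  rw [e1] at key
  rw [neg_add, ← key]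
  abel

end WeakPairs

/-! ### Mollification in `L²` -/

section Mollify

variable {n : ℕ} {F : Type*} [NormedAddCommGroup F] [NormedSpace ℝ F]

/-- Jensen's inequality for the probability measure ν, followed by exchanging the two integrals of
the squared difference. -/
theorem eLpNorm_average_sub_le [CompleteSpace F] {f : E n → F} (hf : StronglyMeasurable f)
    {ν : Measure (E n)} [IsProbabilityMeasure ν] (hi : ∀ x, Integrable (fun y => f (x - y)) ν)
    {ε : ℝ≥0∞} (h : ∀ᵐ y ∂ν, eLpNorm (fun x => f (x - y) - f x) 2 volume ≤ ε) :
    eLpNorm (fun x => (∫ y, f (x - y) ∂ν) - f x) 2 volume ≤ ε := by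
  have hsq : ∀ (u : E n → F), eLpNorm u 2 volume ≤ ε ↔ ∫⁻ x, ‖u x‖ₑ ^ 2 ≤ ε ^ 2 := by
    intro u
    rw [eLpNorm_eq_lintegral_rpow_enorm_toReal (by norm_num) (by norm_num)]
    simp only [ENNReal.toReal_ofNat, ENNReal.rpow_ofNat, one_div]
    rw [ENNReal.rpow_inv_le_iff (by norm_num), ENNReal.rpow_ofNat]
  rw [hsq]
  simp only [hsq] at h
  have hm : Measurable (uncurry fun (x y : E n) => ‖f (x - y) - f x‖ₑ ^ 2) := by
    have h1 : StronglyMeasurable fun z : E n × E n => f (z.1 - z.2) :=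
      hf.comp_measurable (measurable_fst.sub measurable_snd)
    have h2 : StronglyMeasurable fun z : E n × E n => f z.1 := hf.comp_measurable measurable_fst
    exact (h1.sub h2).enorm.pow_const 2
  calc ∫⁻ x, ‖(∫ y, f (x - y) ∂ν) - f x‖ₑ ^ 2
      ≤ ∫⁻ x, ∫⁻ y, ‖f (x - y) - f x‖ₑ ^ 2 ∂ν := by
        refine lintegral_mono fun x => ?_
        have e1 : (∫ y, f (x - y) ∂ν) - f x = ∫ y, (f (x - y) - f x) ∂ν := by
          rw [integral_sub (hi x) (integrable_const _)]; simp
        have hmx : AEStronglyMeasurable (fun y => f (x - y) - f x) ν :=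
          (hf.comp_measurable (measurable_const.sub measurable_id)).aestronglyMeasurable.sub
            aestronglyMeasurable_const
        have e2 : ‖∫ y, (f (x - y) - f x) ∂ν‖ₑ ≤ eLpNorm (fun y => f (x - y) - f x) 2 ν :=
          (enorm_integral_le_lintegral_enorm _).trans (by
            rw [← eLpNorm_one_eq_lintegral_enorm]
            exact eLpNorm_le_eLpNorm_of_exponent_le (by norm_num) hmx)
        simp only
        rw [e1]
        refine (pow_le_pow_left₀ (by simp) e2 2).trans (le_of_eq ?_)
        rw [eLpNorm_eq_lintegral_rpow_enorm_toReal (by norm_num) (by norm_num)]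
        simp only [ENNReal.toReal_ofNat, ENNReal.rpow_ofNat, one_div]
        rw [← ENNReal.rpow_two, ← ENNReal.rpow_mul]
        norm_num
    _ = ∫⁻ y, (∫⁻ x, ‖f (x - y) - f x‖ₑ ^ 2) ∂ν := lintegral_lintegral_swap hm.aemeasurable
    _ ≤ ∫⁻ _, ε ^ 2 ∂ν := lintegral_mono_ae h
    _ = ε ^ 2 := by simp

/-- This is the continuity of translations in L², read off at y = 0 from the continuity of
composition with measure preserving maps. -/
theorem exists_translate_close (f : Lp F 2 (volume : Measure (E n))) {ε : ℝ≥0∞} (hε : ε ≠ 0) :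
    ∃ δ : ℝ, 0 < δ ∧ ∀ y : E n, ‖y‖ ≤ δ → eLpNorm (fun x => f (x - y) - f x) 2 volume ≤ ε := by
  let g : E n → C(E n, E n) := fun y => ⟨fun x => x - y, by fun_prop⟩
  have hg : Continuous g := by
    have : Continuous fun y => ContinuousMap.curry
      (⟨fun z : E n × E n => z.2 - z.1, by fun_prop⟩ : C(E n × E n, E n)) y :=
      ContinuousMap.continuous _
    exact this
  have hmp : ∀ y, MeasurePreserving (⇑(g y)) (volume : Measure (E n)) volume :=
    fun y => measurePreserving_sub_right volume y
  have hc := Continuous.compMeasurePreservingLp (continuous_const (y := f)) hg hmp (by norm_num)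
  have h0 : Lp.compMeasurePreserving (⇑(g 0)) (hmp 0) f = f := by
    refine Lp.ext ((Lp.coeFn_compMeasurePreserving f (hmp 0)).trans ?_)
    refine Filter.Eventually.of_forall fun x => ?_
    simp [g]
  have ht := hc.tendsto 0
  have := (EMetric.tendsto_nhds.1 ht) ε (pos_iff_ne_zero.2 hε)
  obtain ⟨δ, hδ, hball⟩ := Metric.eventually_nhds_iff.1 this
  refine ⟨δ / 2, by positivity, fun y hy => ?_⟩
  have h1 := hball (y := y) (by rw [dist_zero_right]; linarith)
  rw [h0, Lp.edist_def] at h1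
  refine (le_of_eq (eLpNorm_congr_ae ?_)).trans h1.le
  filter_upwards [Lp.coeFn_compMeasurePreserving f (hmp y)] with x hx
  rw [Pi.sub_apply, hx]
  rfl

/-- Convolution with a normalized bump function. -/
def mollify (b : ContDiffBump (0 : E n)) (f : E n → F) : E n → F :=
  MeasureTheory.convolution (b.normed volume) f (ContinuousLinearMap.lsmul ℝ ℝ) volume

theorem exists_mollify_close [CompleteSpace F] (f : Lp F 2 (volume : Measure (E n)))
    {ε : ℝ≥0∞} (hε : ε ≠ 0) : ∃ δ : ℝ, 0 < δ ∧ ∀ b : ContDiffBump (0 : E n), b.rOut ≤ δ →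
      eLpNorm (fun x => mollify b f x - f x) 2 volume ≤ ε := by
  obtain ⟨δ, hδ, h⟩ := exists_translate_close f hε
  refine ⟨δ, hδ, fun b hb => ?_⟩
  set η : E n → ℝ := b.normed volume with hη
  have hη0 : ∀ x, 0 ≤ η x := b.nonneg_normed
  have hηc : Continuous η := b.continuous_normed
  have hηm : Measurable fun x => ENNReal.ofReal (η x) := hηc.measurable.ennreal_ofReal
  have hηs : HasCompactSupport η := b.hasCompactSupport_normed
  have hηi : Integrable η := b.integrable_normed
  -- Mollification is an average of translates against a probability measure supported in the ball
  -- of radius `b.rOut`.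
  set ν : Measure (E n) := volume.withDensity fun x => ENNReal.ofReal (η x) with hν
  have hprob : IsProbabilityMeasure ν := by
    constructor
    rw [hν, withDensity_apply _ MeasurableSet.univ, Measure.restrict_univ,
      ← ofReal_integral_eq_lintegral_ofReal hηi (Filter.Eventually.of_forall hη0),
      b.integral_normed, ENNReal.ofReal_one]
  have hint : ∀ g : E n → F, ∫ y, g y ∂ν = ∫ y, η y • g y := fun g => by
    rw [hν, integral_withDensity_eq_integral_toReal_smul hηm (by simp)]
    simp only [ENNReal.toReal_ofReal (hη0 _)]
  have hloc : LocallyIntegrable (⇑f) volume := (Lp.memLp f).locallyIntegrable (by norm_num)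
  have hi : ∀ x, Integrable (fun y => f (x - y)) ν := fun x => by
    rw [hν, integrable_withDensity_iff_integrable_smul' hηm (by simp)]
    simp only [ENNReal.toReal_ofReal (hη0 _)]
    exact hηs.convolutionExists_left (ContinuousLinearMap.lsmul ℝ ℝ) hηc hloc x
  have hae : ∀ᵐ y ∂ν, eLpNorm (fun x => f (x - y) - f x) 2 volume ≤ ε := by
    rw [hν, ae_withDensity_iff hηm]
    refine Filter.Eventually.of_forall fun y hy => h y ?_
    have hy' : y ∈ tsupport η := subset_tsupport _ fun h0 => hy (by rw [h0]; simp)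
    rw [hη, b.tsupport_normed_eq] at hy'
    simpa using (Metric.closedBall_subset_closedBall hb hy')
  have key := eLpNorm_average_sub_le (Lp.stronglyMeasurable f) hi hae
  simp only [hint] at key
  exact key

theorem contDiff_mollify (b : ContDiffBump (0 : E n)) {f : E n → F}
    (hf : LocallyIntegrable f volume) : ContDiff ℝ ∞ (mollify b f) :=
  b.hasCompactSupport_normed.contDiff_convolution_left (n := ⊤) _ b.contDiff_normed hf

theorem hasCompactSupport_mollify (b : ContDiffBump (0 : E n)) {f : E n → F}
    (hf : HasCompactSupport f) : HasCompactSupport (mollify b f) :=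
  b.hasCompactSupport_normed.convolution _ hf

/-- The derivative of the convolution falls on the bump, and t ↦ η(x - t) is itself an admissible
test function for the weak gradient of f. -/
theorem gradient_mollify (b : ContDiffBump (0 : E n)) {f : E n → ℝ} {G : E n → E n}
    (hf : LocallyIntegrable f volume) (hfG : IsWeakGradient f G) :
    ∇ (mollify b f) = mollify b G := by
  ext1 x
  set η : E n → ℝ := b.normed volume with hη
  have hηd : ContDiff ℝ ∞ η := b.contDiff_normed
  have hηs : HasCompactSupport η := b.hasCompactSupport_normed
  have hder := hηs.hasFDerivAt_convolution_left (ContinuousLinearMap.lsmul ℝ ℝ : ℝ →L[ℝ] ℝ →L[ℝ] ℝ)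
    (hηd.of_le (by simp)) hf x
  have hφ : ContDiff ℝ ∞ fun t => η (x - t) := hηd.comp (contDiff_const.sub contDiff_id)
  have hφc : HasCompactSupport fun t => η (x - t) :=
    hηs.comp_homeomorph (Homeomorph.subLeft x)
  have hgφ : ∀ t, ∇ (fun t => η (x - t)) t = -∇ η (x - t) := fun t => by
    simp only [gradient_eq_toDual_symm]
    rw [← map_neg]
    congr 1
    have h1 : HasFDerivAt η (fderiv ℝ η (x - t)) (x - t) :=
      (hηd.differentiable (by simp) _).hasFDerivAt
    have h2 : HasFDerivAt (fun t : E n => x - t) (-ContinuousLinearMap.id ℝ (E n)) t :=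
      (hasFDerivAt_id t).const_sub x
    rw [show (fun t => η (x - t)) = η ∘ fun t => x - t from rfl, (h1.comp t h2).fderiv]
    ext v
    simp
  have key := hfG _ hφ hφc
  simp only [hgφ, smul_neg, integral_neg, neg_inj] at key
  have e1 : mollify b G x = ∫ t, η (x - t) • G t := by
    rw [mollify, convolution_eq_swap]; rfl
  rw [e1, ← key, gradient_eq_toDual_symm]
  simp only
  rw [show fderiv ℝ (mollify b f) x = _ from hder.fderiv, convolution_eq_swap]
  have e2 := (InnerProductSpace.toDual ℝ (E n)).symm.toContinuousLinearEquiv.integral_comp_comm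
    (μ := volume) (fun t => ((ContinuousLinearMap.lsmul ℝ ℝ : ℝ →L[ℝ] ℝ →L[ℝ] ℝ).precompL (E n)
      (fderiv ℝ η (x - t))) (f t))
  refine Eq.trans e2.symm (integral_congr_ae (Filter.Eventually.of_forall fun t => ?_))
  simp only
  have e3 : ((ContinuousLinearMap.lsmul ℝ ℝ : ℝ →L[ℝ] ℝ →L[ℝ] ℝ).precompL (E n)
      (fderiv ℝ η (x - t))) (f t) = f t • fderiv ℝ η (x - t) := by
    ext v
    simp [ContinuousLinearMap.precompL_apply, mul_comm]
  rw [e3, gradient_eq_toDual_symm]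
  exact map_smul (InnerProductSpace.toDual ℝ (E n)).symm (f t) (fderiv ℝ η (x - t))

end Mollify

/-! ### Multiplication by bounded smooth functions -/

/-- A smooth bounded function with bounded gradient, acting on `L²` by multiplication. -/
structure Weight (n : ℕ) where
  /-- The underlying function. -/
  toFun : E n → ℝ
  contDiff : ContDiff ℝ ∞ toFun
  bounded : ∃ C, ∀ x, |toFun x| ≤ C
  gradient_bounded : ∃ C, ∀ x, ‖∇ toFun x‖ ≤ C

namespace Weight

variable {n : ℕ} (k : Weight n) {G : Type*} [NormedAddCommGroup G] [NormedSpace ℝ G]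

theorem memLp_top : MemLp k.toFun ∞ volume := by
  obtain ⟨C, hC⟩ := k.bounded
  exact memLp_top_of_bound k.contDiff.continuous.aestronglyMeasurable C
    (Filter.Eventually.of_forall hC)

theorem memLp_top_gradient : MemLp (∇ k.toFun) ∞ volume := by
  obtain ⟨C, hC⟩ := k.gradient_bounded
  exact memLp_top_of_bound (contDiff_gradient k.contDiff).continuous.aestronglyMeasurable C
    (Filter.Eventually.of_forall hC)

variable (G) in
/-- Multiplication by the weight. -/
def mul : Lp G 2 (volume : Measure (E n)) →L[ℝ] Lp G 2 (volume : Measure (E n)) :=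
  (ContinuousLinearMap.lsmul ℝ ℝ : ℝ →L[ℝ] G →L[ℝ] G).holderL volume ∞ 2 2
    (k.memLp_top.toLp k.toFun)

theorem coeFn_mul (f : Lp G 2 (volume : Measure (E n))) :
    k.mul G f =ᵐ[volume] fun x => k.toFun x • f x := by
  filter_upwards [ContinuousLinearMap.coeFn_holder (r := 2)
    (ContinuousLinearMap.lsmul ℝ ℝ : ℝ →L[ℝ] G →L[ℝ] G) (k.memLp_top.toLp k.toFun) f,
    k.memLp_top.coeFn_toLp] with x hx hx'
  rw [mul, ContinuousLinearMap.holderL_apply_apply, hx, hx']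
  rfl

/-- Multiplication by the gradient of the weight. -/
def grad : L2 n →L[ℝ] L2V n :=
  (ContinuousLinearMap.lsmul ℝ ℝ : ℝ →L[ℝ] E n →L[ℝ] E n).flip.holderL volume ∞ 2 2
    (k.memLp_top_gradient.toLp (∇ k.toFun))

theorem coeFn_grad (f : L2 n) : k.grad f =ᵐ[volume] fun x => f x • ∇ k.toFun x := by
  filter_upwards [ContinuousLinearMap.coeFn_holder (r := 2)
    (ContinuousLinearMap.lsmul ℝ ℝ : ℝ →L[ℝ] E n →L[ℝ] E n).flip
    (k.memLp_top_gradient.toLp (∇ k.toFun)) f,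
    k.memLp_top_gradient.coeFn_toLp] with x hx hx'
  rw [grad, ContinuousLinearMap.holderL_apply_apply, hx, hx']
  rfl

theorem norm_mul_le {C : ℝ} (hC : ∀ x, |k.toFun x| ≤ C) (f : Lp G 2 (volume : Measure (E n))) :
    ‖k.mul G f‖ ≤ C * ‖f‖ := by
  refine Lp.norm_le_mul_norm_of_ae_le_mul ?_
  filter_upwards [k.coeFn_mul f] with x hx
  rw [hx, norm_smul]
  exact mul_le_mul_of_nonneg_right (hC x) (norm_nonneg _)

theorem norm_grad_le {C : ℝ} (hC : ∀ x, ‖∇ k.toFun x‖ ≤ C) (f : L2 n) :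
    ‖k.grad f‖ ≤ C * ‖f‖ := by
  refine Lp.norm_le_mul_norm_of_ae_le_mul ?_
  filter_upwards [k.coeFn_grad f] with x hx
  rw [hx, norm_smul, mul_comm]
  exact mul_le_mul_of_nonneg_right (hC x) (norm_nonneg _)

/-- For weights with |∇k| ≤ C|k|, terms containing ∇k are absorbed by the weighted energy itself,
which is what closes the energy estimate. -/
theorem norm_grad_le_mul {C : ℝ} (hC : ∀ x, ‖∇ k.toFun x‖ ≤ C * |k.toFun x|) (f : L2 n) :
    ‖k.grad f‖ ≤ C * ‖k.mul ℝ f‖ := by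
  refine Lp.norm_le_mul_norm_of_ae_le_mul ?_
  filter_upwards [k.coeFn_grad f, k.coeFn_mul f] with x hx hx'
  rw [hx, hx', norm_smul, norm_smul, Real.norm_eq_abs (k.toFun x)]
  calc ‖f x‖ * ‖∇ k.toFun x‖ ≤ ‖f x‖ * (C * |k.toFun x|) := by gcongr; exact hC x
    _ = _ := by ring

theorem weakPair_mul {z : L2 n × L2V n} (hz : z ∈ weakPairs n) :
    (k.mul ℝ z.1, k.mul (E n) z.2 + k.grad z.1) ∈ weakPairs n := by
  rw [mem_weakPairs] at hz ⊢
  refine (hz.mul_smooth (Lp.memLp _) (Lp.memLp _) k.contDiff).congr (k.coeFn_mul z.1).symm ?_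
  filter_upwards [Lp.coeFn_add (k.mul (E n) z.2) (k.grad z.1), k.coeFn_mul z.2,
    k.coeFn_grad z.1] with x h1 h2 h3
  rw [h1, Pi.add_apply, h2, h3]

theorem inner_mul_left {G : Type*} [NormedAddCommGroup G] [InnerProductSpace ℝ G]
    (f g : Lp G 2 (volume : Measure (E n))) :
    inner ℝ (k.mul G f) g = inner ℝ f (k.mul G g) := by
  rw [L2.inner_def, L2.inner_def]
  refine integral_congr_ae ?_
  filter_upwards [k.coeFn_mul f, k.coeFn_mul g] with x h1 h2
  rw [h1, h2, real_inner_smul_left, real_inner_smul_right]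

theorem mul_grad (f : L2 n) : k.mul (E n) (k.grad f) = k.grad (k.mul ℝ f) := by
  refine Lp.ext ?_
  filter_upwards [k.coeFn_mul (k.grad f), k.coeFn_grad (k.mul ℝ f), k.coeFn_grad f,
    k.coeFn_mul f] with x h1 h2 h3 h4
  rw [h1, h2, h3, h4, smul_smul, smul_eq_mul]

end Weight

/-! ### Density of test functions -/

section Density

variable {n : ℕ}

/-- A fixed smooth cutoff function. -/
def unitBump (n : ℕ) : ContDiffBump (0 : E n) := ⟨1, 2, one_pos, one_lt_two⟩

theorem exists_unitBump_gradient_bound (n : ℕ) : ∃ C, ∀ x, ‖∇ (unitBump n : E n → ℝ) x‖ ≤ C :=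
  (hasCompactSupport_gradient (unitBump n).hasCompactSupport).exists_bound_of_continuous
    (contDiff_gradient (unitBump n).contDiff).continuous

theorem gradient_comp_smul {φ : E n → ℝ} (c : ℝ) (x : E n) :
    ∇ (fun y => φ (c • y)) x = c • ∇ φ (c • x) := by
  rw [gradient_eq_toDual_symm, gradient_eq_toDual_symm]
  simp only
  rw [fderiv_comp_smul, map_smul]

/-- Smooth cutoff functions at scale `R`. -/
def cutoff (n : ℕ) (R : ℝ) : Weight n where
  toFun x := unitBump n (R⁻¹ • x)
  contDiff := (unitBump n).contDiff.comp (contDiff_const_smul _)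
  bounded := ⟨1, fun x => by rw [abs_of_nonneg (unitBump n).nonneg]; exact (unitBump n).le_one⟩
  gradient_bounded := by
    obtain ⟨C, hC⟩ := exists_unitBump_gradient_bound n
    refine ⟨|R⁻¹| * C, fun x => ?_⟩
    rw [gradient_comp_smul, norm_smul, Real.norm_eq_abs]
    gcongr
    exact hC _

theorem cutoff_nonneg (R : ℝ) (x : E n) : 0 ≤ (cutoff n R).toFun x := (unitBump n).nonneg

theorem abs_cutoff_le_one (R : ℝ) (x : E n) : |(cutoff n R).toFun x| ≤ 1 := by
  rw [abs_of_nonneg (cutoff_nonneg R x)]; exact (unitBump n).le_one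

theorem cutoff_eq_one {R : ℝ} (hR : 0 < R) {x : E n} (hx : ‖x‖ ≤ R) :
    (cutoff n R).toFun x = 1 := by
  refine (unitBump n).one_of_mem_closedBall ?_
  rw [mem_closedBall_zero_iff, norm_smul, norm_inv, Real.norm_of_nonneg hR.le,
    inv_mul_le_iff₀ hR]
  simpa [unitBump] using hx

theorem hasCompactSupport_cutoff {R : ℝ} (hR : 0 < R) : HasCompactSupport (cutoff n R).toFun :=
  (unitBump n).hasCompactSupport.comp_smul (inv_ne_zero hR.ne')

theorem tendsto_cutoff_mul {G : Type*} [NormedAddCommGroup G] [NormedSpace ℝ G]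
    (f : Lp G 2 (volume : Measure (E n))) :
    Filter.Tendsto (fun R => (cutoff n R).mul G f) Filter.atTop (nhds f) := by
  rw [Metric.tendsto_atTop]
  intro ε hε
  obtain ⟨g, hgc, hgd, hfg⟩ := (Lp.memLp f).exist_eLpNorm_sub_le (by norm_num) (by norm_num)
    (show 0 < ε / 4 by positivity)
  have hg : MemLp g 2 volume := memLp_of_smooth hgd hgc
  set u : Lp G 2 (volume : Measure (E n)) := hg.toLp g with hu
  have hfu : ‖f - u‖ ≤ ε / 4 := by
    rw [Lp.norm_def]
    refine ENNReal.toReal_le_of_le_ofReal (by positivity) (le_trans (le_of_eq ?_) hfg)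
    refine eLpNorm_congr_ae ?_
    filter_upwards [Lp.coeFn_sub f u, hg.coeFn_toLp] with x h1 h2
    rw [h1, Pi.sub_apply, Pi.sub_apply, hu, h2]
  obtain ⟨r, hr⟩ := hgc.isBounded.exists_norm_le
  refine ⟨max r 1, fun R hR => ?_⟩
  have hR0 : 0 < R := lt_of_lt_of_le one_pos ((le_max_right _ _).trans hR)
  have hχu : (cutoff n R).mul G u = u := by
    refine Lp.ext ?_
    filter_upwards [(cutoff n R).coeFn_mul u, hg.coeFn_toLp] with x h1 h2
    rw [h1, hu, h2]
    by_cases hx : x ∈ tsupport g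
    · rw [cutoff_eq_one hR0 ((hr x hx).trans ((le_max_left _ _).trans hR)), one_smul]
    · rw [image_eq_zero_of_notMem_tsupport hx, smul_zero]
  have e : (cutoff n R).mul G f - f = (cutoff n R).mul G (f - u) - (f - u) := by
    rw [map_sub, hχu]; abel
  rw [dist_eq_norm, e]
  have := (cutoff n R).norm_mul_le (abs_cutoff_le_one R) (f - u)
  calc _ ≤ ‖(cutoff n R).mul G (f - u)‖ + ‖f - u‖ := norm_sub_le _ _
    _ < ε := by linarith

theorem tendsto_cutoff_grad (f : L2 n) :
    Filter.Tendsto (fun R => (cutoff n R).grad f) Filter.atTop (nhds 0) := by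
  obtain ⟨C, hC⟩ := exists_unitBump_gradient_bound n
  have hlim : Filter.Tendsto (fun R : ℝ => |R⁻¹| * C * ‖f‖) Filter.atTop (nhds (|0| * C * ‖f‖)) :=
    ((tendsto_inv_atTop_zero.abs).mul_const C).mul_const _
  rw [abs_zero, zero_mul, zero_mul] at hlim
  refine squeeze_zero_norm (fun R => (cutoff n R).norm_grad_le (C := |R⁻¹| * C) (fun x => ?_) f)
    hlim
  rw [show (cutoff n R).toFun = fun y => unitBump n (R⁻¹ • y) from rfl, gradient_comp_smul,
    norm_smul, Real.norm_eq_abs]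
  gcongr
  exact hC _

/-- The set of pairs given by test functions. -/
def testPairs (n : ℕ) : Set (L2 n × L2V n) :=
  {z | ∃ (φ : E n → ℝ) (hφ : ContDiff ℝ ∞ φ) (hc : HasCompactSupport φ), z = testPair φ hφ hc}

/-- A mollification of a compactly supported f is a test function, and its gradient is the mollified
weak gradient, so both components converge in L² at once. -/
theorem mem_closure_testPairs_of_hasCompactSupport {z : L2 n × L2V n} (hz : z ∈ weakPairs n)
    {f : E n → ℝ} (hf : ⇑z.1 =ᵐ[volume] f) (hfc : HasCompactSupport f) :
    z ∈ closure (testPairs n) := by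
  rw [Metric.mem_closure_iff]
  intro ε hε
  have hε' : ENNReal.ofReal (ε / 2) ≠ 0 := by simpa using hε
  obtain ⟨δ₁, hδ₁, h₁⟩ := exists_mollify_close z.1 hε'
  obtain ⟨δ₂, hδ₂, h₂⟩ := exists_mollify_close z.2 hε'
  have hmin : 0 < min δ₁ δ₂ := lt_min hδ₁ hδ₂
  let b : ContDiffBump (0 : E n) := ⟨min δ₁ δ₂ / 2, min δ₁ δ₂, by positivity, by linarith⟩
  have hloc : LocallyIntegrable f volume :=
    (((memLp_congr_ae hf).1 (Lp.memLp z.1))).locallyIntegrable (by norm_num)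
  have hmf : mollify b f = mollify b z.1 := by
    ext1 x
    rw [mollify, mollify, convolution_eq_swap, convolution_eq_swap]
    exact integral_congr_ae (by filter_upwards [hf] with t ht; rw [ht])
  have hs : ContDiff ℝ ∞ (mollify b f) := contDiff_mollify b hloc
  have hc : HasCompactSupport (mollify b f) := hasCompactSupport_mollify b hfc
  have hgr : ∇ (mollify b f) = mollify b z.2 :=
    gradient_mollify b hloc ((mem_weakPairs.1 hz).congr hf (Filter.EventuallyEq.refl _ _))
  refine ⟨testPair _ hs hc, ⟨_, hs, hc, rfl⟩, ?_⟩
  rw [dist_comm, Prod.dist_eq]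
  refine max_lt ?_ ?_
  · refine lt_of_le_of_lt (b := ε / 2) ?_ (by linarith)
    rw [dist_eq_norm, Lp.norm_def]
    refine ENNReal.toReal_le_of_le_ofReal (by positivity)
      (le_trans (le_of_eq ?_) (h₁ b (min_le_left _ _)))
    refine eLpNorm_congr_ae ?_
    filter_upwards [Lp.coeFn_sub (testPair _ hs hc).1 z.1, coeFn_testPair_fst hs hc] with x h3 h4
    rw [h3, Pi.sub_apply, h4, hmf]
  · refine lt_of_le_of_lt (b := ε / 2) ?_ (by linarith)
    rw [dist_eq_norm, Lp.norm_def]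
    refine ENNReal.toReal_le_of_le_ofReal (by positivity)
      (le_trans (le_of_eq ?_) (h₂ b (min_le_right _ _)))
    refine eLpNorm_congr_ae ?_
    filter_upwards [Lp.coeFn_sub (testPair _ hs hc).2 z.2, coeFn_testPair_snd hs hc] with x h3 h4
    rw [h3, Pi.sub_apply, h4, hgr]

/-- Test functions are dense in `H¹`. -/
theorem weakPairs_subset_closure : (weakPairs n : Set (L2 n × L2V n)) ⊆ closure (testPairs n) := by
  intro z hz
  have hlim : Filter.Tendsto (fun R => ((cutoff n R).mul ℝ z.1,
      (cutoff n R).mul (E n) z.2 + (cutoff n R).grad z.1)) Filter.atTop (nhds z) := by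
    have := (tendsto_cutoff_mul z.2).add (tendsto_cutoff_grad z.1)
    rw [add_zero] at this
    exact (tendsto_cutoff_mul z.1).prodMk_nhds this
  refine isClosed_closure.mem_of_tendsto hlim ?_
  filter_upwards [Filter.eventually_gt_atTop 0] with R hR
  exact mem_closure_testPairs_of_hasCompactSupport ((cutoff n R).weakPair_mul hz)
    ((cutoff n R).coeFn_mul z.1) (hasCompactSupport_cutoff hR).smul_right

/-- A closed property that holds for test functions holds on H¹; this extends the Sobolev inequality
and the weak equation from smooth functions. -/
theorem testPairs_induction {p : L2 n × L2V n → Prop} (hp : IsClosed {z | p z})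
    (h : ∀ (φ : E n → ℝ) (hφ : ContDiff ℝ ∞ φ) (hc : HasCompactSupport φ), p (testPair φ hφ hc))
    {z : L2 n × L2V n} (hz : z ∈ weakPairs n) : p z :=
  closure_minimal (by rintro _ ⟨φ, hφ, hc, rfl⟩; exact h φ hφ hc) hp
    (weakPairs_subset_closure hz)

end Density

/-! ### The Sobolev inequality for `H¹` -/

/-! ### Interpolation between Lebesgue exponents. -/

section Interpolation

variable {α F : Type*} [MeasurableSpace α] {μ : Measure α} [NormedAddCommGroup F]

/-- Pointwise a^r ≤ A^(r-2) a² + A^(r-q) a^q, by the first term when a ≤ A and by the second when a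
≥ A. Integrating gives 2 A^r. -/
theorem eLpNorm_le_two_mul_of_le {f : α → F} (hf : AEStronglyMeasurable f μ) {r q : ℝ}
    (hr : 2 ≤ r) (hrq : r ≤ q) {A : ℝ≥0∞} (h2 : eLpNorm f 2 μ ≤ A)
    (hq : eLpNorm f (ENNReal.ofReal q) μ ≤ A) : eLpNorm f (ENNReal.ofReal r) μ ≤ 2 * A := by
  rcases eq_or_ne A ⊤ with rfl | hAt
  · simp
  rcases eq_or_ne A 0 with rfl | hA0
  · have := (eLpNorm_eq_zero_iff hf (by norm_num)).1 (le_antisymm h2 (by simp))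
    rw [eLpNorm_congr_ae this, eLpNorm_zero]
    simp
  have hr0 : 0 < r := by linarith
  have hq0 : 0 < q := by linarith
  have hpow : ∀ s : ℝ, 0 < s → eLpNorm f (ENNReal.ofReal s) μ ≤ A → ∫⁻ x, ‖f x‖ₑ ^ s ∂μ ≤ A ^ s := by
    intro s hs h
    rw [eLpNorm_eq_lintegral_rpow_enorm_toReal (by simpa using hs) (by simp),
      ENNReal.toReal_ofReal hs.le, one_div, ENNReal.rpow_inv_le_iff hs] at h
    exact h
  have h2' := hpow 2 (by norm_num) (by simpa using h2)
  have hq' := hpow q hq0 hq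
  rw [eLpNorm_eq_lintegral_rpow_enorm_toReal (by simpa using hr0) (by simp),
    ENNReal.toReal_ofReal hr0.le, one_div, ENNReal.rpow_inv_le_iff hr0]
  have hpt : ∀ a : ℝ≥0∞, a ^ r ≤ A ^ (r - 2) * a ^ (2 : ℝ) + A ^ (r - q) * a ^ q := by
    intro a
    rcases eq_or_ne a ⊤ with rfl | hat
    · refine le_add_left ?_
      rw [ENNReal.top_rpow_of_pos hq0, ENNReal.mul_top]
      · exact le_top
      · simp [ENNReal.rpow_eq_zero_iff, hAt, hA0]
    rcases eq_or_ne a 0 with rfl | ha0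
    · rw [ENNReal.zero_rpow_of_pos hr0]; simp
    rcases le_total a A with h | h
    · refine le_add_right ?_
      calc a ^ r = a ^ (r - 2) * a ^ (2 : ℝ) := by rw [← ENNReal.rpow_add _ _ ha0 hat]; ring_nf
        _ ≤ _ := by gcongr
    · refine le_add_left ?_
      calc a ^ r = a ^ (r - q) * a ^ q := by rw [← ENNReal.rpow_add _ _ ha0 hat]; ring_nf
        _ ≤ _ := by
          refine mul_le_mul' ?_ le_rfl
          rw [← neg_sub q r, ENNReal.rpow_neg, ENNReal.rpow_neg]
          exact ENNReal.inv_le_inv.2 (ENNReal.rpow_le_rpow h (by linarith))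
  calc ∫⁻ x, ‖f x‖ₑ ^ r ∂μ
      ≤ ∫⁻ x, (A ^ (r - 2) * ‖f x‖ₑ ^ (2 : ℝ) + A ^ (r - q) * ‖f x‖ₑ ^ q) ∂μ :=
        lintegral_mono fun x => hpt _
    _ = A ^ (r - 2) * (∫⁻ x, ‖f x‖ₑ ^ (2 : ℝ) ∂μ) + A ^ (r - q) * ∫⁻ x, ‖f x‖ₑ ^ q ∂μ := by
        rw [lintegral_add_left' ((hf.enorm.pow_const _).const_mul _),
          lintegral_const_mul'' _ (hf.enorm.pow_const _),
          lintegral_const_mul'' _ (hf.enorm.pow_const _)]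
    _ ≤ A ^ (r - 2) * A ^ (2 : ℝ) + A ^ (r - q) * A ^ q := by gcongr
    _ = 2 * A ^ r := by
        rw [← ENNReal.rpow_add _ _ hA0 hAt, ← ENNReal.rpow_add _ _ hA0 hAt, sub_add_cancel,
          sub_add_cancel, two_mul]
    _ ≤ (2 * A) ^ r := by
        rw [ENNReal.mul_rpow_of_nonneg _ _ hr0.le]
        gcongr
        calc (2 : ℝ≥0∞) = 2 ^ (1 : ℝ) := by simp
          _ ≤ 2 ^ r := ENNReal.rpow_le_rpow_of_exponent_le (by norm_num) (by linarith)

theorem eLpNorm_pow_two (f : α → ℝ) {k : ℕ} (hk : k ≠ 0) :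
    eLpNorm (fun x => f x ^ k) 2 μ = eLpNorm f (ENNReal.ofReal (2 * k)) μ ^ k := by
  have h := eLpNorm_norm_rpow (p := 2) (μ := μ) f (q := k) (by positivity)
  rw [ENNReal.rpow_natCast] at h
  rw [ENNReal.ofReal_mul (by norm_num)]
  simp only [ENNReal.ofReal_ofNat]
  rw [← h, ← eLpNorm_norm]
  congr 1
  ext x
  rw [Real.rpow_natCast, norm_pow]

end Interpolation

/-! ### The Sobolev inequality for smooth compactly supported functions. -/

section Sobolev

/-- The `H¹` norm of a smooth function. -/
def smoothNorm {n : ℕ} (φ : E n → ℝ) : ℝ≥0∞ :=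
  eLpNorm φ 2 volume + eLpNorm (fderiv ℝ φ) 2 volume

/-- The value ψ(s)² is the integral of 2ψψ' up to s, and Cauchy–Schwarz bounds it by 2 ‖ψ‖ ‖ψ'‖ ≤
(‖ψ‖ + ‖ψ'‖)². -/
theorem sobolev_dim_one {φ : E 1 → ℝ} (hφ : ContDiff ℝ ∞ φ) (hc : HasCompactSupport φ) (x : E 1) :
    ‖φ x‖ₑ ≤ smoothNorm φ := by
  set e : E 1 := EuclideanSpace.single 0 1 with he
  have hne : ‖e‖ = 1 := by simp [he]
  set L : ℝ → E 1 := fun s => s • e with hL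
  have hLe : ∀ s, L s = WithLp.toLp 2 (fun _ => s) := fun s => by
    ext i
    fin_cases i
    simp [hL, he]
  have hLm : MeasurePreserving L volume volume := by
    have h1 := (volume_preserving_funUnique (Fin 1) ℝ).symm
    have h2 := (PiLp.volume_preserving_toLp (Fin 1)).comp h1
    convert! h2 using 1
    ext1 s
    rw [hLe]
    rfl
  have hLc : Topology.IsClosedEmbedding L := by
    refine (LinearMap.isClosedEmbedding_of_injective (f := LinearMap.toSpanSingleton ℝ (E 1) e) ?_)
    rw [LinearMap.ker_toSpanSingleton]
    intro h; simp [h] at hne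
  set ψ : ℝ → ℝ := fun s => φ (L s) with hψ
  have hLd : ContDiff ℝ ∞ L := contDiff_id.smul contDiff_const
  have hψd : ContDiff ℝ ∞ ψ := hφ.comp hLd
  have hψc : HasCompactSupport ψ := hc.comp_isClosedEmbedding hLc
  have hder : ∀ s, ‖deriv ψ s‖ₑ ≤ ‖fderiv ℝ φ (L s)‖ₑ := fun s => by
    have h1 : HasDerivAt L e s := by
      simpa [hL] using (hasDerivAt_id s).smul_const e
    have h2 := ((hφ.differentiable (by simp) (L s)).hasFDerivAt.comp_hasDerivAt s h1).deriv
    rw [show deriv ψ s = fderiv ℝ φ (L s) e from h2, enorm_le_iff_norm_le]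
    simpa [hne] using (fderiv ℝ φ (L s)).le_opNorm e
  obtain ⟨s, rfl⟩ : ∃ s, L s = x := ⟨x 0, by
    rw [hLe]; ext i; fin_cases i; rfl⟩
  have hsqd : ContDiff ℝ 1 fun s => ψ s ^ 2 := (hψd.pow 2).of_le (by simp)
  have hsqc : HasCompactSupport fun s => ψ s ^ 2 := hψc.comp_left (g := fun y : ℝ => y ^ 2) (by simp)
  have e2 : eLpNorm ψ 2 volume = eLpNorm φ 2 volume :=
    eLpNorm_comp_measurePreserving hφ.continuous.aestronglyMeasurable hLm
  have e3 : eLpNorm (deriv ψ) 2 volume ≤ eLpNorm (fderiv ℝ φ) 2 volume := by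
    have h1 : eLpNorm (fderiv ℝ φ ∘ L) 2 volume = eLpNorm (fderiv ℝ φ) 2 volume :=
      eLpNorm_comp_measurePreserving (hφ.continuous_fderiv (by simp)).aestronglyMeasurable hLm
    rw [← h1]
    exact eLpNorm_mono_enorm hder
  have key : ‖ψ s‖ₑ ^ 2 ≤ smoothNorm φ ^ 2 := by
    calc ‖ψ s‖ₑ ^ 2 = ‖ψ s ^ 2‖ₑ := (enorm_pow _ _).symm
      _ ≤ ∫⁻ y in Iic s, ‖deriv (fun s => ψ s ^ 2) y‖ₑ :=
          hsqc.enorm_le_lintegral_Ici_deriv hsqd s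
      _ ≤ ∫⁻ y, ‖deriv (fun s => ψ s ^ 2) y‖ₑ := setLIntegral_le_lintegral _ _
      _ = eLpNorm (fun y => (2 * ψ y) • deriv ψ y) 1 volume := by
          rw [eLpNorm_one_eq_lintegral_enorm]
          congr 1
          ext1 y
          rw [deriv_fun_pow (hψd.differentiable (by simp) y)]
          simp
      _ ≤ eLpNorm (fun y => 2 * ψ y) 2 volume * eLpNorm (deriv ψ) 2 volume :=
          eLpNorm_smul_le_mul_eLpNorm (p := 2) (q := 2) (r := 1) (φ := fun y => 2 * ψ y)
            (f := deriv ψ)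
            (hψd.continuous_deriv (by simp)).aestronglyMeasurable
            (hψd.continuous.const_mul 2).aestronglyMeasurable
      _ = 2 * eLpNorm ψ 2 volume * eLpNorm (deriv ψ) 2 volume := by
          have := eLpNorm_const_smul (2 : ℝ) ψ 2 (volume : Measure ℝ)
          rw [show (fun y => 2 * ψ y) = (2 : ℝ) • ψ from rfl, this]
          congr 2
          rw [Real.enorm_eq_ofReal (by norm_num)]; simp
      _ ≤ 2 * eLpNorm φ 2 volume * eLpNorm (fderiv ℝ φ) 2 volume := by rw [e2]; gcongr
      _ ≤ smoothNorm φ ^ 2 := by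
          rw [smoothNorm, add_sq]
          exact le_add_right (le_add_left le_rfl)
  exact (ENNReal.pow_le_pow_left_iff (by norm_num)).1 key

/-- Induction on k. The Gagliardo–Nirenberg–Sobolev inequality bounds the L² norm of φ^(k+1) by the
L¹ norm of its gradient (k+1) φ^k ∇φ, and Cauchy–Schwarz leaves the L^(2k) norm of φ from the
previous stage. All even exponents are reached, although H¹ does not embed in L^∞. -/
theorem sobolev_dim_two {k : ℕ} (hk : 1 ≤ k) : ∃ C : NNReal, ∀ φ : E 2 → ℝ, ContDiff ℝ ∞ φ →
    HasCompactSupport φ → eLpNorm φ (ENNReal.ofReal (2 * k)) volume ≤ C * smoothNorm φ := by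
  induction k, hk using Nat.le_induction with
  | base =>
    refine ⟨1, fun φ _ _ => ?_⟩
    simp only [Nat.cast_one, mul_one, ENNReal.coe_one, one_mul, ENNReal.ofReal_ofNat]
    exact le_self_add
  | succ k hk ih =>
    obtain ⟨C, hC⟩ := ih
    set K := eLpNormLESNormFDerivOneConst (volume : Measure (E 2)) 2 with hK
    set D : NNReal := max 1 (K * ((k + 1 : ℕ) * C ^ k)) with hD
    refine ⟨D, fun φ hφ hc => ?_⟩
    have hk0 : k ≠ 0 := by omega
    have hu : ContDiff ℝ 1 fun x => φ x ^ (k + 1) := (hφ.pow _).of_le (by simp)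
    have huc : HasCompactSupport fun x => φ x ^ (k + 1) :=
      hc.comp_left (g := fun y : ℝ => y ^ (k + 1)) (by simp)
    have hconj : NNReal.HolderConjugate (Module.finrank ℝ (E 2)) 2 := by
      rw [finrank_euclideanSpace_fin]
      exact NNReal.HolderConjugate.two_two
    have h1 := eLpNorm_le_eLpNorm_fderiv_one (volume : Measure (E 2)) hu huc hconj
    have hfd : fderiv ℝ (fun x => φ x ^ (k + 1))
        = fun x => ((k + 1 : ℕ) * φ x ^ k) • fderiv ℝ φ x := by
      ext1 x
      rw [fderiv_fun_pow _ (hφ.differentiable (by simp) x)]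
      simp
    have h2 : eLpNorm (fderiv ℝ fun x => φ x ^ (k + 1)) 1 volume ≤
        (k + 1 : ℕ) * eLpNorm φ (ENNReal.ofReal (2 * k)) volume ^ k *
          eLpNorm (fderiv ℝ φ) 2 volume := by
      rw [hfd]
      refine (eLpNorm_smul_le_mul_eLpNorm (p := 2) (q := 2)
        (hφ.continuous_fderiv (by simp)).aestronglyMeasurable
        ((hφ.continuous.pow k).const_mul _).aestronglyMeasurable).trans ?_
      gcongr
      have := eLpNorm_const_smul ((k + 1 : ℕ) : ℝ) (fun x => φ x ^ k) 2 (volume : Measure (E 2))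
      refine (le_of_eq this).trans ?_
      rw [eLpNorm_pow_two _ hk0, Real.enorm_natCast]
    rw [NNReal.coe_ofNat] at h1
    have h3 : eLpNorm φ (ENNReal.ofReal (2 * ((k + 1 : ℕ) : ℝ))) volume ^ (k + 1)
        ≤ (D * smoothNorm φ) ^ (k + 1) := by
      rw [← eLpNorm_pow_two _ (by omega)]
      calc _ ≤ (K : ℝ≥0∞) * ((k + 1 : ℕ) * (C * smoothNorm φ) ^ k * smoothNorm φ) := by
            refine h1.trans ?_
            gcongr
            refine h2.trans ?_
            gcongr
            · exact hC φ hφ hc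
            · exact le_add_self
        _ = ((K * ((k + 1 : ℕ) * C ^ k) : NNReal) : ℝ≥0∞) * smoothNorm φ ^ (k + 1) := by
            push_cast; ring
        _ ≤ (D : ℝ≥0∞) ^ (k + 1) * smoothNorm φ ^ (k + 1) := by
            gcongr
            norm_cast
            calc _ ≤ D := le_max_right _ _
              _ ≤ D ^ (k + 1) := le_self_pow₀ (le_max_left _ _) (by omega)
        _ = _ := by rw [mul_pow]
    exact (ENNReal.pow_le_pow_left_iff (by omega)).1 h3

/-- An endpoint estimate is interpolated with L²: the supremum norm for n = 1, a large even exponent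
for n = 2, and the critical exponent 2n/(n-2) for n ≥ 3. -/
theorem sobolev_smooth {n : ℕ} (hn : 1 ≤ n) {r : ℝ} (hr : 2 ≤ r)
    (hrn : 3 ≤ n → r ≤ 2 * n / ((n : ℝ) - 2)) : ∃ C : NNReal, ∀ φ : E n → ℝ, ContDiff ℝ ∞ φ →
    HasCompactSupport φ → eLpNorm φ (ENNReal.ofReal r) volume ≤ C * smoothNorm φ := by
  obtain rfl | rfl | hn3 : n = 1 ∨ n = 2 ∨ 3 ≤ n := by omega
  · refine ⟨2, fun φ hφ hc => ?_⟩
    have hsup := sobolev_dim_one hφ hc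
    have hr0 : 0 < r := by linarith
    have h2 : eLpNorm φ 2 volume ≤ smoothNorm φ := le_self_add
    set A := smoothNorm φ with hA
    rw [eLpNorm_eq_lintegral_rpow_enorm_toReal (by norm_num) (by norm_num), ENNReal.toReal_ofNat,
      one_div, ENNReal.rpow_inv_le_iff (by norm_num)] at h2
    rw [eLpNorm_eq_lintegral_rpow_enorm_toReal (by simpa using hr0) (by simp),
      ENNReal.toReal_ofReal hr0.le, one_div, ENNReal.rpow_inv_le_iff hr0]
    calc ∫⁻ x, ‖φ x‖ₑ ^ r ≤ ∫⁻ x, A ^ (r - 2) * ‖φ x‖ₑ ^ (2 : ℝ) := by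
          refine lintegral_mono fun x => ?_
          calc ‖φ x‖ₑ ^ r = ‖φ x‖ₑ ^ ((r - 2) + 2) := by ring_nf
            _ = ‖φ x‖ₑ ^ (r - 2) * ‖φ x‖ₑ ^ (2 : ℝ) :=
                ENNReal.rpow_add_of_nonneg _ _ (by linarith) (by norm_num)
            _ ≤ _ := by gcongr; exact hsup x
      _ = A ^ (r - 2) * ∫⁻ x, ‖φ x‖ₑ ^ (2 : ℝ) :=
          lintegral_const_mul _ (by have := hφ.continuous; fun_prop)
      _ ≤ A ^ (r - 2) * A ^ (2 : ℝ) := by gcongr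
      _ = A ^ r := by rw [← ENNReal.rpow_add_of_nonneg _ _ (by linarith) (by norm_num)]; ring_nf
      _ ≤ _ := by
          gcongr
          calc A = 1 * A := (one_mul A).symm
            _ ≤ _ := by gcongr; norm_num
  · obtain ⟨k, hk⟩ := exists_nat_ge (r / 2)
    have hk1 : 1 ≤ k := by
      have : (1 : ℝ) ≤ k := by linarith
      exact_mod_cast this
    obtain ⟨C, hC⟩ := sobolev_dim_two hk1
    refine ⟨2 * max 1 C, fun φ hφ hc => ?_⟩
    have := eLpNorm_le_two_mul_of_le (μ := (volume : Measure (E 2)))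
      hφ.continuous.aestronglyMeasurable hr (q := 2 * k)
      (by linarith) (A := (max 1 C : NNReal) * smoothNorm φ) ?_ ?_
    · refine this.trans (le_of_eq ?_)
      push_cast; ring
    · calc _ ≤ smoothNorm φ := le_self_add
        _ = (1 : NNReal) * smoothNorm φ := by simp
        _ ≤ _ := by gcongr; exact le_max_left _ _
    · refine (hC φ hφ hc).trans ?_
      gcongr
      exact le_max_right _ _
  · have hn' : (3 : ℝ) ≤ n := by exact_mod_cast hn3
    set q : ℝ := 2 * n / ((n : ℝ) - 2) with hq
    have hq0 : 0 < q := by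
      have : 0 < (n : ℝ) - 2 := by linarith
      positivity
    set C := SNormLESNormFDerivOfEqConst ℝ (volume : Measure (E n)) 2 with hC
    refine ⟨2 * max 1 C, fun φ hφ hc => ?_⟩
    have hgns := eLpNorm_le_eLpNorm_fderiv_of_eq (volume : Measure (E n)) (u := φ)
      (hφ.of_le (by simp)) hc (p := 2) (p' := q.toNNReal) (by norm_num)
      (by rw [finrank_euclideanSpace_fin]; omega) (by
        rw [finrank_euclideanSpace_fin, Real.coe_toNNReal _ hq0.le, hq]
        have : (n : ℝ) - 2 ≠ 0 := by linarith
        have : (n : ℝ) ≠ 0 := by linarith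
        push_cast
        field_simp)
    have := eLpNorm_le_two_mul_of_le (μ := (volume : Measure (E n)))
      hφ.continuous.aestronglyMeasurable hr (q := q)
      (hrn hn3) (A := (max 1 C : NNReal) * smoothNorm φ) ?_ ?_
    · refine this.trans (le_of_eq ?_)
      push_cast; ring
    · calc _ ≤ smoothNorm φ := le_self_add
        _ = (1 : NNReal) * smoothNorm φ := by simp
        _ ≤ _ := by gcongr; exact le_max_left _ _
    · refine (le_trans (le_of_eq rfl) hgns).trans ?_
      rw [NNReal.coe_ofNat] at *
      gcongr
      · exact le_max_right _ _
      · exact le_add_self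

end Sobolev

/-! ### The power nonlinearity on `H¹` -/

section Power

variable {n : ℕ}

/-- The Sobolev inequality for pairs of a function and its weak gradient. -/
theorem sobolev_weakPairs (hn : 1 ≤ n) {r : ℝ} (hr : 2 ≤ r)
    (hrn : 3 ≤ n → r ≤ 2 * n / ((n : ℝ) - 2)) : ∃ C : ℝ, 0 ≤ C ∧ ∀ z ∈ weakPairs n,
      eLpNorm z.1 (ENNReal.ofReal r) volume ≤ ENNReal.ofReal (C * (‖z.1‖ + ‖z.2‖)) := by
  obtain ⟨C, hC⟩ := sobolev_smooth hn hr hrn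
  refine ⟨C, C.2, fun z hz => ?_⟩
  refine testPairs_induction (p := fun z => eLpNorm z.1 (ENNReal.ofReal r) volume ≤
    ENNReal.ofReal (C * (‖z.1‖ + ‖z.2‖))) ?_ ?_ hz
  -- The condition is closed because the L^r norm is lower semicontinuous along an almost everywhere
  -- convergent subsequence.
  · refine IsSeqClosed.isClosed fun x z hx hlim => ?_
    have h1 : Filter.Tendsto (fun k => (x k).1) Filter.atTop (nhds z.1) :=
      (continuous_fst.tendsto z).comp hlim
    obtain ⟨ns, hns, hae⟩ := (tendstoInMeasure_of_tendsto_Lp h1).exists_seq_tendsto_ae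
    refine (Lp.eLpNorm_lim_le_liminf_eLpNorm (fun k => Lp.aestronglyMeasurable _) _ hae).trans ?_
    have hc : Continuous fun z : L2 n × L2V n => ENNReal.ofReal (C * (‖z.1‖ + ‖z.2‖)) :=
      ENNReal.continuous_ofReal.comp (by fun_prop)
    have h2 := ((hc.tendsto z).comp hlim).comp hns.tendsto_atTop
    rw [← h2.liminf_eq]
    exact Filter.liminf_le_liminf (Filter.Eventually.of_forall fun k => hx (ns k))
  · intro φ hφ hc
    have e1 : eLpNorm (testPair φ hφ hc).1 (ENNReal.ofReal r) volume
        = eLpNorm φ (ENNReal.ofReal r) volume := eLpNorm_congr_ae (coeFn_testPair_fst hφ hc)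
    have e2 : smoothNorm φ = ENNReal.ofReal (‖(testPair φ hφ hc).1‖ + ‖(testPair φ hφ hc).2‖) := by
      rw [ENNReal.ofReal_add (norm_nonneg _) (norm_nonneg _), ofReal_norm, ofReal_norm,
        Lp.enorm_def, Lp.enorm_def, eLpNorm_congr_ae (coeFn_testPair_fst hφ hc),
        eLpNorm_congr_ae (coeFn_testPair_snd hφ hc), smoothNorm]
      congr 1
      exact eLpNorm_congr_norm_ae (Filter.Eventually.of_forall fun x => (norm_gradient φ x).symm)
    rw [e1, ENNReal.ofReal_mul C.coe_nonneg, ← e2]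
    refine (hC φ hφ hc).trans (le_of_eq ?_)
    simp

/-- The convex function a ↦ a^p lies above its tangent lines, which here is Bernoulli's inequality
applied to b/a. -/
theorem abs_rpow_sub_rpow_le {p : ℝ} (hp : 1 ≤ p) (x y : ℝ) :
    ‖|x| ^ p - |y| ^ p‖ ≤ p * (|x - y| * |x| ^ (p - 1)) + p * (|x - y| * |y| ^ (p - 1)) := by
  have tangent : ∀ a b : ℝ, 0 ≤ b → b ≤ a → a ^ p - b ^ p ≤ p * ((a - b) * a ^ (p - 1)) := by
    intro a b hb hba
    rcases (hb.trans hba).eq_or_lt with h | h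
    · have : b = 0 := by linarith
      subst this; rw [← h]; simp
    have hB := one_add_mul_self_le_rpow_one_add (s := b / a - 1) (p := p)
      (by have : 0 ≤ b / a := by positivity
          linarith) hp
    rw [add_sub_cancel, Real.div_rpow hb h.le, le_div_iff₀ (by positivity)] at hB
    have e : a ^ p = a * a ^ (p - 1) := by
      rw [mul_comm, ← Real.rpow_add_one h.ne']; ring_nf
    rw [e] at hB ⊢
    have : (1 + p * (b / a - 1)) * (a * a ^ (p - 1))
        = a * a ^ (p - 1) - p * ((a - b) * a ^ (p - 1)) := by
      field_simp; ring
    linarith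
  have h0 : ∀ u v : ℝ, 0 ≤ |u - v| * |v| ^ (p - 1) := fun u v => by positivity
  have hp0 : 0 ≤ p := by linarith
  have hx := mul_nonneg hp0 (h0 x y)
  have hy : 0 ≤ p * (|x - y| * |x| ^ (p - 1)) := by positivity
  rw [Real.norm_eq_abs]
  rcases le_total (|y|) (|x|) with h | h
  · have h1 : |y| ^ p ≤ |x| ^ p := Real.rpow_le_rpow (abs_nonneg _) h hp0
    rw [abs_of_nonneg (by linarith)]
    have h2 := tangent _ _ (abs_nonneg y) h
    have h3 : p * ((|x| - |y|) * |x| ^ (p - 1)) ≤ p * (|x - y| * |x| ^ (p - 1)) := by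
      gcongr; exact abs_sub_abs_le_abs_sub x y
    linarith
  · have h1 : |x| ^ p ≤ |y| ^ p := Real.rpow_le_rpow (abs_nonneg _) h hp0
    rw [abs_of_nonpos (by linarith)]
    have h2 := tangent _ _ (abs_nonneg x) h
    have h3 : p * ((|y| - |x|) * |y| ^ (p - 1)) ≤ p * (|x - y| * |y| ^ (p - 1)) := by
      gcongr; rw [abs_sub_comm]; exact abs_sub_abs_le_abs_sub y x
    linarith

/-- Hölder's inequality with 1/2 = 1/(2p) + (p-1)/(2p). Only the L^(2p) norm occurs, which is why
the embedding of H¹ in L^(2p) is the one required. -/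
theorem eLpNorm_mul_rpow_le {p : ℝ} (hp : 1 < p) {f g : E n → ℝ}
    (hf : AEStronglyMeasurable f volume) (hg : AEStronglyMeasurable g volume) :
    eLpNorm (fun x => f x * |g x| ^ (p - 1)) 2 volume ≤
      eLpNorm f (ENNReal.ofReal (2 * p)) volume *
        eLpNorm g (ENNReal.ofReal (2 * p)) volume ^ (p - 1) := by
  have hp1 : 0 < p - 1 := by linarith
  have hp0 : 0 < p := by linarith
  have htr : Real.HolderTriple (2 * p) (2 * p / (p - 1)) 2 :=
    ⟨by field_simp; ring, by positivity, by positivity⟩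
  have htr' := htr.ennrealOfReal
  rw [ENNReal.ofReal_ofNat] at htr'
  have hgm : AEStronglyMeasurable (fun x => |g x| ^ (p - 1)) volume := by
    have := hg.aemeasurable
    exact (this.abs.pow_const (p - 1)).aestronglyMeasurable
  have h1 := eLpNorm_smul_le_mul_eLpNorm (p := ENNReal.ofReal (2 * p))
    (q := ENNReal.ofReal (2 * p / (p - 1))) (r := 2) (μ := volume)
    (φ := f) (f := fun x => |g x| ^ (p - 1)) hgm hf
  refine le_trans h1 (le_of_eq ?_)
  congr 1
  have h2 := eLpNorm_norm_rpow (p := ENNReal.ofReal (2 * p / (p - 1)))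
    (μ := (volume : Measure (E n))) g hp1
  rw [← ENNReal.ofReal_mul (by positivity), div_mul_cancel₀ _ hp1.ne'] at h2
  exact h2

open Classical in
/-- The function `|f| ^ p` as an element of `L²`, when it is square integrable. -/
def powL2 (p : ℝ) (f : L2 n) : L2 n :=
  if h : MemLp (fun x => |f x| ^ p) 2 volume then h.toLp else 0

/-- The exponents for which `H¹` embeds into `L ^ (2 p)`. -/
structure AdmissibleExponent (n : ℕ) (p : ℝ) : Prop where
  one_le_dim : 1 ≤ n
  one_lt : 1 < p
  le_critical : 3 ≤ n → p ≤ (n : ℝ) / ((n : ℝ) - 2)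

theorem AdmissibleExponent.sobolev {p : ℝ} (h : AdmissibleExponent n p) :
    ∃ C : ℝ, 0 ≤ C ∧ ∀ z ∈ weakPairs n,
      eLpNorm z.1 (ENNReal.ofReal (2 * p)) volume ≤ ENNReal.ofReal (C * (‖z.1‖ + ‖z.2‖)) := by
  refine sobolev_weakPairs h.one_le_dim (by linarith [h.one_lt]) fun hn => ?_
  rw [mul_div_assoc]
  linarith [h.le_critical hn]

theorem AdmissibleExponent.memLp_rpow {p : ℝ} (h : AdmissibleExponent n p) {z : L2 n × L2V n}
    (hz : z ∈ weakPairs n) : MemLp (fun x => |z.1 x| ^ p) 2 volume := by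
  obtain ⟨C, -, hC⟩ := h.sobolev
  have hm : AEStronglyMeasurable (fun x => |z.1 x| ^ p) volume :=
    ((Lp.aestronglyMeasurable z.1).aemeasurable.abs.pow_const p).aestronglyMeasurable
  refine ⟨hm, ?_⟩
  have h2 := eLpNorm_norm_rpow (p := 2) (μ := (volume : Measure (E n))) z.1
    (q := p) (by linarith [h.one_lt])
  simp only [Real.norm_eq_abs] at h2
  have e2 : (2 : ℝ≥0∞) * ENNReal.ofReal p = ENNReal.ofReal (2 * p) := by
    rw [ENNReal.ofReal_mul (by norm_num), ENNReal.ofReal_ofNat]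
  rw [h2, e2]
  exact ENNReal.rpow_lt_top_of_nonneg (by linarith [h.one_lt])
    (ne_top_of_le_ne_top ENNReal.ofReal_ne_top (hC z hz))

theorem AdmissibleExponent.coeFn_powL2 {p : ℝ} (h : AdmissibleExponent n p) {z : L2 n × L2V n}
    (hz : z ∈ weakPairs n) : powL2 p z.1 =ᵐ[volume] fun x => |z.1 x| ^ p := by
  rw [powL2, dif_pos (h.memLp_rpow hz)]
  exact MemLp.coeFn_toLp _

/-- The first bound splits k|u|^p = (ku)|u|^(p-1), so that the weight sits on a single factor and
the estimate is linear in weighted quantities. The second makes |u|^p a continuous function on H¹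
with values in L². -/
theorem AdmissibleExponent.exists_pow_bounds {p : ℝ} (h : AdmissibleExponent n p) :
    ∃ S : ℝ, 0 ≤ S ∧
      (∀ z ∈ weakPairs n, ∀ k : Weight n, ‖k.mul ℝ (powL2 p z.1)‖ ≤
        S * (‖k.mul ℝ z.1‖ + ‖k.mul (E n) z.2 + k.grad z.1‖) * (‖z.1‖ + ‖z.2‖) ^ (p - 1)) ∧
      ∀ z ∈ weakPairs n, ∀ w ∈ weakPairs n, ‖powL2 p z.1 - powL2 p w.1‖ ≤
        S * (‖z.1 - w.1‖ + ‖z.2 - w.2‖) *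
          ((‖z.1‖ + ‖z.2‖) ^ (p - 1) + (‖w.1‖ + ‖w.2‖) ^ (p - 1)) := by
  obtain ⟨C, hC0, hC⟩ := h.sobolev
  have hp := h.one_lt
  have hp0 : 0 < p := by linarith
  have hp1 : 0 < p - 1 := by linarith
  have base : ∀ (z w : L2 n × L2V n), z ∈ weakPairs n → w ∈ weakPairs n →
      eLpNorm (fun x => z.1 x * |w.1 x| ^ (p - 1)) 2 volume ≤
        ENNReal.ofReal (C * C ^ (p - 1) * (‖z.1‖ + ‖z.2‖) * (‖w.1‖ + ‖w.2‖) ^ (p - 1)) := by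
    intro z w hz hw
    refine (eLpNorm_mul_rpow_le hp (Lp.aestronglyMeasurable _)
      (Lp.aestronglyMeasurable _)).trans ?_
    refine (mul_le_mul' (hC z hz) (ENNReal.rpow_le_rpow (hC w hw) hp1.le)).trans (le_of_eq ?_)
    rw [ENNReal.ofReal_rpow_of_nonneg (by positivity) hp1.le, ← ENNReal.ofReal_mul (by positivity),
      Real.mul_rpow hC0 (by positivity)]
    congr 1; ring
  refine ⟨p * (C * C ^ (p - 1)), by positivity, fun z hz k => ?_, fun z hz w hw => ?_⟩
  · rw [Lp.norm_def]
    refine ENNReal.toReal_le_of_le_ofReal (by positivity) ?_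
    have e : eLpNorm (k.mul ℝ (powL2 p z.1)) 2 volume
        = eLpNorm (fun x => (k.mul ℝ z.1) x * |z.1 x| ^ (p - 1)) 2 volume := by
      refine eLpNorm_congr_norm_ae ?_
      filter_upwards [k.coeFn_mul (powL2 p z.1), k.coeFn_mul z.1, h.coeFn_powL2 hz]
        with x h1 h2 h3
      rw [h1, h2, h3, smul_eq_mul, smul_eq_mul, norm_mul, norm_mul, norm_mul, mul_assoc]
      congr 1
      rw [Real.norm_eq_abs, Real.norm_eq_abs, Real.norm_eq_abs,
        abs_of_nonneg (show 0 ≤ |z.1 x| ^ p by positivity),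
        abs_of_nonneg (show 0 ≤ |z.1 x| ^ (p - 1) by positivity)]
      rcases (abs_nonneg (z.1 x)).eq_or_lt with h0 | h0
      · rw [← h0, Real.zero_rpow hp0.ne', zero_mul]
      · rw [mul_comm, ← Real.rpow_add_one h0.ne', sub_add_cancel]
    rw [e]
    refine (base (k.mul ℝ z.1, k.mul (E n) z.2 + k.grad z.1) z (k.weakPair_mul hz) hz).trans ?_
    refine ENNReal.ofReal_le_ofReal ?_
    simp only
    have h0 : 0 ≤ C * C ^ (p - 1) * (‖k.mul ℝ z.1‖ + ‖k.mul (E n) z.2 + k.grad z.1‖) *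
      (‖z.1‖ + ‖z.2‖) ^ (p - 1) := by positivity
    nlinarith
  · rw [Lp.norm_def]
    refine ENNReal.toReal_le_of_le_ofReal (by positivity) ?_
    have hzw : z - w ∈ weakPairs n := (weakPairs n).sub_mem hz hw
    have b1 := base (z - w) z hzw hz
    have b2 := base (z - w) w hzw hw
    have hm : ∀ u : L2 n, AEStronglyMeasurable (fun x => (z - w).1 x * |u x| ^ (p - 1)) volume :=
      fun u => (Lp.aestronglyMeasurable _).mul
        ((Lp.aestronglyMeasurable u).aemeasurable.abs.pow_const _).aestronglyMeasurable
    have e : eLpNorm (powL2 p z.1 - powL2 p w.1 : L2 n) 2 volume ≤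
        ENNReal.ofReal p * eLpNorm ((fun x => ‖(z - w).1 x * |z.1 x| ^ (p - 1)‖) +
          fun x => ‖(z - w).1 x * |w.1 x| ^ (p - 1)‖) 2 volume := by
      have hpe : ENNReal.ofReal p = ‖p‖ₑ := (Real.enorm_eq_ofReal hp0.le).symm
      rw [hpe, ← eLpNorm_const_smul]
      refine eLpNorm_mono_ae ?_
      filter_upwards [Lp.coeFn_sub (powL2 p z.1) (powL2 p w.1), h.coeFn_powL2 hz,
        h.coeFn_powL2 hw, Lp.coeFn_sub z.1 w.1] with x h1 h2 h3 h4
      rw [h1, Pi.sub_apply, h2, h3]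
      refine (abs_rpow_sub_rpow_le hp.le _ _).trans (le_trans (le_of_eq ?_) (Real.le_norm_self _))
      simp only [Pi.smul_apply, Pi.add_apply, smul_eq_mul, Prod.fst_sub, norm_mul, Real.norm_eq_abs]
      rw [h4, Pi.sub_apply]
      rw [abs_of_nonneg (show 0 ≤ |z.1 x| ^ (p - 1) by positivity),
        abs_of_nonneg (show 0 ≤ |w.1 x| ^ (p - 1) by positivity)]
      ring
    refine e.trans ?_
    refine (mul_le_mul' le_rfl (eLpNorm_add_le (hm z.1).norm (hm w.1).norm
      (by norm_num))).trans ?_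
    have n1 : ∀ u : L2 n, eLpNorm (fun x => ‖(z - w).1 x * |u x| ^ (p - 1)‖) 2 volume
        = eLpNorm (fun x => (z - w).1 x * |u x| ^ (p - 1)) 2 volume :=
      fun u => eLpNorm_norm fun x => (z - w).1 x * |u x| ^ (p - 1)
    rw [n1, n1]
    refine (mul_le_mul' le_rfl (add_le_add b1 b2)).trans (le_of_eq ?_)
    rw [← ENNReal.ofReal_add (by positivity) (by positivity), ← ENNReal.ofReal_mul hp0.le]
    congr 1
    simp only [Prod.fst_sub, Prod.snd_sub]
    ring

theorem AdmissibleExponent.continuousOn_powL2 {p : ℝ} (h : AdmissibleExponent n p) :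
    ContinuousOn (fun z : L2 n × L2V n => powL2 p z.1) (weakPairs n) := by
  obtain ⟨S, hS0, -, hS⟩ := h.exists_pow_bounds
  have hp1 : 0 < p - 1 := by linarith [h.one_lt]
  intro z hz
  rw [ContinuousWithinAt, tendsto_iff_norm_sub_tendsto_zero]
  have hc : Continuous fun w : L2 n × L2V n => S * (‖w.1 - z.1‖ + ‖w.2 - z.2‖) *
      ((‖w.1‖ + ‖w.2‖) ^ (p - 1) + (‖z.1‖ + ‖z.2‖) ^ (p - 1)) := by
    have : Continuous fun w : L2 n × L2V n => (‖w.1‖ + ‖w.2‖) ^ (p - 1) :=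
      Continuous.rpow_const (by fun_prop) fun _ => Or.inr hp1.le
    fun_prop
  have h0 := (hc.tendsto z).mono_left (nhdsWithin_le_nhds (s := (weakPairs n : Set _)))
  simp only [sub_self, norm_zero, add_zero, mul_zero, zero_mul] at h0
  refine squeeze_zero' (Filter.Eventually.of_forall fun w => norm_nonneg _) ?_ h0
  filter_upwards [self_mem_nhdsWithin] with w hw
  exact hS w hw z hz

end Power

/-! ### Steklov averages -/

section Steklov

variable {H : Type*} [NormedAddCommGroup H] [NormedSpace ℝ H]

/-- The average of `X` over the interval from `t` to `t + h`. -/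
def steklov (X : ℝ → H) (h t : ℝ) : H := ∫ σ in (0 : ℝ)..1, X (t + h * σ)

/-- Rescaling the average to σ in [0,1] makes it jointly continuous up to h = 0, where the passage
to the limit takes place. -/
theorem continuous_steklov {X : ℝ → H} (hX : Continuous X) :
    Continuous fun z : ℝ × ℝ => steklov X z.1 z.2 :=
  intervalIntegral.continuous_parametric_intervalIntegral_of_continuous'
    (f := fun (z : ℝ × ℝ) σ => X (z.2 + z.1 * σ)) (by fun_prop) 0 1

theorem steklov_zero [CompleteSpace H] (X : ℝ → H) (t : ℝ) : steklov X 0 t = X t := by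
  simp [steklov]

theorem steklov_eq (X : ℝ → H) {h : ℝ} (hh : h ≠ 0) (t : ℝ) :
    steklov X h t = h⁻¹ • ∫ s in t..t + h, X s := by
  rw [steklov, intervalIntegral.integral_comp_add_mul X hh t]
  simp

theorem hasDerivAt_steklov [CompleteSpace H] {X : ℝ → H} (hX : Continuous X) {h : ℝ} (hh : h ≠ 0)
    (t : ℝ) : HasDerivAt (steklov X h) (h⁻¹ • (X (t + h) - X t)) t := by
  have hprim : ∀ s, HasDerivAt (fun s => ∫ r in (0 : ℝ)..s, X r) (X s) s := fun s =>
    intervalIntegral.integral_hasDerivAt_right (hX.intervalIntegrable _ _)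
      hX.stronglyMeasurable.stronglyMeasurableAtFilter hX.continuousAt
  have h1 := (((hprim (t + h)).comp_add_const t h).sub (hprim t)).const_smul h⁻¹
  refine h1.congr_of_eventuallyEq (Filter.Eventually.of_forall fun s => ?_)
  simp only [Pi.smul_apply, Pi.sub_apply]
  rw [steklov_eq X hh, intervalIntegral.integral_interval_sub_left] <;>
    exact hX.intervalIntegrable _ _

theorem steklov_deriv [CompleteSpace H] {X X' : ℝ → H} (hX : ∀ t, HasDerivAt X (X' t) t)
    (hX' : Continuous X') {h : ℝ} (hh : h ≠ 0) (t : ℝ) :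
    steklov X' h t = h⁻¹ • (X (t + h) - X t) := by
  rw [steklov_eq X' hh, intervalIntegral.integral_eq_sub_of_hasDerivAt (fun s _ => hX s)
    (hX'.intervalIntegrable _ _)]

end Steklov

/-! ### The energy identity -/

/-- Curves solving the linear wave equation `u_tt - Δu = G` on `[0, S]` in the energy space,
extended continuously to all times. -/
structure LinearSolution (n : ℕ) (S : ℝ) where
  /-- The solution. -/
  U : ℝ → L2 n
  /-- Its time derivative. -/
  V : ℝ → L2 n
  /-- Its gradient. -/
  W : ℝ → L2V n
  /-- The source. -/
  G : ℝ → L2 n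
  continuous_V : Continuous V
  continuous_W : Continuous W
  continuous_G : Continuous G
  hasDerivAt : ∀ t, HasDerivAt U (V t) t
  weakPair : ∀ t ∈ Icc 0 S, (U t, W t) ∈ weakPairs n
  weak : ∀ s ∈ Icc 0 S, ∀ t ∈ Icc 0 S, ∀ z ∈ weakPairs n,
    inner ℝ (V t - V s) z.1 = -inner ℝ (∫ r in s..t, W r) z.2 + inner ℝ (∫ r in s..t, G r) z.1

namespace LinearSolution

variable {n : ℕ} {S : ℝ} (A : LinearSolution n S) (k : Weight n)

theorem continuous_U : Continuous A.U :=
  continuous_iff_continuousAt.2 fun t => (A.hasDerivAt t).continuousAt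

/-- The weighted energy of a state. -/
def energyForm (u v : L2 n) (w : L2V n) : ℝ :=
  ‖k.mul ℝ u‖ ^ 2 + ‖k.mul ℝ v‖ ^ 2 + ‖k.mul (E n) w‖ ^ 2

/-- The rate of change of the weighted energy. -/
def energyRate (u v : L2 n) (w : L2V n) (g : L2 n) : ℝ :=
  2 * inner ℝ (k.mul ℝ u) (k.mul ℝ v) - 4 * inner ℝ (k.mul (E n) w) (k.grad v) +
    2 * inner ℝ (k.mul ℝ g) (k.mul ℝ v)

theorem continuous_energyForm {X : Type*} [TopologicalSpace X] {u v : X → L2 n} {w : X → L2V n}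
    (hu : Continuous u) (hv : Continuous v) (hw : Continuous w) :
    Continuous fun x => energyForm k (u x) (v x) (w x) :=
  ((((k.mul ℝ).continuous.comp hu).norm.pow 2).add
    (((k.mul ℝ).continuous.comp hv).norm.pow 2)).add
    (((k.mul (E n)).continuous.comp hw).norm.pow 2)

theorem continuous_energyRate {X : Type*} [TopologicalSpace X] {u v g : X → L2 n} {w : X → L2V n}
    (hu : Continuous u) (hv : Continuous v) (hw : Continuous w) (hg : Continuous g) :
    Continuous fun x => energyRate k (u x) (v x) (w x) (g x) :=
  ((continuous_const.mul
    (((k.mul ℝ).continuous.comp hu).inner ((k.mul ℝ).continuous.comp hv))).sub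
    (continuous_const.mul
      (((k.mul (E n)).continuous.comp hw).inner (k.grad.continuous.comp hv)))).add
    (continuous_const.mul
      (((k.mul ℝ).continuous.comp hg).inner ((k.mul ℝ).continuous.comp hv)))

/-- Here z plays the role of u_tt and w' that of ∇v. Testing the equation with k²v produces the
gradient k²w' + 2k v∇k; its first term cancels against the derivative of ‖kw‖², and the second gives
the term with coefficient 4. -/
theorem energyRate_eq {u v z g : L2 n} {w w' : L2V n} (hv : (v, w') ∈ weakPairs n)
    (hz : ∀ y ∈ weakPairs n, inner ℝ z y.1 = -inner ℝ w y.2 + inner ℝ g y.1) :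
    energyRate k u v w g = 2 * inner ℝ (k.mul ℝ u) (k.mul ℝ v) +
      2 * inner ℝ (k.mul ℝ v) (k.mul ℝ z) + 2 * inner ℝ (k.mul (E n) w) (k.mul (E n) w') := by
  have h1 := hz _ (k.weakPair_mul (k.weakPair_mul hv))
  simp only at h1
  rw [← k.mul_grad v, ← map_add, ← k.inner_mul_left z, ← k.inner_mul_left w,
    ← k.inner_mul_left g] at h1
  rw [energyRate, real_inner_comm (k.mul ℝ z), h1, inner_add_right, inner_add_right]
  ring

/-- The velocity V need not lie in H¹ and cannot be used as a test function. Its Steklov average is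
a difference quotient of U, which has a weak gradient, and the averaged curves satisfy the averaged
equation, so the energy may be differentiated. -/
theorem energy_steklov {h t : ℝ} (hh : 0 < h) (ht : 0 ≤ t) (hth : t + h ≤ S) :
    energyForm k (steklov A.U h t) (steklov A.V h t) (steklov A.W h t)
      - energyForm k (steklov A.U h 0) (steklov A.V h 0) (steklov A.W h 0) =
    ∫ s in (0 : ℝ)..t, energyRate k (steklov A.U h s) (steklov A.V h s) (steklov A.W h s)
      (steklov A.G h s) := by
  have hh' : h ≠ 0 := hh.ne'
  have cont : ∀ {H : Type} [NormedAddCommGroup H] [NormedSpace ℝ H] {X : ℝ → H},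
      Continuous X → Continuous (steklov X h) := fun hX =>
    (continuous_steklov hX).comp (by fun_prop : Continuous fun t : ℝ => (h, t))
  have cU := cont A.continuous_U
  have cV := cont A.continuous_V
  have cW := cont A.continuous_W
  have cG := cont A.continuous_G
  symm
  refine intervalIntegral.integral_eq_sub_of_hasDerivAt
    (f := fun t => energyForm k (steklov A.U h t) (steklov A.V h t) (steklov A.W h t)) ?_ ?_
  · intro s hs
    rw [uIcc_of_le ht] at hs
    have hs1 : s ∈ Icc 0 S := ⟨hs.1, by linarith [hs.2]⟩
    have hs2 : s + h ∈ Icc 0 S := ⟨by linarith [hs.1], by linarith [hs.2]⟩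
    have dU := hasDerivAt_steklov A.continuous_U hh' s
    rw [← steklov_deriv A.hasDerivAt A.continuous_V hh'] at dU
    have dV := hasDerivAt_steklov A.continuous_V hh' s
    have dW := hasDerivAt_steklov A.continuous_W hh' s
    have hpair : (steklov A.V h s, h⁻¹ • (A.W (s + h) - A.W s)) ∈ weakPairs n := by
      rw [steklov_deriv A.hasDerivAt A.continuous_V hh']
      exact (weakPairs n).smul_mem h⁻¹
        ((weakPairs n).sub_mem (A.weakPair _ hs2) (A.weakPair _ hs1))
    have hweak : ∀ y ∈ weakPairs n, inner ℝ (h⁻¹ • (A.V (s + h) - A.V s)) y.1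
        = -inner ℝ (steklov A.W h s) y.2 + inner ℝ (steklov A.G h s) y.1 := by
      intro y hy
      rw [steklov_eq _ hh', steklov_eq _ hh', real_inner_smul_left, real_inner_smul_left,
        real_inner_smul_left, A.weak s hs1 (s + h) hs2 y hy]
      ring
    rw [energyRate_eq k hpair hweak]
    have e1 := ((k.mul ℝ).hasFDerivAt.comp_hasDerivAt s dU).norm_sq
    have e2 := ((k.mul ℝ).hasFDerivAt.comp_hasDerivAt s dV).norm_sq
    have e3 := ((k.mul (E n)).hasFDerivAt.comp_hasDerivAt s dW).norm_sq
    exact (e1.add e2).add e3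
  · apply Continuous.intervalIntegrable
    exact continuous_energyRate k cU cV cW cG

/-- Let h decrease to 0 in the averaged identity. Strictness of t < S leaves room for the averaging
interval [t, t + h]. -/
theorem energy_identity {t : ℝ} (ht : 0 ≤ t) (htS : t < S) :
    energyForm k (A.U t) (A.V t) (A.W t) - energyForm k (A.U 0) (A.V 0) (A.W 0) =
      ∫ s in (0 : ℝ)..t, energyRate k (A.U s) (A.V s) (A.W s) (A.G s) := by
  have cU := continuous_steklov A.continuous_U
  have cV := continuous_steklov A.continuous_V
  have cW := continuous_steklov A.continuous_W
  have cG := continuous_steklov A.continuous_G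
  have at_time : ∀ (r : ℝ) {H : Type} [NormedAddCommGroup H] [NormedSpace ℝ H] {X : ℝ → H},
      (Continuous fun z : ℝ × ℝ => steklov X z.1 z.2) → Continuous fun h => steklov X h r :=
    fun r _ _ _ _ hX => hX.comp (by fun_prop : Continuous fun h : ℝ => (h, r))
  have cR : Continuous fun z : ℝ × ℝ => energyRate k (steklov A.U z.1 z.2) (steklov A.V z.1 z.2)
      (steklov A.W z.1 z.2) (steklov A.G z.1 z.2) :=
    continuous_energyRate k cU cV cW cG
  have cL : Continuous fun h : ℝ =>
      energyForm k (steklov A.U h t) (steklov A.V h t) (steklov A.W h t)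
      - energyForm k (steklov A.U h 0) (steklov A.V h 0) (steklov A.W h 0) :=
    (continuous_energyForm k (at_time t cU) (at_time t cV) (at_time t cW)).sub
      (continuous_energyForm k (at_time 0 cU) (at_time 0 cV) (at_time 0 cW))
  have cI : Continuous fun h : ℝ => ∫ s in (0 : ℝ)..t, energyRate k (steklov A.U h s)
      (steklov A.V h s) (steklov A.W h s) (steklov A.G h s) :=
    intervalIntegral.continuous_parametric_intervalIntegral_of_continuous'
      (f := fun (h s : ℝ) => energyRate k (steklov A.U h s) (steklov A.V h s) (steklov A.W h s)
        (steklov A.G h s)) cR 0 t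
  have l1 := (cL.tendsto 0).mono_left (nhdsWithin_le_nhds (s := Ioi (0 : ℝ)))
  have l2 := (cI.tendsto 0).mono_left (nhdsWithin_le_nhds (s := Ioi (0 : ℝ)))
  have heq : (fun h : ℝ => energyForm k (steklov A.U h t) (steklov A.V h t) (steklov A.W h t)
      - energyForm k (steklov A.U h 0) (steklov A.V h 0) (steklov A.W h 0)) =ᶠ[nhdsWithin 0 (Ioi 0)]
      fun h : ℝ => ∫ s in (0 : ℝ)..t, energyRate k (steklov A.U h s)
      (steklov A.V h s) (steklov A.W h s) (steklov A.G h s) := by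
    filter_upwards [Ioo_mem_nhdsGT (show (0 : ℝ) < S - t by linarith)] with h hh
    exact A.energy_steklov k hh.1 ht (by linarith [hh.2])
  have := tendsto_nhds_unique (l1.congr' heq) l2
  simpa only [steklov_zero] using this

end LinearSolution

/-! ### Exponential weights -/

section ExpWeight

variable {n : ℕ}

theorem hasGradientAt_smoothDist (δ : ℝ) (hδ : 0 < δ) (x₀ x : E n) :
    HasGradientAt (fun y => Real.sqrt (δ ^ 2 + ‖y - x₀‖ ^ 2))
      ((Real.sqrt (δ ^ 2 + ‖x - x₀‖ ^ 2))⁻¹ • (x - x₀)) x := by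
  rw [hasGradientAt_iff_hasFDerivAt]
  have h1 : HasFDerivAt (fun y : E n => y - x₀) (ContinuousLinearMap.id ℝ (E n)) x :=
    (hasFDerivAt_id x).sub_const x₀
  have h2 := (h1.norm_sq.const_add (δ ^ 2)).sqrt (by positivity)
  convert! h2 using 1
  ext v
  simp only [InnerProductSpace.toDual_apply_apply, real_inner_smul_left, one_div, smul_apply,
    ContinuousLinearMap.comp_apply, innerSL_apply_apply, smul_eq_mul]
  simp
  ring

theorem contDiff_smoothDist (δ : ℝ) (hδ : 0 < δ) (x₀ : E n) :
    ContDiff ℝ ∞ fun y => Real.sqrt (δ ^ 2 + ‖y - x₀‖ ^ 2) := by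
  refine ContDiff.sqrt ?_ fun y => by positivity
  exact contDiff_const.add ((contDiff_id.sub contDiff_const).norm_sq ℝ)

theorem contDiff_expFun (l δ : ℝ) (hδ : 0 < δ) (x₀ : E n) :
    ContDiff ℝ ∞ fun y => Real.exp (-l * Real.sqrt (δ ^ 2 + ‖y - x₀‖ ^ 2)) :=
  (contDiff_const.mul (contDiff_smoothDist δ hδ x₀)).exp

theorem norm_gradient_expFun_le {l δ : ℝ} (hl : 0 ≤ l) (hδ : 0 < δ) (x₀ x : E n) :
    ‖∇ (fun y => Real.exp (-l * Real.sqrt (δ ^ 2 + ‖y - x₀‖ ^ 2))) x‖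
      ≤ l * Real.exp (-l * Real.sqrt (δ ^ 2 + ‖x - x₀‖ ^ 2)) := by
  rw [norm_gradient]
  have h1 := ((hasGradientAt_iff_hasFDerivAt.1 (hasGradientAt_smoothDist δ hδ x₀ x)).const_mul
    (-l)).exp
  rw [h1.fderiv, norm_smul, norm_smul, LinearIsometryEquiv.norm_map, norm_smul, Real.norm_eq_abs,
    Real.abs_exp, norm_neg, Real.norm_of_nonneg hl, norm_inv, Real.norm_eq_abs,
    abs_of_nonneg (Real.sqrt_nonneg _)]
  have h2 : ‖x - x₀‖ ≤ Real.sqrt (δ ^ 2 + ‖x - x₀‖ ^ 2) :=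
    Real.le_sqrt_of_sq_le (by nlinarith)
  have h3 : (Real.sqrt (δ ^ 2 + ‖x - x₀‖ ^ 2))⁻¹ * ‖x - x₀‖ ≤ 1 := by
    rw [inv_mul_le_iff₀ (Real.sqrt_pos.2 (by positivity)), mul_one]
    exact h2
  calc _ ≤ Real.exp (-l * Real.sqrt (δ ^ 2 + ‖x - x₀‖ ^ 2)) * (l * 1) := by gcongr
    _ = _ := by ring

/-- The weight `exp (-l √(δ² + |x - x₀|²))`. -/
def expWeight (l δ : ℝ) (hl : 0 ≤ l) (hδ : 0 < δ) (x₀ : E n) : Weight n where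
  toFun y := Real.exp (-l * Real.sqrt (δ ^ 2 + ‖y - x₀‖ ^ 2))
  contDiff := contDiff_expFun l δ hδ x₀
  bounded := ⟨1, fun x => by
    rw [Real.abs_exp, Real.exp_le_one_iff]
    nlinarith [Real.sqrt_nonneg (δ ^ 2 + ‖x - x₀‖ ^ 2)]⟩
  gradient_bounded := ⟨l, fun x => by
    refine (norm_gradient_expFun_le hl hδ x₀ x).trans (mul_le_of_le_one_right hl ?_)
    rw [Real.exp_le_one_iff]
    nlinarith [Real.sqrt_nonneg (δ ^ 2 + ‖x - x₀‖ ^ 2)]⟩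

theorem Weight.norm_mul_le_of_supp {G : Type*} [NormedAddCommGroup G] [NormedSpace ℝ G]
    (k : Weight n) {s : Set (E n)} {c : ℝ} (hc : ∀ x ∈ s, |k.toFun x| ≤ c)
    {f : Lp G 2 (volume : Measure (E n))} (hf : ∀ᵐ x, x ∉ s → f x = 0) :
    ‖k.mul G f‖ ≤ c * ‖f‖ := by
  refine Lp.norm_le_mul_norm_of_ae_le_mul ?_
  filter_upwards [k.coeFn_mul f, hf] with x hx h0
  by_cases hs : x ∈ s
  · rw [hx, norm_smul]
    exact mul_le_mul_of_nonneg_right (hc x hs) (norm_nonneg _)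
  · rw [hx, h0 hs]; simp

end ExpWeight

/-! ### Growth of the weighted energy. -/

namespace LinearSolution

variable {n : ℕ} {S : ℝ} (A : LinearSolution n S) (k : Weight n)

theorem energyForm_nonneg (u v : L2 n) (w : L2V n) : 0 ≤ energyForm k u v w := by
  unfold energyForm; positivity

theorem energyRate_le {l : ℝ} (hl : 0 ≤ l) (hk : ∀ x, ‖∇ k.toFun x‖ ≤ l * |k.toFun x|)
    (u v g : L2 n) (w : L2V n) : energyRate k u v w g ≤
      (2 * l + 1) * energyForm k u v w + 2 * ‖k.mul ℝ g‖ * Real.sqrt (energyForm k u v w) := by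
  have h1 := real_inner_le_norm (k.mul ℝ u) (k.mul ℝ v)
  have h2 := (abs_le.1 (abs_real_inner_le_norm (k.mul (E n) w) (k.grad v))).1
  have h3 := real_inner_le_norm (k.mul ℝ g) (k.mul ℝ v)
  have h4 := k.norm_grad_le_mul hk v
  have h5 : ‖k.mul ℝ v‖ ≤ Real.sqrt (energyForm k u v w) := by
    refine Real.le_sqrt_of_sq_le ?_
    unfold energyForm
    nlinarith [sq_nonneg ‖k.mul ℝ u‖, sq_nonneg ‖k.mul (E n) w‖]
  have h6 : ‖k.mul (E n) w‖ * ‖k.grad v‖ ≤ ‖k.mul (E n) w‖ * (l * ‖k.mul ℝ v‖) := by gcongr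
  have h7 : ‖k.mul ℝ g‖ * ‖k.mul ℝ v‖ ≤ ‖k.mul ℝ g‖ * Real.sqrt (energyForm k u v w) := by gcongr
  have h8 : 2 * (‖k.mul ℝ u‖ * ‖k.mul ℝ v‖) ≤ energyForm k u v w := by
    unfold energyForm
    nlinarith [sq_nonneg (‖k.mul ℝ u‖ - ‖k.mul ℝ v‖), sq_nonneg ‖k.mul (E n) w‖]
  have h9 : 2 * (‖k.mul (E n) w‖ * ‖k.mul ℝ v‖) ≤ energyForm k u v w := by
    unfold energyForm
    nlinarith [sq_nonneg (‖k.mul (E n) w‖ - ‖k.mul ℝ v‖), sq_nonneg ‖k.mul ℝ u‖]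
  have h10 : l * (2 * (‖k.mul (E n) w‖ * ‖k.mul ℝ v‖)) ≤ l * energyForm k u v w := by gcongr
  unfold energyRate
  nlinarith

/-- Exponential growth of the weighted energy when the source is controlled by its history. -/
theorem energy_growth {l : ℝ} (hl : 0 ≤ l) (hk : ∀ x, ‖∇ k.toFun x‖ ≤ l * |k.toFun x|)
    {g : ℝ → ℝ} (hg0 : ∀ t ∈ Ioc 0 S, 0 ≤ g t) (hgi : IntegrableOn g (Ioc 0 S)) {D : ℝ}
    (hD : 0 ≤ D)
    (hG : ∀ s ∈ Ico 0 S, ‖k.mul ℝ (A.G s)‖ ≤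
      ∫ r in (0 : ℝ)..s, g r * (D * Real.sqrt (energyForm k (A.U (s - r)) (A.V (s - r)) (A.W (s - r)))))
    {t : ℝ} (ht : 0 ≤ t) (htS : t < S) :
    energyForm k (A.U t) (A.V t) (A.W t) ≤ (2 * l + 2) * energyForm k (A.U 0) (A.V 0) (A.W 0) *
      Real.exp (2 * (l + 1 + 2 * (D * ∫ r in (0 : ℝ)..S, g r * Real.exp (-l * r))) * t) := by
  have hS : 0 < S := ht.trans_lt htS
  have hgS : IntervalIntegrable (fun r => g r * Real.exp (-l * r)) volume 0 S :=
    ((intervalIntegrable_iff_integrableOn_Ioc_of_le hS.le).2 hgi).mul_continuousOn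
      (by fun_prop)
  set κ := D * ∫ r in (0 : ℝ)..S, g r * Real.exp (-l * r) with hκ
  have hκ0 : 0 ≤ κ := by
    refine mul_nonneg hD (intervalIntegral.integral_nonneg_of_ae_restrict hS.le ?_)
    rw [Filter.EventuallyLE, ae_restrict_iff' measurableSet_Icc]
    filter_upwards [compl_mem_ae_iff.2 (measure_singleton (0 : ℝ))] with r hr hr'
    have : 0 < r := lt_of_le_of_ne hr'.1 (Ne.symm hr)
    exact mul_nonneg (hg0 r ⟨this, hr'.2⟩) (Real.exp_pos _).le
  -- This rate exceeds half of 2l + 1 + 2κ, the growth constant of the energy rate, by 1/2 + κ; the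
  -- surplus absorbs the integral at the maximum point below.
  set b := l + 1 + 2 * κ with hb
  have hb0 : 0 < b := by positivity
  set Y : ℝ → ℝ := fun s => energyForm k (A.U s) (A.V s) (A.W s) with hY
  have hYc : Continuous Y :=
    continuous_energyForm k A.continuous_U A.continuous_V A.continuous_W
  have hY0 : ∀ s, 0 ≤ Y s := fun s => energyForm_nonneg k _ _ _
  -- The estimate is closed at a maximum point of e^(-bs) √Y. Past values of Y are then bounded by a
  -- pure exponential, and since b ≥ l the memory integral picks up the factor e^(-lr).
  obtain ⟨t₁, ht₁, hmax⟩ := isCompact_Icc.exists_isMaxOn (nonempty_Icc.2 ht)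
    (f := fun s => Real.exp (-b * s) * Real.sqrt (Y s)) (by fun_prop)
  set Q := Real.exp (-b * t₁) * Real.sqrt (Y t₁) with hQ
  have hQ0 : 0 ≤ Q := by positivity
  have hle : ∀ s ∈ Icc 0 t, Real.sqrt (Y s) ≤ Q * Real.exp (b * s) := by
    intro s hs
    have h := hmax hs
    simp only [mem_ofPred_eq] at h
    calc Real.sqrt (Y s) = Real.exp (-b * s) * Real.sqrt (Y s) * Real.exp (b * s) := by
          rw [mul_right_comm, ← Real.exp_add]; simp
      _ ≤ _ := by gcongr
  have hle2 : ∀ s ∈ Icc 0 t, Y s ≤ Q ^ 2 * Real.exp (2 * b * s) := by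
    intro s hs
    calc Y s = Real.sqrt (Y s) ^ 2 := (Real.sq_sqrt (hY0 s)).symm
      _ ≤ (Q * Real.exp (b * s)) ^ 2 := by gcongr; exact hle s hs
      _ = _ := by rw [mul_pow, ← Real.exp_nat_mul]; push_cast; ring_nf
  have hsrc : ∀ s ∈ Icc 0 t, ‖k.mul ℝ (A.G s)‖ ≤ κ * (Q * Real.exp (b * s)) := by
    intro s hs
    have hsS : s < S := hs.2.trans_lt htS
    refine (hG s ⟨hs.1, hsS⟩).trans ?_
    have hi1 : IntervalIntegrable (fun r => g r) volume 0 s :=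
      (intervalIntegrable_iff_integrableOn_Ioc_of_le hs.1).2
        (hgi.mono_set (Ioc_subset_Ioc_right hsS.le))
    calc ∫ r in (0 : ℝ)..s, g r * (D * Real.sqrt (Y (s - r)))
        ≤ ∫ r in (0 : ℝ)..s, (D * (Q * Real.exp (b * s))) * (g r * Real.exp (-l * r)) := by
          refine intervalIntegral.integral_mono_on_of_le_Ioo hs.1
            (hi1.mul_continuousOn (by fun_prop))
            ((hi1.mul_continuousOn (by fun_prop)).const_mul _) fun r hr => ?_
          have hgr := hg0 r ⟨hr.1, hr.2.le.trans hsS.le⟩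
          have h1 := hle (s - r) ⟨by linarith [hr.2], by linarith [hr.1, hs.2]⟩
          have h2 : Real.exp (b * (s - r)) ≤ Real.exp (b * s) * Real.exp (-l * r) := by
            rw [← Real.exp_add]
            refine Real.exp_le_exp.2 ?_
            have : l * r ≤ b * r := by
              refine mul_le_mul_of_nonneg_right ?_ hr.1.le
              rw [hb]; linarith
            linarith
          calc g r * (D * Real.sqrt (Y (s - r)))
              ≤ g r * (D * (Q * (Real.exp (b * s) * Real.exp (-l * r)))) := by
                refine mul_le_mul_of_nonneg_left (mul_le_mul_of_nonneg_left (h1.trans ?_) hD) hgr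
                exact mul_le_mul_of_nonneg_left h2 hQ0
            _ = _ := by ring
      _ = (D * (Q * Real.exp (b * s))) * ∫ r in (0 : ℝ)..s, g r * Real.exp (-l * r) := by
          rw [intervalIntegral.integral_const_mul]
      _ ≤ (D * (Q * Real.exp (b * s))) * ∫ r in (0 : ℝ)..S, g r * Real.exp (-l * r) := by
          refine mul_le_mul_of_nonneg_left ?_ (by positivity)
          refine intervalIntegral.integral_mono_interval le_rfl hs.1 hsS.le ?_ hgS
          rw [Filter.EventuallyLE, ae_restrict_iff' measurableSet_Ioc]
          exact Filter.Eventually.of_forall fun r hr => mul_nonneg (hg0 r hr) (Real.exp_pos _).le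
      _ = _ := by rw [hκ]; ring
  have hid := A.energy_identity k ht₁.1 (ht₁.2.trans_lt htS)
  have hint : ∫ s in (0 : ℝ)..t₁, energyRate k (A.U s) (A.V s) (A.W s) (A.G s) ≤
      (2 * l + 1 + 2 * κ) * Q ^ 2 * ((Real.exp (2 * b * t₁)) / (2 * b)) := by
    calc ∫ s in (0 : ℝ)..t₁, energyRate k (A.U s) (A.V s) (A.W s) (A.G s)
        ≤ ∫ s in (0 : ℝ)..t₁, (2 * l + 1 + 2 * κ) * Q ^ 2 * Real.exp (2 * b * s) := by
          refine intervalIntegral.integral_mono_on ht₁.1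
            ((continuous_energyRate k A.continuous_U A.continuous_V A.continuous_W
              A.continuous_G).intervalIntegrable _ _)
            ((by fun_prop : Continuous fun s : ℝ =>
              (2 * l + 1 + 2 * κ) * Q ^ 2 * Real.exp (2 * b * s)).intervalIntegrable _ _)
            fun s hs => ?_
          have hst : s ∈ Icc 0 t := ⟨hs.1, hs.2.trans ht₁.2⟩
          refine (energyRate_le k hl hk _ _ _ _).trans ?_
          have h1 := hle2 s hst
          have h2 : ‖k.mul ℝ (A.G s)‖ * Real.sqrt (Y s) ≤
              κ * (Q * Real.exp (b * s)) * (Q * Real.exp (b * s)) :=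
            mul_le_mul (hsrc s hst) (hle s hst) (Real.sqrt_nonneg _) (by positivity)
          have h3 : Real.exp (b * s) * Real.exp (b * s) = Real.exp (2 * b * s) := by
            rw [← Real.exp_add]; ring_nf
          have h4 : κ * (Q * Real.exp (b * s)) * (Q * Real.exp (b * s))
              = κ * Q ^ 2 * Real.exp (2 * b * s) := by rw [← h3]; ring
          have h5 : (2 * l + 1) * Y s ≤ (2 * l + 1) * (Q ^ 2 * Real.exp (2 * b * s)) := by gcongr
          change (2 * l + 1) * Y s + 2 * ‖k.mul ℝ (A.G s)‖ * Real.sqrt (Y s) ≤ _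
          linarith
      _ = (2 * l + 1 + 2 * κ) * Q ^ 2 * ((Real.exp (2 * b * t₁) - 1) / (2 * b)) := by
          rw [intervalIntegral.integral_const_mul, intervalIntegral.integral_comp_mul_left
            (fun x => Real.exp x) (by positivity), integral_exp]
          simp
          left
          field_simp
      _ ≤ _ := by gcongr; linarith
  have hYt₁ : Y t₁ = Q ^ 2 * Real.exp (2 * b * t₁) := by
    rw [hQ, mul_pow, Real.sq_sqrt (hY0 _), ← Real.exp_nat_mul, mul_right_comm, ← Real.exp_add]
    push_cast
    ring_nf
    simp
  set Z := Q ^ 2 * Real.exp (2 * b * t₁) with hZ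
  have hZb : Z - Y 0 ≤ (2 * l + 1 + 2 * κ) * Z / (2 * b) := by
    rw [← hYt₁]
    refine (le_of_eq hid).trans (hint.trans (le_of_eq ?_))
    rw [hYt₁, hZ]; ring
  -- The energy identity at the maximum point gives Z(1 + 2κ) ≤ 2b Y(0), and 2b ≤ (2l + 2)(1 + 2κ).
  have hZ2 : Z ≤ (2 * l + 2) * Y 0 := by
    rw [le_div_iff₀ (by positivity)] at hZb
    have h1 : Z * (1 + 2 * κ) ≤ 2 * b * Y 0 := by rw [hb] at hZb ⊢; nlinarith
    have h2 : 2 * b * Y 0 ≤ (2 * l + 2) * Y 0 * (1 + 2 * κ) := by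
      rw [hb]
      nlinarith [mul_nonneg (mul_nonneg hl hκ0) (hY0 0)]
    exact le_of_mul_le_mul_right (h1.trans h2) (by positivity)
  have hQZ : Q ^ 2 ≤ Z := by
    rw [hZ]
    exact le_mul_of_one_le_right (by positivity) (Real.one_le_exp (by have := ht₁.1; positivity))
  calc Y t ≤ Q ^ 2 * Real.exp (2 * b * t) := hle2 t ⟨ht, le_rfl⟩
    _ ≤ _ := by gcongr; exact hQZ.trans hZ2

end LinearSolution

/-! ### Finite speed of propagation -/

/-- Although the source costs a factor 2 + l, this decay makes the contribution of the memory to the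
growth rate of size o(l), so the propagation speed stays equal to 1. -/
theorem tendsto_integral_mul_exp_neg {g : ℝ → ℝ} {S : ℝ} (hS : 0 ≤ S)
    (hgi : IntegrableOn g (Ioc 0 S)) :
    Filter.Tendsto (fun l : ℝ => ∫ r in (0 : ℝ)..S, g r * Real.exp (-l * r)) Filter.atTop
      (nhds 0) := by
  have hgi' : IntervalIntegrable g volume 0 S :=
    (intervalIntegrable_iff_integrableOn_Ioc_of_le hS).2 hgi
  have h := intervalIntegral.tendsto_integral_filter_of_dominated_convergence
    (μ := volume) (a := 0) (b := S) (l := Filter.atTop)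
    (F := fun (l : ℝ) r => g r * Real.exp (-l * r)) (f := fun _ => (0 : ℝ))
    (fun r => ‖g r‖) ?_ ?_ hgi'.norm ?_
  · simpa using h
  · refine Filter.Eventually.of_forall fun l => ?_
    rw [uIoc_of_le hS]
    exact hgi.aestronglyMeasurable.mul (by fun_prop)
  · filter_upwards [Filter.eventually_ge_atTop (0 : ℝ)] with l hl
    refine Filter.Eventually.of_forall fun r hr => ?_
    rw [uIoc_of_le hS] at hr
    rw [norm_mul, Real.norm_eq_abs (Real.exp _), Real.abs_exp]
    refine mul_le_of_le_one_right (norm_nonneg _) (Real.exp_le_one_iff.2 ?_)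
    nlinarith [hr.1]
  · refine Filter.Eventually.of_forall fun r hr => ?_
    rw [uIoc_of_le hS] at hr
    have h1 : Filter.Tendsto (fun l : ℝ => Real.exp (-(l * r))) Filter.atTop (nhds 0) :=
      Real.tendsto_exp_neg_atTop_nhds_zero.comp
        (Filter.tendsto_id.atTop_mul_const hr.1)
    simpa using h1.const_mul (g r)

theorem memLp_indicator {n : ℕ} {s : Set (E n)} (hs : MeasurableSet s) (u : L2 n) :
    MemLp (s.indicator fun x => u x) 2 volume := (Lp.memLp u).indicator hs

/-- Restriction of an `L²` function to a set. -/
def restrictL2 {n : ℕ} {s : Set (E n)} (hs : MeasurableSet s) (u : L2 n) : L2 n :=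
  (memLp_indicator hs u).toLp

theorem coeFn_restrictL2 {n : ℕ} {s : Set (E n)} (hs : MeasurableSet s) (u : L2 n) :
    restrictL2 hs u =ᵐ[volume] s.indicator fun x => u x := by
  unfold restrictL2
  exact MemLp.coeFn_toLp (memLp_indicator hs u)

namespace LinearSolution

variable {n : ℕ} {S : ℝ} (A : LinearSolution n S)

theorem continuousOn_powL2 {p : ℝ} (h : AdmissibleExponent n p) :
    ContinuousOn (fun t => powL2 p (A.U t)) (Icc 0 S) :=
  h.continuousOn_powL2.comp (f := fun t => (A.U t, A.W t))
    (A.continuous_U.prodMk A.continuous_W).continuousOn A.weakPair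

/-- The unweighted H¹ norm of the solution is bounded on the compact interval [0, S], so its power p
- 1 enters the constant. The factor 2 + l comes from ku, k∇u and u∇k in the weighted H¹ norm. -/
theorem exists_source_bound {p : ℝ} (h : AdmissibleExponent n p) {g : ℝ → ℝ}
    (hg0 : ∀ t ∈ Ioc 0 S, 0 ≤ g t) (hgi : IntegrableOn g (Ioc 0 S))
    (hG : ∀ s ∈ Ico 0 S, A.G s = ∫ r in (0 : ℝ)..s, g r • powL2 p (A.U (s - r))) :
    ∃ C : ℝ, 0 ≤ C ∧ ∀ l : ℝ, 0 ≤ l → ∀ k : Weight n, (∀ x, ‖∇ k.toFun x‖ ≤ l * |k.toFun x|) →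
      ∀ s ∈ Ico 0 S, ‖k.mul ℝ (A.G s)‖ ≤ ∫ r in (0 : ℝ)..s, g r *
        (C * (2 + l) * Real.sqrt (energyForm k (A.U (s - r)) (A.V (s - r)) (A.W (s - r)))) := by
  obtain ⟨B, hB0, hB, -⟩ := h.exists_pow_bounds
  have hp1 : 0 ≤ p - 1 := by linarith [h.one_lt]
  have hNc : Continuous fun t => (‖A.U t‖ + ‖A.W t‖) ^ (p - 1) :=
    Continuous.rpow_const (A.continuous_U.norm.add A.continuous_W.norm) fun _ => Or.inr hp1
  obtain ⟨M, hM⟩ := isCompact_Icc.bddAbove_image (f := fun t => (‖A.U t‖ + ‖A.W t‖) ^ (p - 1))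
    (K := Icc 0 S) hNc.continuousOn
  have hM' : ∀ t ∈ Icc 0 S, (‖A.U t‖ + ‖A.W t‖) ^ (p - 1) ≤ max M 0 := fun t ht =>
    (hM (mem_image_of_mem _ ht)).trans (le_max_left _ _)
  refine ⟨B * max M 0, by positivity, fun l hl k hk s hs => ?_⟩
  have key : ∀ t ∈ Icc 0 S, ‖k.mul ℝ (powL2 p (A.U t))‖ ≤
      B * max M 0 * (2 + l) * Real.sqrt (energyForm k (A.U t) (A.V t) (A.W t)) := by
    intro t ht
    have h1 : ‖k.mul ℝ (A.U t)‖ ≤ Real.sqrt (energyForm k (A.U t) (A.V t) (A.W t)) := by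
      refine Real.le_sqrt_of_sq_le ?_
      unfold energyForm
      nlinarith [sq_nonneg ‖k.mul ℝ (A.V t)‖, sq_nonneg ‖k.mul (E n) (A.W t)‖]
    have h2 : ‖k.mul (E n) (A.W t)‖ ≤ Real.sqrt (energyForm k (A.U t) (A.V t) (A.W t)) := by
      refine Real.le_sqrt_of_sq_le ?_
      unfold energyForm
      nlinarith [sq_nonneg ‖k.mul ℝ (A.V t)‖, sq_nonneg ‖k.mul ℝ (A.U t)‖]
    have h3 := k.norm_grad_le_mul hk (A.U t)
    have h4 := norm_add_le (k.mul (E n) (A.W t)) (k.grad (A.U t))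
    have h5 := mul_le_mul_of_nonneg_left h1 hl
    have h6 : ‖k.mul ℝ (A.U t)‖ + ‖k.mul (E n) (A.W t) + k.grad (A.U t)‖ ≤
        (2 + l) * Real.sqrt (energyForm k (A.U t) (A.V t) (A.W t)) := by linarith
    calc _ ≤ B * (‖k.mul ℝ (A.U t)‖ + ‖k.mul (E n) (A.W t) + k.grad (A.U t)‖) *
          (‖A.U t‖ + ‖A.W t‖) ^ (p - 1) := hB _ (A.weakPair t ht) k
      _ ≤ B * ((2 + l) * Real.sqrt (energyForm k (A.U t) (A.V t) (A.W t))) * max M 0 := by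
          gcongr
          exact hM' t ht
      _ = _ := by ring
  have hgs : IntervalIntegrable g volume 0 s :=
    (intervalIntegrable_iff_integrableOn_Ioc_of_le hs.1).2
      (hgi.mono_set (Ioc_subset_Ioc_right hs.2.le))
  have hmaps : MapsTo (fun r => s - r) (uIcc 0 s) (Icc 0 S) := by
    intro r hr
    rw [uIcc_of_le hs.1] at hr
    exact ⟨by linarith [hr.2], by linarith [hr.1, hs.2]⟩
  have hint : IntervalIntegrable (fun r => g r • powL2 p (A.U (s - r))) volume 0 s :=
    hgs.smul_continuousOn ((A.continuousOn_powL2 h).comp (by fun_prop) hmaps)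
  rw [hG s hs, ← ContinuousLinearMap.intervalIntegral_comp_comm _ hint]
  refine intervalIntegral.norm_integral_le_of_norm_le hs.1 ?_ ?_
  · refine Filter.Eventually.of_forall fun r hr => ?_
    have hr' : s - r ∈ Icc 0 S := ⟨by linarith [hr.2], by linarith [hr.1, hs.2]⟩
    have hgr := hg0 r ⟨hr.1, hr.2.trans hs.2.le⟩
    rw [map_smul, norm_smul, Real.norm_of_nonneg hgr]
    exact mul_le_mul_of_nonneg_left (key _ hr') hgr
  · refine hgs.mul_continuousOn (Continuous.continuousOn ?_)
    have := continuous_energyForm k A.continuous_U A.continuous_V A.continuous_W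
    exact continuous_const.mul
      (Real.continuous_sqrt.comp (this.comp (by fun_prop : Continuous fun r : ℝ => s - r)))

/-- The data live in |x| ≤ R, at distance at least d from x₀, so the weight is at most e^(-ld)
there. -/
theorem initial_energyForm_le {l d δ : ℝ} (hl : 0 ≤ l) (hδ : 0 < δ) (x₀ : E n) {R : ℝ}
    (hd : d = ‖x₀‖ - R) (hU : ∀ᵐ x, R < ‖x‖ → A.U 0 x = 0) (hV : ∀ᵐ x, R < ‖x‖ → A.V 0 x = 0)
    (hW : ∀ᵐ x, R < ‖x‖ → A.W 0 x = 0) (hd0 : 0 ≤ d) :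
    energyForm (expWeight l δ hl hδ x₀) (A.U 0) (A.V 0) (A.W 0) ≤
      Real.exp (-2 * l * d) * (‖A.U 0‖ ^ 2 + ‖A.V 0‖ ^ 2 + ‖A.W 0‖ ^ 2) := by
  have hk : ∀ x ∈ {x : E n | ‖x‖ ≤ R}, |(expWeight l δ hl hδ x₀).toFun x| ≤ Real.exp (-l * d) := by
    intro x hx
    have hx' : ‖x‖ ≤ R := hx
    rw [expWeight, Real.abs_exp]
    refine Real.exp_le_exp.2 ?_
    have h1 : d ≤ Real.sqrt (δ ^ 2 + ‖x - x₀‖ ^ 2) := by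
      refine Real.le_sqrt_of_sq_le ?_
      have h2 : d ≤ ‖x - x₀‖ := by
        have := norm_sub_norm_le x₀ x
        rw [norm_sub_rev] at this
        linarith
      nlinarith
    nlinarith
  have conv : ∀ {G : Type} [NormedAddCommGroup G] [NormedSpace ℝ G]
      {f : Lp G 2 (volume : Measure (E n))}, (∀ᵐ x, R < ‖x‖ → f x = 0) →
      ‖(expWeight l δ hl hδ x₀).mul G f‖ ^ 2 ≤ Real.exp (-2 * l * d) * ‖f‖ ^ 2 := by
    intro G _ _ f hf
    have h1 := (expWeight l δ hl hδ x₀).norm_mul_le_of_supp hk (f := f) (by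
      filter_upwards [hf] with x hx hx'
      exact hx (not_le.1 hx'))
    calc _ ≤ (Real.exp (-l * d) * ‖f‖) ^ 2 := by gcongr
      _ = _ := by rw [mul_pow, ← Real.exp_nat_mul]; push_cast; ring_nf
  have h1 := conv hU
  have h2 := conv hV
  have h3 := conv hW
  unfold energyForm
  linarith

/-- On the ball of radius δ the smoothed distance is at most 2δ, so removing the weight costs
e^(2lδ). -/
theorem norm_restrictL2_ball_le {l δ : ℝ} (hl : 0 ≤ l) (hδ : 0 < δ) (x₀ : E n) (u : L2 n) :
    ‖restrictL2 (measurableSet_ball (x := x₀) (ε := δ)) u‖ ≤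
      Real.exp (2 * l * δ) * ‖(expWeight l δ hl hδ x₀).mul ℝ u‖ := by
  refine Lp.norm_le_mul_norm_of_ae_le_mul ?_
  filter_upwards [coeFn_restrictL2 (measurableSet_ball (x := x₀) (ε := δ)) u,
    (expWeight l δ hl hδ x₀).coeFn_mul u] with x h1 h2
  rw [h1, h2, norm_smul]
  by_cases hx : x ∈ Metric.ball x₀ δ
  · rw [indicator_of_mem hx, ← mul_assoc]
    refine le_mul_of_one_le_left (norm_nonneg _) ?_
    rw [expWeight, Real.norm_eq_abs, Real.abs_exp, ← Real.exp_add]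
    refine Real.one_le_exp ?_
    have h3 : Real.sqrt (δ ^ 2 + ‖x - x₀‖ ^ 2) ≤ 2 * δ := by
      rw [Real.sqrt_le_left (by positivity)]
      have : ‖x - x₀‖ < δ := by rwa [mem_ball_iff_norm] at hx
      nlinarith [norm_nonneg (x - x₀)]
    nlinarith
  · rw [indicator_of_notMem hx, norm_zero]
    positivity

/-- Finite speed of propagation: the solution vanishes outside `{|x| ≤ R + t}`. -/
theorem eq_zero_of_support {p : ℝ} (h : AdmissibleExponent n p) {g : ℝ → ℝ}
    (hg0 : ∀ t ∈ Ioc 0 S, 0 ≤ g t) (hgi : IntegrableOn g (Ioc 0 S))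
    (hG : ∀ s ∈ Ico 0 S, A.G s = ∫ r in (0 : ℝ)..s, g r • powL2 p (A.U (s - r))) {R : ℝ}
    (hU : ∀ᵐ x, R < ‖x‖ → A.U 0 x = 0) (hV : ∀ᵐ x, R < ‖x‖ → A.V 0 x = 0)
    {t : ℝ} (ht : 0 ≤ t) (htS : t < S) : ∀ᵐ x, R + t < ‖x‖ → A.U t x = 0 := by
  have hS : 0 < S := ht.trans_lt htS
  have hW : ∀ᵐ x, R < ‖x‖ → A.W 0 x = 0 :=
    IsWeakGradient.eq_zero_on (mem_weakPairs.1 (A.weakPair 0 ⟨le_rfl, hS.le⟩)) (Lp.memLp _)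
      (O := {x : E n | R < ‖x‖}) (isOpen_lt continuous_const continuous_norm) hU
  obtain ⟨C, hC0, hC⟩ := A.exists_source_bound h hg0 hgi hG
  set E₀ := ‖A.U 0‖ ^ 2 + ‖A.V 0‖ ^ 2 + ‖A.W 0‖ ^ 2 with hE₀
  have hE₀' : 0 ≤ E₀ := by positivity
  have hball : ∀ x₀ : E n, R + t < ‖x₀‖ → ∃ δ, 0 < δ ∧
      ∀ᵐ x, x ∈ Metric.ball x₀ δ → A.U t x = 0 := by
    intro x₀ hx₀
    set d := ‖x₀‖ - R - t with hd
    have hd0 : 0 < d := by rw [hd]; linarith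
    refine ⟨d / 8, by positivity, ?_⟩
    have hδ : 0 < d / 8 := by positivity
    set f : L2 n := restrictL2 (measurableSet_ball (x := x₀) (ε := d / 8)) (A.U t) with hf
    -- The exponents add up to ld/2 from the ball, -2l(d + t) from the data and 2(l + 1)t + 4C(2 +
    -- l)εt from the growth. For l ≥ 2 and 8Ctε < d the sum is at most 2t - ld/2, which tends to -∞
    -- with l.
    have bound : ∀ᶠ l : ℝ in Filter.atTop,
        ‖f‖ ^ 2 ≤ (2 * l + 2) * E₀ * Real.exp (2 * t) * Real.exp (-(l * (d / 2))) := by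
      have hlim := (tendsto_integral_mul_exp_neg hS.le hgi).const_mul (8 * C * t)
      rw [mul_zero] at hlim
      filter_upwards [Filter.eventually_ge_atTop (2 : ℝ), hlim.eventually (gt_mem_nhds hd0)]
        with l hl hε
      have hl0 : 0 ≤ l := by linarith
      set ε := ∫ r in (0 : ℝ)..S, g r * Real.exp (-l * r) with hε'
      have hε0 : 0 ≤ ε := by
        refine intervalIntegral.integral_nonneg_of_ae_restrict hS.le ?_
        rw [Filter.EventuallyLE, ae_restrict_iff' measurableSet_Icc]
        filter_upwards [compl_mem_ae_iff.2 (measure_singleton (0 : ℝ))] with r hr hr'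
        have : 0 < r := lt_of_le_of_ne hr'.1 (Ne.symm hr)
        exact mul_nonneg (hg0 r ⟨this, hr'.2⟩) (Real.exp_pos _).le
      have hk := norm_gradient_expFun_le hl0 hδ x₀
      have hk' : ∀ x, ‖∇ (expWeight l (d / 8) hl0 hδ x₀).toFun x‖ ≤
          l * |(expWeight l (d / 8) hl0 hδ x₀).toFun x| := by
        intro x
        rw [expWeight, Real.abs_exp]
        exact hk x
      have h1 := A.energy_growth _ hl0 hk' hg0 hgi (D := C * (2 + l)) (by positivity)
        (hC l hl0 _ hk') ht htS
      have h2 := A.initial_energyForm_le hl0 hδ x₀ rfl hU hV hW (by linarith)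
      have h3 := norm_restrictL2_ball_le hl0 hδ x₀ (A.U t)
      rw [← hf] at h3
      have h4 : ‖(expWeight l (d / 8) hl0 hδ x₀).mul ℝ (A.U t)‖ ^ 2 ≤
          energyForm (expWeight l (d / 8) hl0 hδ x₀) (A.U t) (A.V t) (A.W t) := by
        unfold energyForm
        nlinarith [sq_nonneg ‖(expWeight l (d / 8) hl0 hδ x₀).mul ℝ (A.V t)‖,
          sq_nonneg ‖(expWeight l (d / 8) hl0 hδ x₀).mul (E n) (A.W t)‖]
      calc ‖f‖ ^ 2 ≤ (Real.exp (2 * l * (d / 8)) *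
            ‖(expWeight l (d / 8) hl0 hδ x₀).mul ℝ (A.U t)‖) ^ 2 := by gcongr
        _ = Real.exp (l * d / 2) * ‖(expWeight l (d / 8) hl0 hδ x₀).mul ℝ (A.U t)‖ ^ 2 := by
            rw [mul_pow, ← Real.exp_nat_mul]; push_cast; ring_nf
        _ ≤ Real.exp (l * d / 2) * ((2 * l + 2) * (Real.exp (-2 * l * (‖x₀‖ - R)) * E₀) *
            Real.exp (2 * (l + 1 + 2 * (C * (2 + l) * ε)) * t)) := by
            refine mul_le_mul_of_nonneg_left (h4.trans (h1.trans ?_)) (Real.exp_pos _).le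
            gcongr
        _ = (2 * l + 2) * E₀ * (Real.exp (l * d / 2) * Real.exp (-2 * l * (‖x₀‖ - R)) *
            Real.exp (2 * (l + 1 + 2 * (C * (2 + l) * ε)) * t)) := by ring
        _ ≤ (2 * l + 2) * E₀ * (Real.exp (2 * t) * Real.exp (-(l * (d / 2)))) := by
            refine mul_le_mul_of_nonneg_left ?_ (by positivity)
            rw [← Real.exp_add, ← Real.exp_add, ← Real.exp_add]
            refine Real.exp_le_exp.2 ?_
            have h5 : (2 + l) * (C * ε * t) ≤ 2 * l * (C * ε * t) := by gcongr; linarith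
            have h6 : l * (8 * C * t * ε) ≤ l * d := by gcongr
            have h7 : ‖x₀‖ - R = d + t := by rw [hd]; ring
            rw [h7]
            nlinarith
        _ = _ := by ring
    have hlim : Filter.Tendsto (fun l : ℝ => (2 * l + 2) * E₀ * Real.exp (2 * t) *
        Real.exp (-(l * (d / 2)))) Filter.atTop (nhds 0) := by
      have hd2 : 0 < d / 2 := by positivity
      have hm : Filter.Tendsto (fun l : ℝ => l * (d / 2)) Filter.atTop Filter.atTop :=
        Filter.tendsto_id.atTop_mul_const hd2
      have e1 := (Real.tendsto_pow_mul_exp_neg_atTop_nhds_zero 1).comp hm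
      have e0 := Real.tendsto_exp_neg_atTop_nhds_zero.comp hm
      have := (e1.const_mul (2 * E₀ * Real.exp (2 * t) * (d / 2)⁻¹)).add
        (e0.const_mul (2 * E₀ * Real.exp (2 * t)))
      simp only [mul_zero, add_zero] at this
      refine this.congr fun l => ?_
      simp only [comp_apply, pow_one]
      field_simp
    have hf0 : ‖f‖ = 0 := by
      have : ‖f‖ ^ 2 ≤ 0 := ge_of_tendsto hlim bound
      exact pow_eq_zero_iff (two_ne_zero) |>.1 (le_antisymm this (by positivity))
    rw [norm_eq_zero] at hf0
    filter_upwards [coeFn_restrictL2 (measurableSet_ball (x := x₀) (ε := d / 8)) (A.U t), Lp.coeFn_zero ℝ 2 volume (α := E n)]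
      with x h1 h2 hx
    rw [← hf, hf0, h2, indicator_of_mem hx] at h1
    exact h1.symm
  rw [ae_iff]
  refine measure_null_of_locally_null _ fun x₀ hx₀ => ?_
  have hx₀' : R + t < ‖x₀‖ := by
    by_contra hcon
    exact hx₀ fun h => absurd h hcon
  obtain ⟨δ, hδ, hae⟩ := hball x₀ hx₀'
  refine ⟨{x | ¬(R + t < ‖x‖ → A.U t x = 0)} ∩ Metric.ball x₀ δ,
    inter_mem_nhdsWithin _ (Metric.ball_mem_nhds _ hδ), ?_⟩
  refine measure_mono_null ?_ (ae_iff.1 hae)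
  rintro x ⟨hx1, hx2⟩ hx3
  exact hx1 fun _ => hx3 hx2

end LinearSolution

/-! ### Energy solutions as curves in the energy space -/

section History

variable {H : Type*} [NormedAddCommGroup H] [NormedSpace ℝ H]

/-- The convolution of a kernel on `(0, S]` with a curve, which is regarded as zero at negative
times. -/
def history (g : ℝ → ℝ) (P : ℝ → H) (S s : ℝ) : H :=
  ∫ r in Ioc 0 S, g r • (Ici 0).indicator P (s - r)

/-- Keeping the integration interval (0, S] fixed allows dominated convergence. The jump of the
curve at time 0 is met only at r = s₀, a null set. -/
theorem continuous_history {g : ℝ → ℝ} {P : ℝ → H} {S M : ℝ} (hg : IntegrableOn g (Ioc 0 S))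
    (hP : Continuous P) (hM : ∀ t, ‖P t‖ ≤ M) : Continuous (history g P S) := by
  refine continuous_iff_continuousAt.2 fun s₀ => ?_
  refine continuousAt_of_dominated (bound := fun r => ‖g r‖ * M) ?_ ?_ (hg.norm.mul_const M) ?_
  · refine Filter.Eventually.of_forall fun s => hg.aestronglyMeasurable.smul ?_
    exact ((hP.stronglyMeasurable.indicator measurableSet_Ici).comp_measurable
      (measurable_const.sub measurable_id)).aestronglyMeasurable
  · refine Filter.Eventually.of_forall fun s => Filter.Eventually.of_forall fun r => ?_
    rw [norm_smul]
    exact mul_le_mul_of_nonneg_left ((norm_indicator_le_norm_self P _).trans (hM _))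
      (norm_nonneg _)
  · filter_upwards [ae_restrict_of_ae (compl_mem_ae_iff.2 (measure_singleton s₀))] with r hr
    refine ContinuousAt.const_smul (ContinuousAt.comp (f := fun s => s - r)
      (g := (Ici 0).indicator P) ?_ (by fun_prop)) _
    have hne : s₀ - r ≠ 0 := fun h => hr (by simp only [mem_singleton_iff]; linarith)
    rcases hne.lt_or_gt with h | h
    · refine continuousAt_const (y := (0 : H)).congr ?_
      filter_upwards [Iio_mem_nhds h] with x hx
      rw [indicator_of_notMem]
      exact not_le.2 (mem_Iio.1 hx)
    · refine hP.continuousAt.congr ?_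
      filter_upwards [Ioi_mem_nhds h] with x hx
      rw [indicator_of_mem]
      exact le_of_lt (mem_Ioi.1 hx)

theorem history_eq {g : ℝ → ℝ} {P : ℝ → H} {S s : ℝ} (hs : s ∈ Icc 0 S) :
    history g P S s = ∫ r in (0 : ℝ)..s, g r • P (s - r) := by
  rw [history, intervalIntegral.integral_of_le hs.1,
    ← integral_indicator measurableSet_Ioc, ← integral_indicator measurableSet_Ioc]
  congr 1
  funext r
  by_cases h1 : r ∈ Ioc 0 s
  · rw [indicator_of_mem (show r ∈ Ioc 0 S from ⟨h1.1, h1.2.trans hs.2⟩), indicator_of_mem h1,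
      indicator_of_mem (show s - r ∈ Ici 0 from sub_nonneg.2 h1.2)]
  · rw [indicator_of_notMem h1]
    by_cases h2 : r ∈ Ioc 0 S
    · rw [indicator_of_mem h2, indicator_of_notMem, smul_zero]
      intro h3
      exact h1 ⟨h2.1, sub_nonneg.1 h3⟩
    · rw [indicator_of_notMem h2]

end History

theorem inner_intervalIntegral {H : Type*} [NormedAddCommGroup H] [InnerProductSpace ℝ H]
    [CompleteSpace H] {X : ℝ → H} {a b : ℝ} (hX : IntervalIntegrable X volume a b) (y : H) :
    inner ℝ (∫ r in a..b, X r) y = ∫ r in a..b, inner ℝ (X r) y := by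
  rw [real_inner_comm]
  have := (innerSL ℝ y).intervalIntegral_comp_comm hX
  simp only [innerSL_apply_apply] at this
  rw [← this]
  exact intervalIntegral.integral_congr fun r _ => real_inner_comm _ _

theorem inner_eq_mul (a b : ℝ) : inner ℝ a b = a * b := by simp [mul_comm]

theorem inner_testPair_fst {n : ℕ} {ψ : E n → ℝ} (hψ : ContDiff ℝ ∞ ψ) (hc : HasCompactSupport ψ)
    {f : E n → ℝ} {F : L2 n} (hf : f =ᵐ[volume] F) :
    inner ℝ F (testPair ψ hψ hc).1 = ∫ x, f x * ψ x := by
  rw [L2.inner_def]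
  refine integral_congr_ae ?_
  filter_upwards [hf, coeFn_testPair_fst hψ hc] with x h1 h2
  rw [h1, h2, inner_eq_mul]

theorem inner_testPair_snd {n : ℕ} {ψ : E n → ℝ} (hψ : ContDiff ℝ ∞ ψ) (hc : HasCompactSupport ψ)
    (F : L2V n) : inner ℝ F (testPair ψ hψ hc).2 = ∫ x, inner ℝ (F x) (∇ ψ x) := by
  rw [L2.inner_def]
  refine integral_congr_ae ?_
  filter_upwards [coeFn_testPair_snd hψ hc] with x h2
  rw [h2]

section TimeSpan

variable {T : ℝ≥0∞}

theorem Icc_subset_timeSpan {S : ℝ} (hST : ENNReal.ofReal S < T) : Icc 0 S ⊆ timeSpan T :=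
  fun _ ht => ⟨ht.1, (ENNReal.ofReal_le_ofReal ht.2).trans_lt hST⟩

theorem exists_gt_mem_timeSpan {t : ℝ} (ht : t ∈ timeSpan T) :
    ∃ S, t < S ∧ ENNReal.ofReal S < T := by
  obtain ⟨r, hr0, h1, h2⟩ := ENNReal.lt_iff_exists_real_btwn.1 ht.2
  exact ⟨r, (ENNReal.ofReal_lt_ofReal_iff'.1 h1).1, h2⟩

/-- A test function that does not depend on time up to time `S`. -/
theorem isTestFunction_mul {n : ℕ} (χ : ContDiffBump (0 : ℝ))
    (hχ : ENNReal.ofReal χ.rOut < T) {ψ : E n → ℝ} (hψ : ContDiff ℝ ∞ ψ)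
    (hc : HasCompactSupport ψ) : IsTestFunction T fun t x => χ t * ψ x := by
  have hsub : support (uncurry fun (t : ℝ) (x : E n) => χ t * ψ x) ⊆
      Metric.closedBall 0 χ.rOut ×ˢ tsupport ψ := by
    rintro ⟨t, x⟩ h
    have h' : χ t * ψ x ≠ 0 := h
    have h1 : t ∈ support χ := left_ne_zero_of_mul h'
    rw [χ.support_eq] at h1
    exact ⟨Metric.ball_subset_closedBall h1, subset_tsupport ψ (right_ne_zero_of_mul h')⟩
  have hcomp : IsCompact (Metric.closedBall (0 : ℝ) χ.rOut ×ˢ tsupport ψ) :=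
    (isCompact_closedBall _ _).prod hc
  refine ⟨(χ.contDiff.comp contDiff_fst).mul (hψ.comp contDiff_snd),
    HasCompactSupport.of_support_subset_isCompact hcomp hsub, fun z hz => ?_⟩
  have h1 := (closure_minimal hsub hcomp.isClosed hz).1
  rw [mem_closedBall_zero_iff, Real.norm_eq_abs] at h1
  exact (ENNReal.ofReal_le_ofReal ((le_abs_self _).trans h1)).trans_lt hχ

end TimeSpan

/-- The memory term tested against a function, by Fubini's theorem. -/
theorem integral_memory_mul {n : ℕ} {g : ℝ → ℝ} {p M s : ℝ} (hs : 0 ≤ s)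
    (hg : IntegrableOn g (Ioc 0 s)) {u : ℝ → E n → ℝ} {P : ℝ → L2 n}
    (hu : AEStronglyMeasurable (uncurry u) (volume.restrict (Ioc 0 s ×ˢ (univ : Set (E n)))))
    (hP : ∀ τ ∈ Icc 0 s, P τ =ᵐ[volume] fun x => |u τ x| ^ p) (hM : ∀ τ, ‖P τ‖ ≤ M)
    {ψ : E n → ℝ} (hψ : ContDiff ℝ ∞ ψ) (hc : HasCompactSupport ψ) :
    ∫ x, memory g p u s x * ψ x =
      ∫ r in (0 : ℝ)..s, g r * inner ℝ (P (s - r)) (testPair ψ hψ hc).1 := by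
  have hgs : IntegrableOn (fun τ => g (s - τ)) (Ioc 0 s) := by
    have h1 : IntervalIntegrable (fun τ => g (s - τ)) volume (s - 0) (s - s) :=
      ((intervalIntegrable_iff_integrableOn_Ioc_of_le hs).2 hg).comp_sub_left s
    rw [sub_zero, sub_self] at h1
    exact (intervalIntegrable_iff_integrableOn_Ioc_of_le hs).1 h1.symm
  have hψL : MemLp ψ 2 volume := memLp_of_smooth hψ hc
  set ν := (volume : Measure ℝ).restrict (Ioc 0 s) with hν
  have hprod : (volume : Measure (ℝ × E n)).restrict (Ioc 0 s ×ˢ (univ : Set (E n))) =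
      ν.prod (volume : Measure (E n)) := by
    rw [Measure.volume_eq_prod, ← Measure.prod_restrict, Measure.restrict_univ]
  rw [hprod] at hu
  have hmeas : AEStronglyMeasurable
      (uncurry fun (τ : ℝ) (x : E n) => g (s - τ) * |u τ x| ^ p * ψ x) (ν.prod volume) := by
    have h1 : AEStronglyMeasurable (fun z : ℝ × E n => g (s - z.1)) (ν.prod volume) :=
      hgs.aestronglyMeasurable.comp_fst
    have h2 : AEStronglyMeasurable (fun z : ℝ × E n => |u z.1 z.2| ^ p) (ν.prod volume) :=
      (hu.aemeasurable.abs.pow_const p).aestronglyMeasurable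
    exact (h1.mul h2).mul (hψ.continuous.comp continuous_snd).aestronglyMeasurable
  have hmem : ∀ τ ∈ Icc 0 s, MemLp (fun x => |u τ x| ^ p) 2 volume := fun τ hτ =>
    (memLp_congr_ae (hP τ hτ)).1 (Lp.memLp (P τ))
  have hint : Integrable (uncurry fun (τ : ℝ) (x : E n) => g (s - τ) * |u τ x| ^ p * ψ x)
      (ν.prod volume) := by
    rw [integrable_prod_iff hmeas]
    constructor
    · filter_upwards [ae_restrict_mem measurableSet_Ioc] with τ hτ
      have := ((hmem τ ⟨hτ.1.le, hτ.2⟩).integrable_mul hψL).const_mul (g (s - τ))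
      refine this.congr (Filter.Eventually.of_forall fun x => ?_)
      simp [mul_assoc]
    · refine Integrable.mono' (hgs.norm.mul_const (M * ‖hψL.norm.toLp‖))
        hmeas.norm.integral_prod_right' ?_
      filter_upwards [ae_restrict_mem measurableSet_Ioc] with τ hτ
      have hτ' : τ ∈ Icc 0 s := ⟨hτ.1.le, hτ.2⟩
      have e : ∫ x, ‖g (s - τ) * |u τ x| ^ p * ψ x‖ =
          ‖g (s - τ)‖ * inner ℝ (P τ) hψL.norm.toLp := by
        rw [L2.inner_def, ← integral_const_mul]
        refine integral_congr_ae ?_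
        filter_upwards [hP τ hτ', hψL.norm.coeFn_toLp] with x h1 h2
        rw [h1, h2, inner_eq_mul, norm_mul, norm_mul,
          Real.norm_of_nonneg (show 0 ≤ |u τ x| ^ p by positivity), mul_assoc]
      simp only [uncurry_apply_pair]
      rw [e, norm_mul, norm_norm]
      refine mul_le_mul_of_nonneg_left ((norm_inner_le_norm _ _).trans ?_) (norm_nonneg _)
      exact mul_le_mul_of_nonneg_right (hM τ) (norm_nonneg _)
  have h1 := integral_integral_swap hint
  calc ∫ x, memory g p u s x * ψ x
      = ∫ x, ∫ τ, g (s - τ) * |u τ x| ^ p * ψ x ∂ν := by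
        congr 1; funext x
        rw [memory, intervalIntegral.integral_of_le hs, ← integral_mul_const]
        rfl
    _ = ∫ τ in (0 : ℝ)..s, ∫ x, g (s - τ) * |u τ x| ^ p * ψ x := by
        rw [← h1, intervalIntegral.integral_of_le hs]
    _ = ∫ τ in (0 : ℝ)..s, g (s - τ) * inner ℝ (P (s - (s - τ))) (testPair ψ hψ hc).1 := by
        refine intervalIntegral.integral_congr fun τ hτ => ?_
        rw [uIcc_of_le hs] at hτ
        simp only [sub_sub_cancel]
        rw [inner_testPair_fst hψ hc (hP τ hτ).symm, ← integral_const_mul]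
        simp only [mul_assoc]
    _ = _ := by
        rw [intervalIntegral.integral_comp_sub_left
          (fun r => g r * inner ℝ (P (s - r)) (testPair ψ hψ hc).1) s]
        simp

/-! ### From energy solutions to linear solutions with a memory source. -/

section Curves

variable {n : ℕ} {g : ℝ → ℝ} {p : ℝ} {u₀ u₁ : E n → ℝ} {T : ℝ≥0∞} {u : ℝ → E n → ℝ} {S : ℝ}

/-- The weak formulation with a test function that does not depend on time. -/
theorem weak_identity_of_test {V : ℝ → L2 n} {W : ℝ → L2V n} (hS : 0 < S)
    (hST : ENNReal.ofReal S < T)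
    (hweak : ∀ φ : ℝ → E n → ℝ, IsTestFunction T φ → ∀ t ∈ timeSpan T, 0 < t →
      (∫ s in (0 : ℝ)..t, ∫ x, (-(V s x * deriv (fun σ => φ σ x) s) + inner ℝ (W s x) (∇ (φ s) x)))
          + ∫ x, V t x * φ t x
        = (∫ x, u₁ x * φ 0 x) + ∫ s in (0 : ℝ)..t, ∫ x, memory g p u s x * φ s x)
    {ψ : E n → ℝ} (hψ : ContDiff ℝ ∞ ψ) (hc : HasCompactSupport ψ) {t : ℝ} (ht : 0 < t)
    (htS : t ≤ S) :
    (∫ s in (0 : ℝ)..t, inner ℝ (W s) (testPair ψ hψ hc).2) + inner ℝ (V t) (testPair ψ hψ hc).1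
      = (∫ x, u₁ x * ψ x) + ∫ s in (0 : ℝ)..t, ∫ x, memory g p u s x * ψ x := by
  obtain ⟨S', hS', hS'T⟩ := exists_gt_mem_timeSpan (T := T) (t := S) ⟨hS.le, hST⟩
  -- The cutoff is 1 on [0, S] and its support stays below T, so the product test function is
  -- independent of time where the equation is used and its time derivative drops out.
  set χ : ContDiffBump (0 : ℝ) := ⟨S, S', hS, hS'⟩ with hχ
  have hχ1 : ∀ s ∈ Icc 0 S, χ s = 1 := fun s hs =>
    χ.one_of_mem_closedBall (by
      rw [mem_closedBall_zero_iff, Real.norm_eq_abs, abs_of_nonneg hs.1]; exact hs.2)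
  have htmem : t ∈ Icc 0 S := ⟨ht.le, htS⟩
  have h := hweak _ (isTestFunction_mul χ hS'T hψ hc) t (Icc_subset_timeSpan hST htmem) ht
  simp only [hχ1 t htmem, hχ1 0 ⟨le_rfl, hS.le⟩, one_mul] at h
  rw [inner_testPair_fst hψ hc (Filter.EventuallyEq.refl _ (V t))]
  have e1 : ∫ s in (0 : ℝ)..t, ∫ x, memory g p u s x * (χ s * ψ x) =
      ∫ s in (0 : ℝ)..t, ∫ x, memory g p u s x * ψ x := by
    refine intervalIntegral.integral_congr fun s hs => ?_
    rw [uIcc_of_le ht.le] at hs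
    simp only [hχ1 s ⟨hs.1, hs.2.trans htS⟩, one_mul]
  have e2 : ∫ s in (0 : ℝ)..t, ∫ x, (-(V s x * deriv (fun σ => χ σ * ψ x) s) +
      inner ℝ (W s x) (∇ (fun x => χ s * ψ x) x)) =
      ∫ s in (0 : ℝ)..t, inner ℝ (W s) (testPair ψ hψ hc).2 := by
    rw [intervalIntegral.integral_of_le ht.le, intervalIntegral.integral_of_le ht.le,
      integral_Ioc_eq_integral_Ioo, integral_Ioc_eq_integral_Ioo]
    refine setIntegral_congr_fun measurableSet_Ioo fun s hs => ?_
    have hs' : s ∈ Ioo 0 S := ⟨hs.1, hs.2.trans_le htS⟩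
    rw [inner_testPair_snd]
    congr 1; funext x
    have hd : deriv (fun σ => χ σ * ψ x) s = 0 := by
      have : (fun σ => χ σ * ψ x) =ᶠ[nhds s] fun _ => ψ x := by
        filter_upwards [isOpen_Ioo.mem_nhds hs'] with σ hσ
        rw [hχ1 σ ⟨hσ.1.le, hσ.2.le⟩, one_mul]
      rw [this.deriv_eq, deriv_const]
    simp only [hd, mul_zero, neg_zero, zero_add, hχ1 s ⟨hs'.1.le, hs'.2.le⟩, one_mul]
  rw [e1, e2] at h
  exact h

theorem eq_of_inner_testPair_eq {F : L2 n} {f : E n → ℝ} (hf : MemLp f 2 volume)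
    (h : ∀ ψ hψ hc, inner ℝ F (testPair ψ hψ hc).1 = ∫ x, f x * ψ x) : F =ᵐ[volume] f := by
  refine ae_eq_of_integral_contDiff_smul_eq ((Lp.memLp F).locallyIntegrable (by norm_num))
    (hf.locallyIntegrable (by norm_num)) fun ψ hψ hc => ?_
  have h1 := h ψ hψ hc
  rw [inner_testPair_fst hψ hc (Filter.EventuallyEq.refl _ F)] at h1
  simpa only [smul_eq_mul, mul_comm] using h1

/-- On compact time intervals an energy solution is a solution of a linear equation whose source is
the memory term. -/
theorem IsEnergySolution.exists_linearSolution (h : AdmissibleExponent n p)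
    (hu : IsEnergySolution g p u₀ u₁ T u) (hu₁ : MemLp u₁ 2 volume) (hS : 0 < S)
    (hST : ENNReal.ofReal S < T) (hg : IntegrableOn g (Ioc 0 S)) :
    ∃ A : LinearSolution n S, (∀ t ∈ Icc 0 S, u t =ᵐ[volume] A.U t) ∧ A.V 0 =ᵐ[volume] u₁ ∧
      ∀ s ∈ Icc 0 S, A.G s = ∫ r in (0 : ℝ)..s, g r • powL2 p (A.U (s - r)) := by
  obtain ⟨hum, -, -, -, U, V, W, huU, hUW, hUc, hWc, hUV, hVc, hweak⟩ := hu
  have hsub := Icc_subset_timeSpan hST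
  -- Clamping time to [0, S] extends the curves continuously to the whole line with constant end
  -- values.
  set c : ℝ → ℝ := fun t => projIcc 0 S hS.le t with hc
  have hcc : Continuous c := continuous_subtype_val.comp continuous_projIcc
  have hcm : ∀ t, c t ∈ Icc 0 S := fun t => (projIcc 0 S hS.le t).2
  have hce : ∀ t ∈ Icc 0 S, c t = t := fun t ht => by
    simp only [hc, projIcc_of_mem hS.le ht]
  have ext : ∀ {H : Type} [TopologicalSpace H] {X : ℝ → H}, ContinuousOn X (timeSpan T) →
      Continuous fun t => X (c t) := fun hX =>
    (hX.mono hsub).comp_continuous hcc hcm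
  have hVc' := ext hVc
  have hWc' := ext hWc
  have hpair : ∀ t ∈ Icc 0 S, (U t, W t) ∈ weakPairs n := fun t ht =>
    mem_weakPairs.2 (hUW t (hsub ht))
  set P : ℝ → L2 n := fun t => powL2 p (U (c t)) with hP
  have hPc : Continuous P := by
    have : Continuous fun t => (U (c t), W (c t)) := (ext hUc).prodMk hWc'
    exact h.continuousOn_powL2.comp_continuous this fun t => hpair _ (hcm t)
  obtain ⟨M, hM⟩ := isCompact_Icc.bddAbove_image (f := fun t => ‖P t‖) (K := Icc 0 S)
    hPc.norm.continuousOn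
  have hPM : ∀ t, ‖P t‖ ≤ M := fun t => by
    have h1 : P t = P (c t) := by simp only [hP, hce _ (hcm t)]
    rw [h1]
    exact hM (mem_image_of_mem _ (hcm t))
  -- The clamped U would fail to be differentiable at 0 and S; integrating the extended velocity
  -- gives a C¹ extension instead.
  set U' : ℝ → L2 n := fun t => U 0 + ∫ r in (0 : ℝ)..t, V (c r) with hU'
  have hder : ∀ t, HasDerivAt U' (V (c t)) t := fun t =>
    (intervalIntegral.integral_hasDerivAt_right (hVc'.intervalIntegrable _ _)
      hVc'.stronglyMeasurable.stronglyMeasurableAtFilter hVc'.continuousAt).const_add (U 0)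
  have hUU' : ∀ t ∈ Icc 0 S, U' t = U t := by
    intro t ht
    have hI : ∀ s ∈ Ioo 0 t, timeSpan T ∈ nhds s := fun s hs =>
      Filter.mem_of_superset (Icc_mem_nhds hs.1 hs.2)
        ((Icc_subset_Icc_right ht.2).trans hsub)
    have h1 := intervalIntegral.integral_eq_sub_of_hasDeriv_right_of_le ht.1
      (f := U) (f' := fun r => V (c r)) (hUc.mono ((Icc_subset_Icc_right ht.2).trans hsub))
      (fun s hs => by
        have hs' : s ∈ Icc 0 S := ⟨hs.1.le, hs.2.le.trans ht.2⟩
        simp only [hce s hs']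
        exact ((hUV s (hsub hs')).hasDerivAt (hI s hs)).hasDerivWithinAt)
      (hVc'.intervalIntegrable _ _)
    simp only [hU', h1, add_sub_cancel]
  set G := history g P S with hG
  have hGc : Continuous G := continuous_history hg hPc hPM
  have hGe : ∀ s ∈ Icc 0 S, G s = ∫ r in (0 : ℝ)..s, g r • P (s - r) := fun s hs => history_eq hs
  have hgs : ∀ s ∈ Icc 0 S, IntervalIntegrable g volume 0 s := fun s hs =>
    (intervalIntegrable_iff_integrableOn_Ioc_of_le hs.1).2
      (hg.mono_set (Ioc_subset_Ioc_right hs.2))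
  have hmemory : ∀ s ∈ Icc 0 S, ∀ ψ hψ hψc, ∫ x, memory g p u s x * ψ x =
      inner ℝ (G s) (testPair ψ hψ hψc).1 := by
    intro s hs ψ hψ hψc
    rw [integral_memory_mul hs.1 (hg.mono_set (Ioc_subset_Ioc_right hs.2)) (P := P) (M := M)
      (hum.mono_measure (Measure.restrict_mono (prod_mono (fun τ hτ => hsub
        ⟨hτ.1.le, hτ.2.trans hs.2⟩) subset_rfl) le_rfl)) ?_ hPM hψ hψc, hGe s hs,
      inner_intervalIntegral (X := fun r => g r • P (s - r)) ((hgs s hs).smul_continuousOn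
        (hPc.comp (by fun_prop : Continuous fun r : ℝ => s - r)).continuousOn)]
    · simp only [real_inner_smul_left]
    · intro τ hτ
      have hτ' : τ ∈ Icc 0 S := ⟨hτ.1, hτ.2.trans hs.2⟩
      simp only [hP, hce τ hτ']
      filter_upwards [h.coeFn_powL2 (hpair τ hτ'), huU τ (hsub hτ')] with x h1 h2
      rw [h1, h2]
  have key : ∀ t ∈ Ioc 0 S, ∀ ψ hψ hψc, inner ℝ (V (c t)) (testPair ψ hψ hψc).1 =
      (∫ x, u₁ x * ψ x) - inner ℝ (∫ r in (0 : ℝ)..t, W (c r)) (testPair ψ hψ hψc).2 +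
        inner ℝ (∫ r in (0 : ℝ)..t, G r) (testPair ψ hψ hψc).1 := by
    intro t ht ψ hψ hψc
    have h1 := weak_identity_of_test hS hST hweak hψ hψc ht.1 ht.2
    rw [inner_intervalIntegral (hWc'.intervalIntegrable _ _),
      inner_intervalIntegral (hGc.intervalIntegrable _ _), hce t ⟨ht.1.le, ht.2⟩]
    have e1 : ∫ r in (0 : ℝ)..t, inner ℝ (W (c r)) (testPair ψ hψ hψc).2 =
        ∫ r in (0 : ℝ)..t, inner ℝ (W r) (testPair ψ hψ hψc).2 := by
      refine intervalIntegral.integral_congr fun r hr => ?_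
      rw [uIcc_of_le ht.1.le] at hr
      simp only [hce r ⟨hr.1, hr.2.trans ht.2⟩]
    have e2 : ∫ r in (0 : ℝ)..t, inner ℝ (G r) (testPair ψ hψ hψc).1 =
        ∫ r in (0 : ℝ)..t, ∫ x, memory g p u r x * ψ x := by
      refine intervalIntegral.integral_congr fun r hr => ?_
      rw [uIcc_of_le ht.1.le] at hr
      exact (hmemory r ⟨hr.1, hr.2.trans ht.2⟩ ψ hψ hψc).symm
    rw [e1, e2]
    linarith
  have contPrim : ∀ {H : Type} [NormedAddCommGroup H] [NormedSpace ℝ H] {X : ℝ → H},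
      Continuous X → Continuous fun t => ∫ r in (0 : ℝ)..t, X r := fun hX =>
    intervalIntegral.continuous_primitive (fun a b => hX.intervalIntegrable a b) 0
  -- The weak formulation is available only for t > 0. Letting t → 0 identifies the initial velocity
  -- with u₁.
  have key0 : ∀ ψ hψ hψc, inner ℝ (V (c 0)) (testPair ψ hψ hψc).1 = ∫ x, u₁ x * ψ x := by
    intro ψ hψ hψc
    have l1 : Continuous fun t => inner ℝ (V (c t)) (testPair ψ hψ hψc).1 :=
      hVc'.inner continuous_const
    have l2 : Continuous fun t => (∫ x, u₁ x * ψ x) -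
        inner ℝ (∫ r in (0 : ℝ)..t, W (c r)) (testPair ψ hψ hψc).2 +
        inner ℝ (∫ r in (0 : ℝ)..t, G r) (testPair ψ hψ hψc).1 :=
      (continuous_const.sub ((contPrim hWc').inner continuous_const)).add
        ((contPrim hGc).inner continuous_const)
    have t1 := (l1.tendsto 0).mono_left (nhdsWithin_le_nhds (s := Ioi (0 : ℝ)))
    have t2 := (l2.tendsto 0).mono_left (nhdsWithin_le_nhds (s := Ioi (0 : ℝ)))
    have := tendsto_nhds_unique (t1.congr' (by
      filter_upwards [Ioc_mem_nhdsGT hS] with t ht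
      exact key t ht ψ hψ hψc)) t2
    simpa using this
  have key' : ∀ t ∈ Icc 0 S, ∀ ψ hψ hψc, inner ℝ (V (c t)) (testPair ψ hψ hψc).1 =
      (∫ x, u₁ x * ψ x) - inner ℝ (∫ r in (0 : ℝ)..t, W (c r)) (testPair ψ hψ hψc).2 +
        inner ℝ (∫ r in (0 : ℝ)..t, G r) (testPair ψ hψ hψc).1 := by
    intro t ht ψ hψ hψc
    rcases ht.1.eq_or_lt with h0 | h0
    · subst h0
      simp [key0 ψ hψ hψc]
    · exact key t ⟨h0, ht.2⟩ ψ hψ hψc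
  refine ⟨{ U := U', V := fun t => V (c t), W := fun t => W (c t), G := G
            continuous_V := hVc', continuous_W := hWc', continuous_G := hGc
            hasDerivAt := hder
            weakPair := fun t ht => by
              rw [hUU' t ht]
              simp only [hce t ht]
              exact hpair t ht
            weak := ?_ }, ?_, ?_, ?_⟩
  · intro s hs t ht z hz
    refine testPairs_induction (p := fun z => inner ℝ (V (c t) - V (c s)) z.1 =
      -inner ℝ (∫ r in s..t, W (c r)) z.2 + inner ℝ (∫ r in s..t, G r) z.1) ?_ ?_ hz
    · exact isClosed_eq (continuous_const.inner continuous_fst)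
        ((continuous_const.inner continuous_snd).neg.add (continuous_const.inner continuous_fst))
    · intro ψ hψ hψc
      rw [← intervalIntegral.integral_interval_sub_left (hWc'.intervalIntegrable 0 t)
        (hWc'.intervalIntegrable 0 s), ← intervalIntegral.integral_interval_sub_left
        (hGc.intervalIntegrable 0 t) (hGc.intervalIntegrable 0 s), inner_sub_left, inner_sub_left,
        inner_sub_left, key' t ht, key' s hs]
      ring
  · intro t ht
    change u t =ᵐ[volume] U' t
    rw [hUU' t ht]
    exact huU t (hsub ht)
  · exact eq_of_inner_testPair_eq hu₁ key0
  · intro s hs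
    change G s = ∫ r in (0 : ℝ)..s, g r • powL2 p (U' (s - r))
    rw [hGe s hs]
    refine intervalIntegral.integral_congr fun r hr => ?_
    rw [uIcc_of_le hs.1] at hr
    have hr' : s - r ∈ Icc 0 S := ⟨by linarith [hr.2], by linarith [hr.1, hs.2]⟩
    simp only [hP, hce _ hr', hUU' _ hr']

/-- Finite speed of propagation for energy solutions. -/
theorem IsEnergySolution.eq_zero_of_support (h : AdmissibleExponent n p)
    (hu : IsEnergySolution g p u₀ u₁ T u) (hu₁ : MemLp u₁ 2 volume)
    (hgpos : ∀ t ∈ timeSpan T, 0 < t → 0 < g t)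
    (hgint : ∀ t ∈ timeSpan T, IntegrableOn g (Ioc 0 t) volume) {R : ℝ}
    (hu₀_supp : ∀ᵐ x ∂volume, R < ‖x‖ → u₀ x = 0)
    (hu₁_supp : ∀ᵐ x ∂volume, R < ‖x‖ → u₁ x = 0) {t : ℝ} (ht : t ∈ timeSpan T) :
    ∀ᵐ x ∂volume, R + t < ‖x‖ → u t x = 0 := by
  obtain ⟨S, htS, hST⟩ := exists_gt_mem_timeSpan ht
  have hS : 0 < S := ht.1.trans_lt htS
  have hsub := Icc_subset_timeSpan hST
  obtain ⟨A, hAU, hAV, hAG⟩ := hu.exists_linearSolution h hu₁ hS hST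
    (hgint S (hsub ⟨hS.le, le_rfl⟩))
  have h0 : ∀ᵐ x, R < ‖x‖ → A.U 0 x = 0 := by
    filter_upwards [hAU 0 ⟨le_rfl, hS.le⟩, hu.2.2.2.1, hu₀_supp] with x h1 h2 h3 hx
    rw [← h1, h2, h3 hx]
  have h1 : ∀ᵐ x, R < ‖x‖ → A.V 0 x = 0 := by
    filter_upwards [hAV, hu₁_supp] with x h1 h3 hx
    rw [h1, h3 hx]
  have h2 := A.eq_zero_of_support h (fun t ht => (hgpos t (hsub ⟨ht.1.le, ht.2⟩) ht.1).le)
    (hgint S (hsub ⟨hS.le, le_rfl⟩)) (fun s hs => hAG s ⟨hs.1, hs.2.le⟩) h0 h1 ht.1 htS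
  filter_upwards [h2, hAU t ⟨ht.1, htS.le⟩] with x h3 h4 hx
  rw [h4, h3 hx]

end Curves

/-! ### Growth of moments -/

/-- For m'' = m + γ with γ ≥ 0, factor the operator: (m + m')' ≥ m + m' gives m + m' ≥ c e^s, and
then (e^s m)' ≥ c e^(2s) is integrated. The auxiliary `y` agrees with `v` on [0, t] and is
differentiable everywhere. -/
theorem exp_growth_of_integral_identity {m v γ : ℝ → ℝ} {c S t : ℝ}
    (hm : ∀ s, HasDerivAt m (v s) s) (hγ : Continuous γ) (hγ0 : ∀ s ∈ Ico 0 S, 0 ≤ γ s)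
    (hid : ∀ s ∈ Ico 0 S, v s - v 0 = ∫ r in (0 : ℝ)..s, (m r + γ r))
    (hm0 : 0 ≤ m 0) (hv0 : c ≤ v 0) (ht : 0 ≤ t) (htS : t < S) :
    c * ((Real.exp t - Real.exp (-t)) / 2) ≤ m t := by
  have hmc : Continuous m := continuous_iff_continuousAt.2 fun s => (hm s).continuousAt
  set y : ℝ → ℝ := fun s => v 0 + ∫ r in (0 : ℝ)..s, (m r + γ r) with hy
  have hyd : ∀ s, HasDerivAt y (m s + γ s) s := fun s =>
    ((hmc.add hγ).integral_hasStrictDerivAt 0 s).hasDerivAt.const_add (v 0)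
  have hyv : ∀ s ∈ Icc 0 t, y s = v s := fun s hs => by
    have := hid s ⟨hs.1, hs.2.trans_lt htS⟩
    simp only [hy]; linarith
  have d1 : ∀ s, HasDerivAt (fun s => Real.exp (-s) * (m s + y s))
      (-Real.exp (-s) * (m s + y s) + Real.exp (-s) * (v s + (m s + γ s))) s := fun s => by
    have h1 := ((hasDerivAt_neg s).exp).mul ((hm s).add (hyd s))
    exact h1.congr_deriv (by simp)
  have mono1 : MonotoneOn (fun s => Real.exp (-s) * (m s + y s)) (Icc 0 t) := by
    refine monotoneOn_of_deriv_nonneg (convex_Icc 0 t)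
      (fun s _ => (d1 s).continuousAt.continuousWithinAt)
      (fun s _ => (d1 s).differentiableAt.differentiableWithinAt) fun s hs => ?_
    rw [interior_Icc] at hs
    rw [(d1 s).deriv, hyv s ⟨hs.1.le, hs.2.le⟩]
    have := mul_nonneg (Real.exp_pos (-s)).le (hγ0 s ⟨hs.1.le, hs.2.trans htS⟩)
    nlinarith
  have low1 : ∀ s ∈ Icc 0 t, c * Real.exp s ≤ m s + v s := by
    intro s hs
    have h1 := mono1 ⟨le_rfl, ht⟩ hs hs.1
    simp only [neg_zero, Real.exp_zero, one_mul] at h1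
    rw [hyv 0 ⟨le_rfl, ht⟩, hyv s hs] at h1
    calc c * Real.exp s ≤ (Real.exp (-s) * (m s + v s)) * Real.exp s := by gcongr; linarith
      _ = m s + v s := by rw [mul_right_comm, ← Real.exp_add]; simp
  have d2 : ∀ s, HasDerivAt (fun s => Real.exp s * m s - c * Real.exp (2 * s) / 2)
      (Real.exp s * m s + Real.exp s * v s - c * (Real.exp (2 * s) * 2) / 2) s := fun s =>
    ((Real.hasDerivAt_exp s).mul (hm s)).sub
      ((((hasDerivAt_id s).const_mul 2).exp.congr_deriv (by simp)).const_mul c |>.div_const 2)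
  have mono2 : MonotoneOn (fun s => Real.exp s * m s - c * Real.exp (2 * s) / 2) (Icc 0 t) := by
    refine monotoneOn_of_deriv_nonneg (convex_Icc 0 t)
      (fun s _ => (d2 s).continuousAt.continuousWithinAt)
      (fun s _ => (d2 s).differentiableAt.differentiableWithinAt) fun s hs => ?_
    rw [interior_Icc] at hs
    rw [(d2 s).deriv]
    have h1 := low1 s ⟨hs.1.le, hs.2.le⟩
    have h2 : Real.exp (2 * s) = Real.exp s * Real.exp s := by rw [← Real.exp_add]; ring_nf
    have := mul_le_mul_of_nonneg_left h1 (Real.exp_pos s).le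
    rw [h2]
    linarith
  have h1 := mono2 ⟨le_rfl, ht⟩ ⟨ht, le_rfl⟩ ht
  simp only [mul_zero, Real.exp_zero, one_mul, mul_one] at h1
  have h2 : c * (Real.exp (2 * t) - 1) / 2 ≤ Real.exp t * m t := by linarith
  refine le_of_mul_le_mul_left (le_trans (le_of_eq ?_) h2) (Real.exp_pos t)
  have h3 : Real.exp (2 * t) = Real.exp t * Real.exp t := by rw [← Real.exp_add]; ring_nf
  have h4 : Real.exp t * Real.exp (-t) = 1 := by rw [← Real.exp_add]; simp
  rw [h3, ← h4]
  ring

/-- On [s + h, t] the history of length h lies in [s, t], so m'' = γ ≥ L ∫_0^h g there. Two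
integrations from s + h, where m and its derivative are nonnegative, give half the square of t - s -
h ≥ h. -/
theorem quadratic_growth_of_integral_identity {m v γ f g : ℝ → ℝ} {S s h t L : ℝ}
    (hm : ∀ s, HasDerivAt m (v s) s) (hγ : Continuous γ)
    (hid : ∀ s ∈ Ico 0 S, v s - v 0 = ∫ r in (0 : ℝ)..s, γ r)
    (hγe : ∀ s ∈ Ico 0 S, γ s = ∫ r in (0 : ℝ)..s, g r * f (s - r))
    (hg0 : ∀ r ∈ Ioc 0 S, 0 ≤ g r) (hgi : IntegrableOn g (Ioc 0 S))
    (hf : ContinuousOn f (Icc 0 S)) (hf0 : ∀ r ∈ Icc 0 S, 0 ≤ f r)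
    (hm0 : 0 ≤ m 0) (hv0 : 0 ≤ v 0) (hs : 0 ≤ s) (hh : 0 < h) (hst : s + 2 * h ≤ t)
    (htS : t < S) (hL : 0 ≤ L) (hfL : ∀ τ ∈ Icc s t, L ≤ f τ) :
    h ^ 2 / 2 * L * (∫ r in (0 : ℝ)..h, g r) ≤ m t := by
  set Γ := ∫ r in (0 : ℝ)..h, g r with hΓ
  have hΓ0 : 0 ≤ Γ := by
    rw [hΓ, intervalIntegral.integral_of_le hh.le]
    exact setIntegral_nonneg measurableSet_Ioc fun r hr => hg0 r ⟨hr.1, by linarith [hr.2]⟩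
  have hγ0 : ∀ r ∈ Ico 0 S, 0 ≤ γ r := by
    intro r hr
    rw [hγe r hr, intervalIntegral.integral_of_le hr.1]
    exact setIntegral_nonneg measurableSet_Ioc fun ρ hρ =>
      mul_nonneg (hg0 ρ ⟨hρ.1, hρ.2.trans hr.2.le⟩)
        (hf0 _ ⟨by linarith [hρ.2], by linarith [hρ.1, hr.2]⟩)
  have hγL : ∀ r ∈ Icc (s + h) t, L * Γ ≤ γ r := by
    intro r hr
    have hr0 : 0 ≤ r := by linarith [hr.1]
    have hrS : r < S := hr.2.trans_lt htS
    have hhr : h ≤ r := by linarith [hr.1]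
    have hgr : IntervalIntegrable g volume 0 r :=
      (intervalIntegrable_iff_integrableOn_Ioc_of_le hr0).2
        (hgi.mono_set (Ioc_subset_Ioc_right hrS.le))
    have hcr : IntervalIntegrable (fun ρ => g ρ * f (r - ρ)) volume 0 r :=
      hgr.mul_continuousOn (hf.comp (by fun_prop) fun ρ hρ => by
        rw [uIcc_of_le hr0] at hρ
        exact ⟨by linarith [hρ.2], by linarith [hρ.1]⟩)
    have hgh : IntervalIntegrable g volume 0 h :=
      hgr.mono_set (by rw [uIcc_of_le hh.le, uIcc_of_le hr0]; exact Icc_subset_Icc_right hhr)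
    have hch : IntervalIntegrable (fun ρ => g ρ * f (r - ρ)) volume 0 h :=
      hcr.mono_set (by rw [uIcc_of_le hh.le, uIcc_of_le hr0]; exact Icc_subset_Icc_right hhr)
    calc L * Γ = ∫ ρ in (0 : ℝ)..h, g ρ * L := by
          rw [intervalIntegral.integral_mul_const, hΓ, mul_comm]
      _ ≤ ∫ ρ in (0 : ℝ)..h, g ρ * f (r - ρ) := by
          refine intervalIntegral.integral_mono_on_of_le_Ioo hh.le (hgh.mul_const L) hch
            fun ρ hρ => ?_
          exact mul_le_mul_of_nonneg_left (hfL _ ⟨by linarith [hρ.2, hr.1], by linarith [hρ.1, hr.2]⟩)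
            (hg0 ρ ⟨hρ.1, by linarith [hρ.2]⟩)
      _ ≤ ∫ ρ in (0 : ℝ)..r, g ρ * f (r - ρ) := by
          refine intervalIntegral.integral_mono_interval le_rfl hh.le hhr ?_ hcr
          rw [Filter.EventuallyLE, ae_restrict_iff' measurableSet_Ioc]
          exact Filter.Eventually.of_forall fun ρ hρ =>
            mul_nonneg (hg0 ρ ⟨hρ.1, hρ.2.trans hrS.le⟩)
              (hf0 _ ⟨by linarith [hρ.2], by linarith [hρ.1]⟩)
      _ = γ r := (hγe r ⟨hr0, hrS⟩).symm
  have hv : ∀ r ∈ Ico 0 S, 0 ≤ v r := by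
    intro r hr
    have h1 := hid r hr
    have h2 : 0 ≤ ∫ ρ in (0 : ℝ)..r, γ ρ := intervalIntegral.integral_nonneg hr.1 fun ρ hρ =>
      hγ0 ρ ⟨hρ.1, hρ.2.trans_lt hr.2⟩
    linarith
  have hvL : ∀ r ∈ Icc (s + h) t, L * Γ * (r - (s + h)) ≤ v r := by
    intro r hr
    have hr0 : 0 ≤ r := by linarith [hr.1]
    have h1 := hid r ⟨hr0, hr.2.trans_lt htS⟩
    have h2 : ∫ ρ in (s + h)..r, L * Γ ≤ ∫ ρ in (s + h)..r, γ ρ :=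
      intervalIntegral.integral_mono_on hr.1 (by simp) (hγ.intervalIntegrable _ _) fun ρ hρ =>
        hγL ρ ⟨hρ.1, hρ.2.trans hr.2⟩
    have h3 : ∫ ρ in (s + h)..r, γ ρ ≤ ∫ ρ in (0 : ℝ)..r, γ ρ := by
      refine intervalIntegral.integral_mono_interval (by linarith) hr.1 le_rfl ?_
        (hγ.intervalIntegrable _ _)
      rw [Filter.EventuallyLE, ae_restrict_iff' measurableSet_Ioc]
      exact Filter.Eventually.of_forall fun ρ hρ => hγ0 ρ ⟨hρ.1.le, by linarith [hρ.2, hr.2]⟩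
    rw [intervalIntegral.integral_const, smul_eq_mul] at h2
    nlinarith
  have mono1 : MonotoneOn m (Icc 0 t) :=
    monotoneOn_of_deriv_nonneg (convex_Icc 0 t)
      (fun r _ => (hm r).continuousAt.continuousWithinAt)
      (fun r _ => (hm r).differentiableAt.differentiableWithinAt) fun r hr => by
        rw [interior_Icc] at hr
        rw [(hm r).deriv]
        exact hv r ⟨hr.1.le, hr.2.trans htS⟩
  have d2 : ∀ r, HasDerivAt (fun r => m r - L * Γ * ((r - (s + h)) ^ 2 / 2))
      (v r - L * Γ * (r - (s + h))) r := fun r => by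
    have h1 := (((hasDerivAt_id r).sub_const (s + h)).pow 2).div_const 2
    refine ((hm r).sub (h1.const_mul (L * Γ))).congr_deriv ?_
    simp
  have mono2 : MonotoneOn (fun r => m r - L * Γ * ((r - (s + h)) ^ 2 / 2)) (Icc (s + h) t) :=
    monotoneOn_of_deriv_nonneg (convex_Icc _ _)
      (fun r _ => (d2 r).continuousAt.continuousWithinAt)
      (fun r _ => (d2 r).differentiableAt.differentiableWithinAt) fun r hr => by
        rw [interior_Icc] at hr
        rw [(d2 r).deriv, sub_nonneg]
        exact hvL r ⟨hr.1.le, hr.2.le⟩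
  have hsht : s + h ≤ t := by linarith
  have h1 := mono1 ⟨le_rfl, by linarith⟩ ⟨by linarith, hsht⟩ (show (0 : ℝ) ≤ s + h by linarith)
  have h2 := mono2 ⟨le_rfl, hsht⟩ ⟨hsht, le_rfl⟩ hsht
  simp only [sub_self] at h2
  have h3 : h ^ 2 ≤ (t - (s + h)) ^ 2 := by
    have : h ≤ t - (s + h) := by linarith
    gcongr
  have h4 := mul_le_mul_of_nonneg_left h3 (mul_nonneg hL hΓ0)
  norm_num at h2
  nlinarith

/-! ### Lower bounds for the nonlinearity -/

/-- Hölder's inequality for the splitting U h = (U h^(1/p)) h^(1/q) on the ball carrying U. It is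
used with exponential h and with h = 1. -/
theorem rpow_abs_integral_mul_le {n : ℕ} {ρ p : ℝ} (hp : 1 < p) {U h : E n → ℝ}
    (hU : AEStronglyMeasurable U volume) (hUp : Integrable fun x => |U x| ^ p)
    (hh : Continuous h) (hh0 : ∀ x, 0 < h x) (hsupp : ∀ᵐ x, ρ < ‖x‖ → U x = 0) :
    |∫ x, U x * h x| ^ p ≤
      (∫ x, |U x| ^ p * h x) * (∫ x in Metric.closedBall (0 : E n) ρ, h x) ^ (p - 1) := by
  have hp0 : 0 < p := by linarith
  set B := Metric.closedBall (0 : E n) ρ with hB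
  have hBc : IsCompact B := isCompact_closedBall _ _
  have hBm : MeasurableSet B := hBc.measurableSet
  have : IsFiniteMeasure ((volume : Measure (E n)).restrict B) :=
    ⟨by rw [Measure.restrict_apply_univ]; exact hBc.measure_lt_top⟩
  set q := p / (p - 1) with hq
  have hpq : p.HolderConjugate q := Real.HolderConjugate.conjExponent hp
  have hq0 : 0 < q := hpq.symm.pos
  have hsupp' : ∀ᵐ x, x ∉ B → U x = 0 := by
    filter_upwards [hsupp] with x hx hxB
    refine hx (not_le.1 fun h => hxB ?_)
    rwa [hB, mem_closedBall_zero_iff]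
  have e1 : ∫ x, U x * h x = ∫ x in B, U x * h x := by
    refine (setIntegral_eq_integral_of_ae_compl_eq_zero ?_).symm
    filter_upwards [hsupp'] with x hx hxB
    rw [hx hxB, zero_mul]
  have e2 : ∫ x, |U x| ^ p * h x = ∫ x in B, |U x| ^ p * h x := by
    refine (setIntegral_eq_integral_of_ae_compl_eq_zero ?_).symm
    filter_upwards [hsupp'] with x hx hxB
    rw [hx hxB, abs_zero, Real.zero_rpow hp0.ne', zero_mul]
  have pf : ∀ x, (|U x| * h x ^ (1 / p)) ^ p = |U x| ^ p * h x := fun x => by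
    rw [Real.mul_rpow (abs_nonneg _) (Real.rpow_nonneg (hh0 x).le _), ← Real.rpow_mul (hh0 x).le,
      one_div_mul_cancel hp0.ne', Real.rpow_one]
  have pg : ∀ x, (h x ^ (1 / q)) ^ q = h x := fun x => by
    rw [← Real.rpow_mul (hh0 x).le, one_div_mul_cancel hq0.ne', Real.rpow_one]
  have hrpc : ∀ a : ℝ, Continuous fun x => h x ^ a := fun a =>
    hh.rpow_const fun x => Or.inl (hh0 x).ne'
  have mf : MemLp (fun x => |U x| * h x ^ (1 / p)) (ENNReal.ofReal p) (volume.restrict B) := by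
    have hm : AEStronglyMeasurable (fun x => |U x| * h x ^ (1 / p)) (volume.restrict B) :=
      (hU.aemeasurable.abs.aestronglyMeasurable.mul (hrpc _).aestronglyMeasurable).restrict
    rw [← integrable_norm_rpow_iff hm (by simpa using hp0) ENNReal.ofReal_ne_top,
      ENNReal.toReal_ofReal hp0.le]
    refine (hUp.integrableOn.mul_continuousOn hh.continuousOn hBc).congr ?_
    refine Filter.Eventually.of_forall fun x => ?_
    simp only
    rw [Real.norm_of_nonneg (by have := Real.rpow_nonneg (hh0 x).le (1 / p); positivity), pf]
  have mg : MemLp (fun x => h x ^ (1 / q)) (ENNReal.ofReal q) (volume.restrict B) := by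
    have hm : AEStronglyMeasurable (fun x => h x ^ (1 / q)) (volume.restrict B) :=
      (hrpc _).aestronglyMeasurable
    rw [← integrable_norm_rpow_iff hm (by simpa using hq0) ENNReal.ofReal_ne_top,
      ENNReal.toReal_ofReal hq0.le]
    refine (hh.continuousOn.integrableOn_compact hBc).congr ?_
    refine Filter.Eventually.of_forall fun x => ?_
    simp only
    rw [Real.norm_of_nonneg (Real.rpow_nonneg (hh0 x).le (1 / q)), pg]
  have hol := integral_mul_le_Lp_mul_Lq_of_nonneg hpq
    (μ := volume.restrict B) (f := fun x => |U x| * h x ^ (1 / p)) (g := fun x => h x ^ (1 / q))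
    (Filter.Eventually.of_forall fun x => mul_nonneg (abs_nonneg _) (Real.rpow_nonneg (hh0 x).le _))
    (Filter.Eventually.of_forall fun x => Real.rpow_nonneg (hh0 x).le _) mf mg
  simp only [pf, pg] at hol
  have e3 : ∀ x, |U x| * h x ^ (1 / p) * h x ^ (1 / q) = |U x| * h x := fun x => by
    rw [mul_assoc, ← Real.rpow_add (hh0 x), hpq.one_div_add_one_div, div_one, Real.rpow_one]
  simp only [e3] at hol
  have h1 : |∫ x, U x * h x| ≤ ∫ x in B, |U x| * h x := by
    rw [e1]
    refine (abs_integral_le_integral_abs).trans (le_of_eq ?_)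
    congr 1; funext x
    rw [abs_mul, abs_of_pos (hh0 x)]
  have i1 : 0 ≤ ∫ x in B, |U x| ^ p * h x := integral_nonneg fun x => by
    have := (hh0 x).le; positivity
  have i2 : 0 ≤ ∫ x in B, h x := integral_nonneg fun x => (hh0 x).le
  calc |∫ x, U x * h x| ^ p
      ≤ ((∫ x in B, |U x| ^ p * h x) ^ (1 / p) * (∫ x in B, h x) ^ (1 / q)) ^ p := by
        gcongr
        exact h1.trans hol
    _ = _ := by
        rw [Real.mul_rpow (by positivity) (by positivity), ← Real.rpow_mul i1, ← Real.rpow_mul i2,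
          one_div_mul_cancel hp0.ne', Real.rpow_one, e2]
        congr 2
        rw [hq]
        field_simp

/-- A function whose exponential moments in all directions are bounded below has large mass. -/
theorem mass_lower_bound_of_exp_moments {m : ℕ} {R t κ : ℝ} (hR : 0 ≤ R) (ht : 0 < t)
    {F : E (m + 1) → ℝ} (hF : Integrable F) (hF0 : ∀ x, 0 ≤ F x)
    (hsupp : ∀ᵐ x, R + t < ‖x‖ → F x = 0)
    (hκ : ∀ w : E (m + 1), ‖w‖ = 1 → κ ≤ ∫ x, F x * Real.exp (inner ℝ w x - t)) :
    κ * (volume (Metric.closedBall (0 : E (m + 1)) 1)).toReal ≤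
      2 * Real.exp R * Real.sqrt (Real.pi / (t / 4)) ^ m * ∫ x, F x := by
  set B := Metric.closedBall (0 : E (m + 1)) 1 with hB
  have hBm : MeasurableSet B := measurableSet_closedBall
  have : IsFiniteMeasure ((volume : Measure (E (m + 1))).restrict B) :=
    ⟨by rw [Measure.restrict_apply_univ]; exact (isCompact_closedBall _ _).measure_lt_top⟩
  have hdir : Measurable fun ξ : E (m + 1) => ‖ξ‖⁻¹ • ξ := by fun_prop
  have hnorm : ∀ ξ : E (m + 1), ‖‖ξ‖⁻¹ • ξ‖ ≤ 1 := fun ξ => by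
    rw [norm_smul, norm_inv, norm_norm]
    exact inv_mul_le_one
  have hint : Integrable (uncurry fun (ξ x : E (m + 1)) =>
      F x * Real.exp (inner ℝ (‖ξ‖⁻¹ • ξ) x - t)) ((volume.restrict B).prod volume) := by
    have hm : AEStronglyMeasurable (uncurry fun (ξ x : E (m + 1)) =>
        F x * Real.exp (inner ℝ (‖ξ‖⁻¹ • ξ) x - t)) ((volume.restrict B).prod volume) := by
      refine hF.aestronglyMeasurable.comp_snd.mul ?_
      refine Measurable.aestronglyMeasurable ?_
      exact (((hdir.comp measurable_fst).inner measurable_snd).sub_const t).exp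
    refine Integrable.mono' (g := fun z => Real.exp R * F z.2) ((hF.comp_snd _).const_mul _) hm ?_
    have hs : ∀ᵐ z ∂((volume.restrict B).prod (volume : Measure (E (m + 1)))),
        R + t < ‖z.2‖ → F z.2 = 0 := Measure.quasiMeasurePreserving_snd.ae hsupp
    filter_upwards [hs] with z hz
    simp only [uncurry]
    rw [Real.norm_of_nonneg (mul_nonneg (hF0 _) (Real.exp_pos _).le), mul_comm]
    by_cases hx : R + t < ‖z.2‖
    · simp [hz hx]
    · refine mul_le_mul_of_nonneg_right (Real.exp_le_exp.2 ?_) (hF0 _)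
      have h1 := real_inner_le_norm (‖z.1‖⁻¹ • z.1) z.2
      have h2 := mul_le_mul_of_nonneg_right (hnorm z.1) (norm_nonneg z.2)
      linarith [not_lt.1 hx]
  have hswap := integral_integral_swap hint
  -- Every nonzero ξ gives a unit direction ξ/|ξ|, so the moment bound is integrated over the unit
  -- ball; the origin is a null set.
  have low : κ * (volume B).toReal ≤
      ∫ ξ in B, ∫ x, F x * Real.exp (inner ℝ (‖ξ‖⁻¹ • ξ) x - t) := by
    have e : κ * (volume B).toReal = ∫ ξ in B, κ := by
      rw [setIntegral_const, smul_eq_mul, mul_comm]; rfl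
    rw [e]
    refine integral_mono_ae (integrable_const _) hint.integral_prod_left ?_
    filter_upwards [ae_restrict_of_ae (compl_mem_ae_iff.2 (measure_singleton (0 : E (m + 1))))]
      with ξ hξ
    refine hκ _ ?_
    rw [norm_smul, norm_inv, norm_norm, inv_mul_cancel₀]
    exact norm_ne_zero_iff.2 hξ
  -- After the exchange of integrals the inner integral no longer involves F and is bounded by the
  -- directional average.
  have up : ∫ x, ∫ ξ in B, F x * Real.exp (inner ℝ (‖ξ‖⁻¹ • ξ) x - t) ≤
      ∫ x, 2 * Real.exp R * Real.sqrt (Real.pi / (t / 4)) ^ m * F x := by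
    refine integral_mono_ae hint.integral_prod_right (hF.const_mul _) ?_
    filter_upwards [hsupp] with x hx
    rw [integral_const_mul]
    by_cases hxt : R + t < ‖x‖
    · simp [hx hxt]
    · rw [mul_comm]
      exact mul_le_mul_of_nonneg_right
        (integral_exp_inner_direction_le hR ht (not_lt.1 hxt)) (hF0 x)
  rw [integral_const_mul] at up
  exact low.trans ((le_of_eq hswap).trans up)

/-! ### Exponential moments of solutions -/

section ExpMoments

variable {n : ℕ} {ρ : ℝ} (w : E n)

/-- The function `exp (w · x)`, cut off outside the ball of radius `ρ`. -/
def expTest (ρ : ℝ) (x : E n) : ℝ := (cutoff n ρ).toFun x * Real.exp (inner ℝ w x)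

theorem contDiff_expTest : ContDiff ℝ ∞ (expTest w ρ) :=
  (cutoff n ρ).contDiff.mul (contDiff_const.inner ℝ contDiff_id).exp

theorem hasCompactSupport_expTest (hρ : 0 < ρ) : HasCompactSupport (expTest w ρ) :=
  (hasCompactSupport_cutoff hρ).mul_right

theorem expTest_nonneg (x : E n) : 0 ≤ expTest w ρ x :=
  mul_nonneg (cutoff_nonneg ρ x) (Real.exp_pos _).le

theorem expTest_eq (hρ : 0 < ρ) {x : E n} (hx : ‖x‖ ≤ ρ) :
    expTest w ρ x = Real.exp (inner ℝ w x) := by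
  rw [expTest, cutoff_eq_one hρ hx, one_mul]

theorem gradient_expTest (hρ : 0 < ρ) {x : E n} (hx : ‖x‖ < ρ) :
    ∇ (expTest w ρ) x = expTest w ρ x • w := by
  have h1 : HasFDerivAt (fun x : E n => Real.exp (inner ℝ w x))
      (Real.exp (inner ℝ w x) • innerSL ℝ w) x :=
    (innerSL ℝ w).hasFDerivAt.exp
  have h2 : expTest w ρ =ᶠ[nhds x] fun x => Real.exp (inner ℝ w x) := by
    filter_upwards [(isOpen_lt continuous_norm continuous_const).mem_nhds hx] with y hy
    exact expTest_eq w hρ (le_of_lt hy)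
  refine ext_inner_left ℝ fun v => ?_
  rw [expTest_eq w hρ hx.le, real_inner_smul_right, real_inner_comm, gradient,
    InnerProductSpace.toDual_symm_apply, h2.fderiv_eq, h1.fderiv]
  simp [real_inner_comm]

/-- The pair of the cut off exponential and its gradient. -/
def expPair (hρ : 0 < ρ) : L2 n × L2V n :=
  testPair (expTest w ρ) (contDiff_expTest w) (hasCompactSupport_expTest w hρ)

theorem inner_expPair_fst (hρ : 0 < ρ) {f : E n → ℝ} {F : L2 n} (hf : f =ᵐ[volume] F)
    (hF : ∀ᵐ x, ρ < ‖x‖ → F x = 0) :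
    inner ℝ F (expPair w hρ).1 = ∫ x, f x * Real.exp (inner ℝ w x) := by
  rw [expPair, inner_testPair_fst _ _ hf]
  refine integral_congr_ae ?_
  filter_upwards [hf, hF] with x h1 h2
  by_cases hx : ρ < ‖x‖
  · rw [h1, h2 hx, zero_mul, zero_mul]
  · rw [expTest_eq w hρ (not_lt.1 hx)]

theorem inner_expPair_nonneg (hρ : 0 < ρ) {F : L2 n} (hF : 0 ≤ᵐ[volume] F) :
    0 ≤ inner ℝ F (expPair w hρ).1 := by
  rw [expPair, inner_testPair_fst _ _ (Filter.EventuallyEq.refl _ F)]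
  refine integral_nonneg_of_ae ?_
  filter_upwards [hF] with x hx
  exact mul_nonneg hx (expTest_nonneg w x)

/-- This is integration by parts with Δ exp(w·x) = |w|² exp(w·x). The condition r < ρ keeps the
region where the cutoff varies away from the support of z. -/
theorem inner_expPair_snd (hρ : 0 < ρ) {r : ℝ} (hr : r < ρ) {z : L2 n × L2V n}
    (hz : z ∈ weakPairs n) (hz0 : ∀ᵐ x, r < ‖x‖ → z.1 x = 0) :
    inner ℝ z.2 (expPair w hρ).2 = -(‖w‖ ^ 2 * inner ℝ z.1 (expPair w hρ).1) := by
  have hz' := mem_weakPairs.1 hz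
  have hW : ∀ᵐ x, r < ‖x‖ → z.2 x = 0 :=
    hz'.eq_zero_on (Lp.memLp _) (O := {x : E n | r < ‖x‖})
      (isOpen_lt continuous_const continuous_norm) hz0
  have hT := memLp_of_smooth (q := 2) (contDiff_expTest w (ρ := ρ)) (hasCompactSupport_expTest w hρ)
  have hi : Integrable fun x => expTest w ρ x • z.2 x :=
    integrable_smul_of_memLp_two hT (Lp.memLp z.2)
  have hi' : Integrable fun x => z.1 x * expTest w ρ x :=
    (Lp.memLp z.1).integrable_mul hT
  have e1 : inner ℝ z.2 (expPair w hρ).2 = ∫ x, inner ℝ w (expTest w ρ x • z.2 x) := by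
    rw [expPair, inner_testPair_snd]
    refine integral_congr_ae ?_
    filter_upwards [hW] with x hx
    by_cases h : r < ‖x‖
    · simp [hx h]
    · rw [gradient_expTest w hρ ((not_lt.1 h).trans_lt hr), real_inner_smul_right,
        real_inner_smul_right, real_inner_comm]
  have e2 : ∫ x, z.1 x • ∇ (expTest w ρ) x = (∫ x, z.1 x * expTest w ρ x) • w := by
    rw [← integral_smul_const]
    refine integral_congr_ae ?_
    filter_upwards [hz0] with x hx
    by_cases h : r < ‖x‖
    · simp [hx h]
    · rw [gradient_expTest w hρ ((not_lt.1 h).trans_lt hr), smul_smul]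
  have e3 := hz' _ (contDiff_expTest w (ρ := ρ)) (hasCompactSupport_expTest w hρ)
  rw [e1, integral_inner hi, ← neg_eq_iff_eq_neg.2 e3, e2, inner_neg_right, real_inner_smul_right,
    real_inner_self_eq_norm_sq, expPair, inner_testPair_fst _ _ (Filter.EventuallyEq.refl _ z.1)]
  ring

theorem integrable_mul_of_support {F h : E n → ℝ} (hF : MemLp F 2 volume)
    (hF0 : ∀ᵐ x, ρ < ‖x‖ → F x = 0) (hh : Continuous h) : Integrable fun x => F x * h x := by
  have hc : IsCompact (Metric.closedBall (0 : E n) ρ) := isCompact_closedBall _ _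
  have : IsFiniteMeasure ((volume : Measure (E n)).restrict (Metric.closedBall (0 : E n) ρ)) :=
    ⟨by rw [Measure.restrict_apply_univ]; exact hc.measure_lt_top⟩
  have h1 : IntegrableOn F (Metric.closedBall (0 : E n) ρ) :=
    (hF.restrict _).integrable (by norm_num)
  refine (h1.mul_continuousOn hh.continuousOn hc).integrable_of_ae_notMem_eq_zero ?_
  filter_upwards [hF0] with x hx hxB
  rw [hx (not_le.1 fun h => hxB (mem_closedBall_zero_iff.2 h)), zero_mul]

end ExpMoments

namespace LinearSolution

variable {n : ℕ} {S : ℝ} (A : LinearSolution n S)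

theorem hasDerivAt_inner (z : L2 n) (t : ℝ) :
    HasDerivAt (fun t => inner ℝ (A.U t) z) (inner ℝ (A.V t) z) t := by
  have := (A.hasDerivAt t).inner ℝ (hasDerivAt_const t z)
  simpa using this

/-- The cutoff radius R + S exceeds R + t for t < S, so the truncated exponential acts as exp(w·x)
throughout. The case w = 0 gives the equation for the mean. -/
theorem expMoment_identity {R : ℝ} (hρ : 0 < R + S)
    (hsupp : ∀ t ∈ Ico 0 S, ∀ᵐ x, R + t < ‖x‖ → A.U t x = 0) (w : E n) {t : ℝ} (ht : t ∈ Ico 0 S) :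
    inner ℝ (A.V t) (expPair w hρ).1 - inner ℝ (A.V 0) (expPair w hρ).1 =
      ∫ r in (0 : ℝ)..t, (‖w‖ ^ 2 * inner ℝ (A.U r) (expPair w hρ).1 +
        inner ℝ (A.G r) (expPair w hρ).1) := by
  have hS : 0 ≤ S := ht.1.trans ht.2.le
  have h1 := A.weak 0 ⟨le_rfl, hS⟩ t ⟨ht.1, ht.2.le⟩ (expPair w hρ) (testPair_mem _ _)
  rw [inner_sub_left, inner_intervalIntegral (A.continuous_W.intervalIntegrable _ _),
    inner_intervalIntegral (A.continuous_G.intervalIntegrable _ _)] at h1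
  have h2 : ∫ r in (0 : ℝ)..t, inner ℝ (A.W r) (expPair w hρ).2 =
      ∫ r in (0 : ℝ)..t, -(‖w‖ ^ 2 * inner ℝ (A.U r) (expPair w hρ).1) := by
    refine intervalIntegral.integral_congr fun r hr => ?_
    rw [uIcc_of_le ht.1] at hr
    have hr' : r ∈ Ico 0 S := ⟨hr.1, hr.2.trans_lt ht.2⟩
    exact inner_expPair_snd w hρ (r := R + r) (by linarith [hr'.2]) (z := (A.U r, A.W r))
      (A.weakPair r ⟨hr'.1, hr'.2.le⟩) (hsupp r hr')
  rw [h1, h2, intervalIntegral.integral_neg, neg_neg, intervalIntegral.integral_add]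
  · exact (continuous_const.mul (A.continuous_U.inner continuous_const)).intervalIntegrable _ _
  · exact (A.continuous_G.inner continuous_const).intervalIntegrable _ _

theorem inner_source {p : ℝ} (h : AdmissibleExponent n p) {g : ℝ → ℝ}
    (hgi : IntegrableOn g (Ioc 0 S))
    (hG : ∀ s ∈ Icc 0 S, A.G s = ∫ r in (0 : ℝ)..s, g r • powL2 p (A.U (s - r))) (z : L2 n)
    {s : ℝ} (hs : s ∈ Icc 0 S) :
    inner ℝ (A.G s) z = ∫ r in (0 : ℝ)..s, g r * inner ℝ (powL2 p (A.U (s - r))) z := by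
  have hgs : IntervalIntegrable g volume 0 s :=
    (intervalIntegrable_iff_integrableOn_Ioc_of_le hs.1).2
      (hgi.mono_set (Ioc_subset_Ioc_right hs.2))
  rw [hG s hs, inner_intervalIntegral (X := fun r => g r • powL2 p (A.U (s - r)))]
  · simp only [real_inner_smul_left]
  · refine hgs.smul_continuousOn ((A.continuousOn_powL2 h).comp (by fun_prop) fun r hr => ?_)
    rw [uIcc_of_le hs.1] at hr
    exact ⟨by linarith [hr.2], by linarith [hr.1, hs.2]⟩

theorem inner_pow_nonneg {p : ℝ} (h : AdmissibleExponent n p) {ρ : ℝ} (hρ : 0 < ρ) (w : E n) {t : ℝ}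
    (ht : t ∈ Icc 0 S) : 0 ≤ inner ℝ (powL2 p (A.U t)) (expPair w hρ).1 := by
  refine inner_expPair_nonneg w hρ ?_
  filter_upwards [h.coeFn_powL2 (A.weakPair t ht)] with x hx
  rw [hx]
  exact Real.rpow_nonneg (abs_nonneg _) _

theorem inner_source_nonneg {p : ℝ} (h : AdmissibleExponent n p) {g : ℝ → ℝ}
    (hg0 : ∀ t ∈ Ioc 0 S, 0 ≤ g t) (hgi : IntegrableOn g (Ioc 0 S))
    (hG : ∀ s ∈ Icc 0 S, A.G s = ∫ r in (0 : ℝ)..s, g r • powL2 p (A.U (s - r))) {ρ : ℝ}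
    (hρ : 0 < ρ) (w : E n) {s : ℝ} (hs : s ∈ Icc 0 S) :
    0 ≤ inner ℝ (A.G s) (expPair w hρ).1 := by
  rw [A.inner_source h hgi hG _ hs, intervalIntegral.integral_of_le hs.1]
  exact setIntegral_nonneg measurableSet_Ioc fun r hr =>
    mul_nonneg (hg0 r ⟨hr.1, hr.2.trans hs.2⟩)
      (A.inner_pow_nonneg h hρ w ⟨by linarith [hr.2], by linarith [hr.1, hs.2]⟩)

end LinearSolution

/-! ### Nonexistence of global energy solutions -/

section Global

variable {n : ℕ} {g : ℝ → ℝ} {p R : ℝ} {u₀ u₁ : E n → ℝ} {u : ℝ → E n → ℝ}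

theorem IsEnergySolution.exists_supported_linearSolution (h : AdmissibleExponent n p)
    (hu : IsEnergySolution g p u₀ u₁ ⊤ u) (hu₁ : MemLp u₁ 2 volume)
    (hgpos : ∀ t, 0 < t → 0 < g t) (hgint : ∀ t, 0 ≤ t → IntegrableOn g (Ioc 0 t) volume)
    (hu₀_supp : ∀ᵐ x ∂volume, R < ‖x‖ → u₀ x = 0)
    (hu₁_supp : ∀ᵐ x ∂volume, R < ‖x‖ → u₁ x = 0) {S : ℝ} (hS : 0 < S) :
    ∃ A : LinearSolution n S, (∀ t ∈ Icc 0 S, u t =ᵐ[volume] A.U t) ∧ A.V 0 =ᵐ[volume] u₁ ∧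
      (∀ s ∈ Icc 0 S, A.G s = ∫ r in (0 : ℝ)..s, g r • powL2 p (A.U (s - r))) ∧
      ∀ t ∈ Icc 0 S, ∀ᵐ x, R + t < ‖x‖ → A.U t x = 0 := by
  obtain ⟨A, h1, h2, h3⟩ := hu.exists_linearSolution h hu₁ hS ENNReal.ofReal_lt_top
    (hgint S hS.le)
  refine ⟨A, h1, h2, h3, fun t ht => ?_⟩
  filter_upwards [hu.eq_zero_of_support h hu₁ (fun t _ => hgpos t)
    (fun t ht => hgint t ht.1) hu₀_supp hu₁_supp (t := t) ⟨ht.1, ENNReal.ofReal_lt_top⟩, h1 t ht]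
    with x h4 h5 hx
  rw [← h5, h4 hx]

/-- Exponential moments of a global solution grow exponentially. -/
theorem IsEnergySolution.exp_moment_lower_bound (h : AdmissibleExponent n p)
    (hu : IsEnergySolution g p u₀ u₁ ⊤ u) (hu₁ : MemLp u₁ 2 volume)
    (hgpos : ∀ t, 0 < t → 0 < g t) (hgint : ∀ t, 0 ≤ t → IntegrableOn g (Ioc 0 t) volume)
    (hR : 0 < R) (hu₀_nonneg : 0 ≤ᵐ[volume] u₀) (hu₁_nonneg : 0 ≤ᵐ[volume] u₁)
    (hu₀_supp : ∀ᵐ x ∂volume, R < ‖x‖ → u₀ x = 0)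
    (hu₁_supp : ∀ᵐ x ∂volume, R < ‖x‖ → u₁ x = 0) {w : E n} (hw : ‖w‖ = 1) {t : ℝ} (ht : 0 ≤ t) :
    Real.exp (-R) * (∫ x, u₁ x) * ((Real.exp t - Real.exp (-t)) / 2) ≤
      ∫ x, u t x * Real.exp (inner ℝ w x) := by
  have hS : 0 < t + 1 := by linarith
  obtain ⟨A, hAU, hAV, hAG, hAs⟩ := hu.exists_supported_linearSolution h hu₁ hgpos hgint
    hu₀_supp hu₁_supp hS
  have hρ : 0 < R + (t + 1) := by linarith
  have ht' : t ∈ Ico 0 (t + 1) := ⟨ht, by linarith⟩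
  have hAs' : ∀ s ∈ Ico 0 (t + 1), ∀ᵐ x, R + s < ‖x‖ → A.U s x = 0 := fun s hs =>
    hAs s ⟨hs.1, hs.2.le⟩
  -- On the support of u₁ one has w·x ≥ -R because |w| = 1.
  have hV0 : Real.exp (-R) * (∫ x, u₁ x) ≤ inner ℝ (A.V 0) (expPair w hρ).1 := by
    rw [inner_expPair_fst w hρ hAV.symm (by
      filter_upwards [hAV, hu₁_supp] with x h1 h2 hx
      rw [h1, h2 (by linarith)]), ← integral_const_mul]
    refine integral_mono_ae ?_ (integrable_mul_of_support hu₁ hu₁_supp (by fun_prop)) ?_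
    · have := (integrable_mul_of_support hu₁ hu₁_supp (h := fun _ => 1) continuous_const)
      simp only [mul_one] at this
      exact this.const_mul _
    · filter_upwards [hu₁_nonneg, hu₁_supp] with x h1 h2
      by_cases hx : R < ‖x‖
      · simp [h2 hx]
      · rw [mul_comm]
        refine mul_le_mul_of_nonneg_left (Real.exp_le_exp.2 ?_) h1
        have h3 := (abs_le.1 (abs_real_inner_le_norm w x)).1
        rw [hw, one_mul] at h3
        linarith [not_lt.1 hx]
  have hU0 : 0 ≤ inner ℝ (A.U 0) (expPair w hρ).1 := by
    refine inner_expPair_nonneg w hρ ?_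
    filter_upwards [hAU 0 ⟨le_rfl, hS.le⟩, hu.2.2.2.1, hu₀_nonneg] with x h1 h2 h3
    rw [← h1, h2]
    exact h3
  have key := exp_growth_of_integral_identity (S := t + 1) (t := t)
    (m := fun s => inner ℝ (A.U s) (expPair w hρ).1)
    (v := fun s => inner ℝ (A.V s) (expPair w hρ).1)
    (γ := fun s => inner ℝ (A.G s) (expPair w hρ).1) (A.hasDerivAt_inner _)
    (A.continuous_G.inner continuous_const)
    (fun s hs => A.inner_source_nonneg h (fun r hr => (hgpos r hr.1).le) (hgint _ hS.le) hAG hρ w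
      ⟨hs.1, hs.2.le⟩)
    (fun s hs => by
      simpa only [hw, one_pow, one_mul] using A.expMoment_identity hρ hAs' w hs)
    hU0 hV0 ht ht'.2
  refine key.trans (le_of_eq ?_)
  refine inner_expPair_fst w hρ (hAU t ⟨ht, ht'.2.le⟩) ?_
  filter_upwards [hAs' t ht'] with x hx hx'
  exact hx (by linarith)

/-- The mean of a global solution is bounded below by the history of its nonlinearity. -/
theorem IsEnergySolution.mean_lower_bound (h : AdmissibleExponent n p)
    (hu : IsEnergySolution g p u₀ u₁ ⊤ u) (hu₁ : MemLp u₁ 2 volume)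
    (hgpos : ∀ t, 0 < t → 0 < g t) (hgint : ∀ t, 0 ≤ t → IntegrableOn g (Ioc 0 t) volume)
    (hR : 0 < R) (hu₀_nonneg : 0 ≤ᵐ[volume] u₀) (hu₁_nonneg : 0 ≤ᵐ[volume] u₁)
    (hu₀_supp : ∀ᵐ x ∂volume, R < ‖x‖ → u₀ x = 0)
    (hu₁_supp : ∀ᵐ x ∂volume, R < ‖x‖ → u₁ x = 0) {s k t L : ℝ} (hs : 0 ≤ s) (hk : 0 < k)
    (hst : s + 2 * k ≤ t) (hL : 0 ≤ L) (hfL : ∀ τ ∈ Icc s t, L ≤ ∫ x, |u τ x| ^ p) :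
    k ^ 2 / 2 * L * (∫ r in (0 : ℝ)..k, g r) ≤ ∫ x, u t x := by
  have ht : 0 ≤ t := by linarith
  have hS : 0 < t + 1 := by linarith
  obtain ⟨A, hAU, hAV, hAG, hAs⟩ := hu.exists_supported_linearSolution h hu₁ hgpos hgint
    hu₀_supp hu₁_supp hS
  have hρ : 0 < R + (t + 1) := by linarith
  have ht' : t ∈ Ico 0 (t + 1) := ⟨ht, by linarith⟩
  have hAs' : ∀ s ∈ Ico 0 (t + 1), ∀ᵐ x, R + s < ‖x‖ → A.U s x = 0 := fun s hs =>
    hAs s ⟨hs.1, hs.2.le⟩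
  have hp0 : p ≠ 0 := by linarith [h.one_lt]
  have hg0 : ∀ r ∈ Ioc 0 (t + 1), 0 ≤ g r := fun r hr => (hgpos r hr.1).le
  -- The mean is the moment with w = 0, for which the Laplacian term vanishes.
  have key := quadratic_growth_of_integral_identity (S := t + 1) (t := t) (s := s) (h := k) (L := L)
    (m := fun s => inner ℝ (A.U s) (expPair 0 hρ).1)
    (v := fun s => inner ℝ (A.V s) (expPair 0 hρ).1)
    (γ := fun s => inner ℝ (A.G s) (expPair 0 hρ).1)
    (f := fun s => inner ℝ (powL2 p (A.U s)) (expPair 0 hρ).1) (g := g) (A.hasDerivAt_inner _)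
    (A.continuous_G.inner continuous_const)
    (fun s hs => by
      have h1 := A.expMoment_identity hρ hAs' 0 hs
      simpa only [norm_zero, ne_eq, OfNat.ofNat_ne_zero, not_false_eq_true, zero_pow, zero_mul,
        zero_add] using h1)
    (fun s hs => A.inner_source h (hgint _ hS.le) hAG _ ⟨hs.1, hs.2.le⟩)
    hg0 (hgint _ hS.le)
    ((A.continuousOn_powL2 h).inner continuousOn_const)
    (fun r hr => A.inner_pow_nonneg h hρ 0 hr) ?_ ?_ hs hk hst ht'.2 hL ?_
  · refine key.trans (le_of_eq ?_)
    rw [inner_expPair_fst 0 hρ (hAU t ⟨ht, ht'.2.le⟩)]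
    · simp
    · filter_upwards [hAs' t ht'] with x hx hx'
      exact hx (by linarith)
  · refine inner_expPair_nonneg 0 hρ ?_
    filter_upwards [hAU 0 ⟨le_rfl, hS.le⟩, hu.2.2.2.1, hu₀_nonneg] with x h1 h2 h3
    rw [← h1, h2]
    exact h3
  · refine inner_expPair_nonneg 0 hρ ?_
    filter_upwards [hAV, hu₁_nonneg] with x h1 h2
    rw [h1]
    exact h2
  · intro τ hτ
    have hτ' : τ ∈ Icc 0 (t + 1) := ⟨hs.trans hτ.1, by linarith [hτ.2]⟩
    refine (hfL τ hτ).trans (le_of_eq ?_)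
    have e : (fun x => |u τ x| ^ p) =ᵐ[volume] powL2 p (A.U τ) := by
      filter_upwards [h.coeFn_powL2 (A.weakPair τ hτ'), hAU τ hτ'] with x h1 h2
      rw [h1, h2]
    rw [inner_expPair_fst 0 hρ e]
    · simp
    · filter_upwards [h.coeFn_powL2 (A.weakPair τ hτ'), hAs τ hτ'] with x h1 h2 hx
      rw [h1, h2 (by linarith [hτ.2]), abs_zero, Real.zero_rpow hp0]

theorem IsEnergySolution.slice_regularity (h : AdmissibleExponent n p)
    (hu : IsEnergySolution g p u₀ u₁ ⊤ u) (hu₁ : MemLp u₁ 2 volume)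
    (hgpos : ∀ t, 0 < t → 0 < g t) (hgint : ∀ t, 0 ≤ t → IntegrableOn g (Ioc 0 t) volume)
    (hu₀_supp : ∀ᵐ x ∂volume, R < ‖x‖ → u₀ x = 0)
    (hu₁_supp : ∀ᵐ x ∂volume, R < ‖x‖ → u₁ x = 0) {t : ℝ} (ht : 0 ≤ t) :
    AEStronglyMeasurable (u t) volume ∧ Integrable (fun x => |u t x| ^ p) ∧
      ∀ᵐ x, R + t < ‖x‖ → u t x = 0 := by
  obtain ⟨A, hAU, -, -, hAs⟩ := hu.exists_supported_linearSolution h hu₁ hgpos hgint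
    hu₀_supp hu₁_supp (show 0 < t + 1 by linarith)
  have ht' : t ∈ Icc 0 (t + 1) := ⟨ht, by linarith⟩
  have hsupp : ∀ᵐ x, R + t < ‖x‖ → u t x = 0 := by
    filter_upwards [hAs t ht', hAU t ht'] with x h1 h2 hx
    rw [h2, h1 hx]
  refine ⟨(Lp.aestronglyMeasurable (A.U t)).congr (hAU t ht').symm, ?_, hsupp⟩
  have h1 : MemLp (fun x => |u t x| ^ p) 2 volume := by
    refine (memLp_congr_ae ?_).1 (h.memLp_rpow (A.weakPair t ht'))
    filter_upwards [hAU t ht'] with x hx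
    rw [hx]
  have h2 := integrable_mul_of_support (ρ := R + t) h1 (by
    filter_upwards [hsupp] with x hx hx'
    rw [hx hx', abs_zero, Real.zero_rpow (by linarith [h.one_lt])])
    (h := fun _ => 1) continuous_const
  simpa only [mul_one] using h2

end Global

/-! ### Power lower bounds for the nonlinearity and the contradiction. -/

section Nonexistence

variable {m : ℕ} {g : ℝ → ℝ} {p R : ℝ} {u₀ u₁ : E (m + 1) → ℝ} {u : ℝ → E (m + 1) → ℝ}

/-- Each direction w gives ∫ |u|^p e^(w·x - t) ≥ d t^(-m(p-1)/2). Averaging over w gains t^(m/2),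
and the exponents add up to m(1 - p/2). -/
theorem IsEnergySolution.exists_nonlinearity_lower_bound (h : AdmissibleExponent (m + 1) p)
    (hu : IsEnergySolution g p u₀ u₁ ⊤ u) (hu₁ : MemLp u₁ 2 volume)
    (hgpos : ∀ t, 0 < t → 0 < g t) (hgint : ∀ t, 0 ≤ t → IntegrableOn g (Ioc 0 t) volume)
    (hR : 0 < R) (hu₀_nonneg : 0 ≤ᵐ[volume] u₀) (hu₁_nonneg : 0 ≤ᵐ[volume] u₁)
    (hu₀_supp : ∀ᵐ x ∂volume, R < ‖x‖ → u₀ x = 0)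
    (hu₁_supp : ∀ᵐ x ∂volume, R < ‖x‖ → u₁ x = 0) (hu₁_ne : ¬ u₁ =ᵐ[volume] 0) :
    ∃ c : ℝ, 0 < c ∧ ∀ t : ℝ, 1 ≤ t → c * t ^ ((m : ℝ) * (1 - p / 2)) ≤ ∫ x, |u t x| ^ p := by
  have hp := h.one_lt
  have hp0 : 0 < p := by linarith
  have hp1 : 0 < p - 1 := by linarith
  have hu₁i : Integrable u₁ := by
    have := integrable_mul_of_support hu₁ hu₁_supp (h := fun _ => 1) continuous_const
    simpa only [mul_one] using this
  have hI : 0 < ∫ x, u₁ x := by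
    refine lt_of_le_of_ne (integral_nonneg_of_ae hu₁_nonneg) fun h0 => hu₁_ne ?_
    exact (integral_eq_zero_iff_of_nonneg_ae hu₁_nonneg hu₁i).1 h0.symm
  set I := ∫ x, u₁ x with hIdef
  set c₀ := Real.exp (-R) * I / 4 with hc₀
  have hc₀0 : 0 < c₀ := by positivity
  set V := (volume (Metric.closedBall (0 : E (m + 1)) 1)).toReal with hV
  have hV0 : 0 < V := ENNReal.toReal_pos
    (Metric.measure_closedBall_pos volume _ one_pos).ne' (isCompact_closedBall _ _).measure_lt_top.ne
  set a := Real.sqrt (4 * Real.pi * (R + 1)) with ha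
  have ha0 : 0 < a := Real.sqrt_pos.2 (by positivity)
  set b := Real.sqrt (4 * Real.pi) with hb
  have hb0 : 0 < b := Real.sqrt_pos.2 (by positivity)
  set d := c₀ ^ p / (2 * Real.exp R * a ^ m) ^ (p - 1) with hd
  have hd0 : 0 < d := by positivity
  refine ⟨d * V / (2 * Real.exp R * b ^ m), by positivity, fun t ht => ?_⟩
  have ht0 : 0 < t := by linarith
  obtain ⟨hum, hui, hus⟩ := hu.slice_regularity h hu₁ hgpos hgint hu₀_supp hu₁_supp ht0.le
  have hκ : ∀ w : E (m + 1), ‖w‖ = 1 → d * t ^ (-((m : ℝ) * (p - 1) / 2)) ≤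
      ∫ x, |u t x| ^ p * Real.exp (inner ℝ w x - t) := by
    intro w hw
    have h1 := hu.exp_moment_lower_bound h hu₁ hgpos hgint hR hu₀_nonneg hu₁_nonneg hu₀_supp
      hu₁_supp hw ht0.le
    -- For t ≥ 1 one has e^(-t) ≤ 1 ≤ e^t/2, hence sinh t ≥ e^t/4; this is the 4 in `c₀`.
    have h2 : c₀ * Real.exp t ≤ ∫ x, u t x * Real.exp (inner ℝ w x) := by
      refine le_trans ?_ h1
      have e1 : Real.exp (-t) ≤ Real.exp t / 2 := by
        have e2 : 2 ≤ Real.exp t := by linarith [Real.add_one_le_exp t]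
        have e3 : Real.exp (-t) ≤ 1 := Real.exp_le_one_iff.2 (by linarith)
        linarith
      have e4 : Real.exp t / 4 ≤ (Real.exp t - Real.exp (-t)) / 2 := by linarith
      calc c₀ * Real.exp t = Real.exp (-R) * I * (Real.exp t / 4) := by rw [hc₀]; ring
        _ ≤ _ := by gcongr
    have h3 := rpow_abs_integral_mul_le hp hum hui (h := fun x => Real.exp (inner ℝ w x))
      (by fun_prop) (fun x => Real.exp_pos _) hus
    have h4 : ∫ x in Metric.closedBall (0 : E (m + 1)) (R + t), Real.exp (inner ℝ w x) ≤
        2 * Real.exp R * a ^ m * (Real.exp t * t ^ ((m : ℝ) / 2)) := by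
      refine (integral_exp_inner_ball_le hw (by linarith)).trans ?_
      have e1 : Real.sqrt (4 * Real.pi * (R + t)) ≤ a * t ^ (1 / 2 : ℝ) := by
        rw [ha, ← Real.sqrt_eq_rpow, ← Real.sqrt_mul (by positivity)]
        refine Real.sqrt_le_sqrt ?_
        rw [mul_assoc (4 * Real.pi)]
        refine mul_le_mul_of_nonneg_left ?_ (by positivity)
        nlinarith
      calc 2 * Real.exp (R + t) * Real.sqrt (4 * Real.pi * (R + t)) ^ m
          ≤ 2 * Real.exp (R + t) * (a * t ^ (1 / 2 : ℝ)) ^ m := by gcongr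
        _ = _ := by
          rw [mul_pow, ← Real.rpow_natCast (t ^ (1 / 2 : ℝ)), ← Real.rpow_mul ht0.le, Real.exp_add,
            one_div_mul_eq_div]
          ring
    have h5 : ∫ x, |u t x| ^ p * Real.exp (inner ℝ w x - t) =
        Real.exp (-t) * ∫ x, |u t x| ^ p * Real.exp (inner ℝ w x) := by
      rw [← integral_const_mul]
      congr 1; funext x
      rw [sub_eq_add_neg, Real.exp_add]
      ring
    set J := ∫ x, |u t x| ^ p * Real.exp (inner ℝ w x) with hJ
    have hJ0 : 0 ≤ J := integral_nonneg fun x => by positivity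
    have h6 : (c₀ * Real.exp t) ^ p ≤
        J * (2 * Real.exp R * a ^ m * (Real.exp t * t ^ ((m : ℝ) / 2))) ^ (p - 1) := by
      calc (c₀ * Real.exp t) ^ p ≤ |∫ x, u t x * Real.exp (inner ℝ w x)| ^ p := by
            gcongr
            exact h2.trans (le_abs_self _)
        _ ≤ _ := h3
        _ ≤ _ := by
            refine mul_le_mul_of_nonneg_left (Real.rpow_le_rpow ?_ h4 hp1.le) hJ0
            exact integral_nonneg fun x => (Real.exp_pos _).le
    rw [Real.mul_rpow hc₀0.le (Real.exp_pos t).le,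
      Real.mul_rpow (x := 2 * Real.exp R * a ^ m) (by positivity) (by positivity),
      Real.mul_rpow (x := Real.exp t) (by positivity) (by positivity), ← Real.exp_mul, ← Real.exp_mul,
      ← Real.rpow_mul ht0.le] at h6
    rw [h5, hd, div_mul_eq_mul_div, div_le_iff₀ (by positivity), Real.rpow_neg ht0.le,
      ← div_eq_mul_inv, div_le_iff₀ (by positivity)]
    have e5 : (m : ℝ) / 2 * (p - 1) = (m : ℝ) * (p - 1) / 2 := by ring
    rw [e5] at h6
    have e6 : Real.exp (t * p) = Real.exp (t * (p - 1)) * Real.exp t := by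
      rw [← Real.exp_add]; ring_nf
    have e7 : Real.exp (-t) * Real.exp t = 1 := by rw [← Real.exp_add]; simp
    refine le_of_mul_le_mul_right ?_ (Real.exp_pos (t * p))
    refine h6.trans (le_of_eq ?_)
    rw [e6]
    linear_combination (-(J * (2 * Real.exp R * a ^ m) ^ (p - 1) * Real.exp (t * (p - 1)) *
      t ^ ((m : ℝ) * (p - 1) / 2))) * e7
  have hF0 : ∀ᵐ x, R + t < ‖x‖ → |u t x| ^ p = 0 := by
    filter_upwards [hus] with x hx hx'
    rw [hx hx', abs_zero, Real.zero_rpow hp0.ne']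
  have h7 := mass_lower_bound_of_exp_moments hR.le ht0 hui
    (fun x => Real.rpow_nonneg (abs_nonneg _) _) hF0 hκ
  have e8 : Real.sqrt (Real.pi / (t / 4)) ^ m = b ^ m * t ^ (-((m : ℝ) / 2)) := by
    have e9 : Real.sqrt (Real.pi / (t / 4)) = b * t ^ (-(1 / 2) : ℝ) := by
      rw [hb, Real.rpow_neg ht0.le, ← Real.sqrt_eq_rpow, ← div_eq_mul_inv,
        ← Real.sqrt_div (by positivity)]
      congr 1
      field_simp
    rw [e9, mul_pow, ← Real.rpow_natCast (t ^ (-(1 / 2) : ℝ)), ← Real.rpow_mul ht0.le]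
    congr 2
    ring
  rw [e8, ← hV] at h7
  rw [div_mul_eq_mul_div, div_le_iff₀ (by positivity)]
  have e10 : t ^ ((m : ℝ) * (1 - p / 2)) =
      t ^ (-((m : ℝ) * (p - 1) / 2)) * t ^ ((m : ℝ) / 2) := by
    rw [← Real.rpow_add ht0]
    congr 1
    ring
  have e11 : t ^ (-((m : ℝ) / 2)) * t ^ ((m : ℝ) / 2) = 1 := by
    rw [← Real.rpow_add ht0]; simp
  calc d * V * t ^ ((m : ℝ) * (1 - p / 2))
      = (d * t ^ (-((m : ℝ) * (p - 1) / 2)) * V) * t ^ ((m : ℝ) / 2) := by rw [e10]; ring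
    _ ≤ (2 * Real.exp R * (b ^ m * t ^ (-((m : ℝ) / 2))) * ∫ x, |u t x| ^ p) *
        t ^ ((m : ℝ) / 2) := mul_le_mul_of_nonneg_right h7 (by positivity)
    _ = _ := by
        linear_combination (2 * Real.exp R * b ^ m * ∫ x, |u t x| ^ p) * e11

/-- Hölder's inequality with the constant weight; for t ≥ 1 the radius R + t is at most (R + 1)t, so
the ball has volume of order t^(m+1). -/
theorem IsEnergySolution.exists_mean_power_bound (h : AdmissibleExponent (m + 1) p)
    (hu : IsEnergySolution g p u₀ u₁ ⊤ u) (hu₁ : MemLp u₁ 2 volume)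
    (hgpos : ∀ t, 0 < t → 0 < g t) (hgint : ∀ t, 0 ≤ t → IntegrableOn g (Ioc 0 t) volume)
    (hR : 0 < R) (hu₀_supp : ∀ᵐ x ∂volume, R < ‖x‖ → u₀ x = 0)
    (hu₁_supp : ∀ᵐ x ∂volume, R < ‖x‖ → u₁ x = 0) :
    ∃ c : ℝ, 0 < c ∧ ∀ t : ℝ, 1 ≤ t →
      c * t ^ (-(((m : ℝ) + 1) * (p - 1))) * |∫ x, u t x| ^ p ≤ ∫ x, |u t x| ^ p := by
  have hp := h.one_lt
  have hp1 : 0 < p - 1 := by linarith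
  set V := (volume (Metric.closedBall (0 : E (m + 1)) (R + 1))).toReal with hV
  have hV0 : 0 < V := ENNReal.toReal_pos
    (Metric.measure_closedBall_pos volume _ (by linarith)).ne'
    (isCompact_closedBall _ _).measure_lt_top.ne
  refine ⟨(V ^ (p - 1))⁻¹, by positivity, fun t ht => ?_⟩
  have ht0 : 0 < t := by linarith
  obtain ⟨hum, hui, hus⟩ := hu.slice_regularity h hu₁ hgpos hgint hu₀_supp hu₁_supp ht0.le
  have hus' : ∀ᵐ x, (R + 1) * t < ‖x‖ → u t x = 0 := by
    filter_upwards [hus] with x hx hx'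
    exact hx (by nlinarith)
  have h3 := rpow_abs_integral_mul_le hp hum hui (h := fun _ => 1) continuous_const
    (fun _ => one_pos) hus'
  have e1 : (volume (Metric.closedBall (0 : E (m + 1)) ((R + 1) * t))).toReal = t ^ (m + 1) * V := by
    have h1 := Measure.addHaar_closedBall_mul (volume : Measure (E (m + 1))) 0 ht0.le
      (show 0 ≤ R + 1 by linarith)
    rw [mul_comm (R + 1) t, h1, ENNReal.toReal_mul, ENNReal.toReal_ofReal (by positivity)]
    simp [hV]
  simp only [mul_one, integral_const, smul_eq_mul, measureReal_def] at h3
  rw [Measure.restrict_apply_univ, e1, Real.mul_rpow (by positivity) hV0.le,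
    ← Real.rpow_natCast, ← Real.rpow_mul ht0.le] at h3
  push_cast at h3
  rw [Real.rpow_neg ht0.le, ← mul_inv, inv_mul_le_iff₀ (by positivity)]
  refine h3.trans (le_of_eq ?_)
  ring

/-- There is no energy solution on `[0, ∞)` when the primitive of the kernel grows faster than the
critical power. -/
theorem IsEnergySolution.not_global (h : AdmissibleExponent (m + 1) p)
    (hu : IsEnergySolution g p u₀ u₁ ⊤ u) (hu₁ : MemLp u₁ 2 volume)
    (hgpos : ∀ t, 0 < t → 0 < g t) (hgint : ∀ t, 0 ≤ t → IntegrableOn g (Ioc 0 t) volume)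
    (hG : ∀ M : ℝ, ∃ t₁ : ℝ, 1 ≤ t₁ ∧ ∀ t, t₁ ≤ t → ∀ θ : ℝ, 0 < θ → θ ≤ 1 →
      M * θ ^ 3 * t ^ criticalExponent (m + 1) p ≤ ∫ s in (0 : ℝ)..θ * t, g s)
    (hR : 0 < R) (hu₀_nonneg : 0 ≤ᵐ[volume] u₀) (hu₁_nonneg : 0 ≤ᵐ[volume] u₁)
    (hu₀_supp : ∀ᵐ x ∂volume, R < ‖x‖ → u₀ x = 0)
    (hu₁_supp : ∀ᵐ x ∂volume, R < ‖x‖ → u₁ x = 0) (hu₁_ne : ¬ u₁ =ᵐ[volume] 0) : False := by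
  obtain ⟨c₁, hc₁, hf₁⟩ := hu.exists_nonlinearity_lower_bound h hu₁ hgpos hgint hR hu₀_nonneg
    hu₁_nonneg hu₀_supp hu₁_supp hu₁_ne
  obtain ⟨c₂, hc₂, hf₂⟩ := hu.exists_mean_power_bound h hu₁ hgpos hgint hR hu₀_supp hu₁_supp
  have hU : ∀ s k t L : ℝ, 0 ≤ s → 0 < k → s + 2 * k ≤ t → 0 ≤ L →
      (∀ τ ∈ Icc s t, L ≤ ∫ x, |u τ x| ^ p) →
      k ^ 2 / 2 * L * (∫ r in (0 : ℝ)..k, g r) ≤ ∫ x, u t x := fun s k t L hs hk hst hL hfL =>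
    hu.mean_lower_bound h hu₁ hgpos hgint hR hu₀_nonneg hu₁_nonneg hu₀_supp hu₁_supp hs hk hst hL
      hfL
  have hp0 : p ≠ 0 := by linarith [h.one_lt]
  -- Equating the two growth laws k = e + 2 + a and k = kp - b + e + 2, with a = m(1 - p/2), gives
  -- this `k` and the critical value of e.
  refine no_global_of_integral_inequality (k := ((m : ℝ) + 2) / 2 - 1 / p)
    (b := ((m : ℝ) + 1) * (p - 1)) h.one_lt hc₁ hc₂ (U := fun t => ∫ x, u t x)
    (f := fun t => ∫ x, |u t x| ^ p) (G := fun k => ∫ r in (0 : ℝ)..k, g r) hU hG hf₁ ?_ ?_ ?_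
  · intro τ hτ
    -- With L = 0 the lower bound says that the mean is nonnegative, so the absolute value can be
    -- dropped.
    have h0 := hU 0 (τ / 2) τ 0 le_rfl (by linarith) (by linarith) le_rfl fun r _ =>
      integral_nonneg fun x => Real.rpow_nonneg (abs_nonneg _) _
    have h1 := hf₂ τ hτ
    rwa [abs_of_nonneg (by simpa using h0)] at h1
  · rw [criticalExponent]
    push_cast
    ring
  · rw [criticalExponent]
    push_cast
    field_simp
    ring

end Nonexistence

end MemoryWave

end

theorem corollary2p1 (n : ℕ) (hn : 1 ≤ n) (p : ℝ) (hp : 1 < p)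
    (hpn : 3 ≤ n → p ≤ (n : ℝ) / ((n : ℝ) - 2))
    (T : ℝ≥0∞) (hT : 0 < T) (g : ℝ → ℝ)
    (hgpos : ∀ t ∈ MemoryWave.timeSpan T, 0 < t → 0 < g t)
    (hgint : ∀ t ∈ MemoryWave.timeSpan T, IntegrableOn g (Ioc 0 t) volume)
    (r : ℕ)
    (hg : MemoryWave.SlowKernel n p r T g ∨ MemoryWave.FastKernel n p T g)
    (R : ℝ) (hR : 0 < R) (u₀ u₁ : MemoryWave.E n → ℝ)
    (hu₀ : MemoryWave.MemH1 u₀) (hu₁ : MemLp u₁ 2 volume)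
    (hu₀_nonneg : 0 ≤ᵐ[volume] u₀) (hu₁_nonneg : 0 ≤ᵐ[volume] u₁)
    (hu₀_supp : ∀ᵐ x ∂volume, R < ‖x‖ → u₀ x = 0)
    (hu₁_supp : ∀ᵐ x ∂volume, R < ‖x‖ → u₁ x = 0)
    (hu₁_ne : ¬ u₁ =ᵐ[volume] 0)
    (u : ℝ → MemoryWave.E n → ℝ)
    (hu : MemoryWave.IsEnergySolution g p u₀ u₁ T u) :
    (∀ t ∈ MemoryWave.timeSpan T, ∀ᵐ x ∂volume, R + t < ‖x‖ → u t x = 0) ∧ T < ⊤ := by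
  have h : MemoryWave.AdmissibleExponent n p := ⟨hn, hp, hpn⟩
  refine ⟨fun t ht => hu.eq_zero_of_support h hu₁ hgpos hgint hu₀_supp hu₁_supp ht,
    lt_top_iff_ne_top.2 fun hTop => ?_⟩
  subst hTop
  have hgpos' : ∀ t, 0 < t → 0 < g t := fun t ht => hgpos t ⟨ht.le, ENNReal.ofReal_lt_top⟩ ht
  have hgint' : ∀ t, 0 ≤ t → IntegrableOn g (Ioc 0 t) volume := fun t ht =>
    hgint t ⟨ht, ENNReal.ofReal_lt_top⟩
  have hG : ∀ M : ℝ, ∃ t₁ : ℝ, 1 ≤ t₁ ∧ ∀ t, t₁ ≤ t → ∀ θ : ℝ, 0 < θ → θ ≤ 1 →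
      M * θ ^ 3 * t ^ MemoryWave.criticalExponent n p ≤ ∫ s in (0 : ℝ)..θ * t, g s :=
    hg.elim (fun hs => hs.integral_lower_bound hgint')
      fun hf => hf.integral_lower_bound hn hp hgpos' hgint'
  -- Here m = n - 1 counts the dimensions transverse to a direction.
  obtain ⟨m, rfl⟩ := Nat.exists_eq_add_of_le' hn
  exact hu.not_global h hu₁ hgpos' hgint' hG hR hu₀_nonneg hu₁_nonneg hu₀_supp hu₁_supp hu₁_ne
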